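/- A homogeneous group is a simply connected nilpotent Lie group $G$ with Lie algebra $\mathfrak g$, together with a diagonalizable linear operator $A$ on $\mathfrak g$ with positive eigenvalues such that the maps $\delta_t=\exp\circ\, e^{A\log t}\circ\exp^{-1}$, $t>0$, are automorphisms of $G$; $Q=\operatorname{tr}A$ is its homogeneous dimension. A homogeneous norm on $G$ is a continuous function $r:G\to[0,\infty)$, smooth on $G\setminus\{e\}$, with $r(x^{-1})=r(x)$, $r(\delta_t x)=t\,r(x)$ for $t>0$, $r(x)=0$ iff $x=e$, and $r(xy)\le c_0(r(x)+r(y))$ for some $c_0>0$. Write $B(e,t)=\{y: r(y^{-1})<t\}$, and let $dx$ be the Haar measure with $|B(e,1)|=1$. Let $G_1,G_2$ be homogeneous groups with neutral elements $e_i$, homogeneous norms $r_i$ and homogeneous dimensions $Q_i$. A weight is a measurable, everywhere positive (finite) function. A function $f:G_1\times G_2\to[0,\infty)$ is radially decreasing if $f(x,y)=\varphi(r_1(x),r_2(y))$ for all $x\ne e_1$, $y\neq e_2$, where $\varphi:(0,\infty)^2\to[0,\infty)$ is decreasing (non-increasing) in each variable separately. For a weight $w$, $L^p_{dec,r}(w,G_1\times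 G_2)$ is the cone of measurable radially decreasing $f$ with $\|f\|_{L^p(w)}=\big(\iint f^p w\,dx\,dy\big)^{1/p}<\infty$, and $$(H^{1,1}f)(x,y)=\int_{B(e_1,r_1(x))}\int_{B(e_2,r_2(y))}f(t,\tau)\,dt\,d\tau\in[0,\infty].$$ $H^{1,1}$ is bounded from $L^p_{dec,r}(w,G_1\times G_2)$ to $L^q(v,G_1\times G_2)$ if there is $C<\infty$ with $\big(\iint (H^{1,1}f)^q v\,dx\,dy\big)^{1/q}\le C\|f\|_{L^p(w)}$ for all $f\in L^p_{dec,r}(w,G_1\times G_2)$. **Proposition.** Let $1<p\le q<\infty$, $p'=p/(p-1)$. Let $v$ and $w$ be weights on $G_1\times G_2$ with $w(x,y)=w_1(x)w_2(y)$, where $w_i$ is a weight on $G_i$ with $\int_{G_i}w_i=\infty$, $i=1,2$. Put $W_i(t)=\int_{B(e_i,t)}w_i$ and $W(t,\tau)=\iint_{B(e_1,t)\times B(e_2,\tau)}w$. Then $H^{1,1}$ is bounded from $L^p_{dec,r}(w,G_1\times G_2)$ to $L^q(v,G_1\times G_2)$ if and only if the following four conditions hold (suprema over all $a_1,a_2>0$;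 in $[0,\infty]$, with $1/\infty=0$ and $0\cdot\infty=0$): (i) $\displaystyle\sup_{a_1,a_2}\Big(\int_{B(e_1,a_1)}\int_{B(e_2,a_2)}w(x,y)\,dx\,dy\Big)^{-1/p}\Big(\int_{B(e_1,a_1)}\int_{B(e_2,a_2)}r_1(x)^{Q_1q}r_2(y)^{Q_2q}v(x,y)\,dx\,dy\Big)^{1/q}<\infty$; (ii) $\displaystyle\sup_{a_1,a_2}\Big(\int_{B(e_1,a_1)}\int_{B(e_2,a_2)}r_1(x)^{Q_1p'}r_2(y)^{Q_2p'}W(r_1(x),r_2(y))^{-p'}w(x,y)\,dx\,dy\Big)^{1/p'}\Big(\int_{G_1\setminus B(e_1,a_1)}\int_{G_2\setminus B(e_2,a_2)}v(x,y)\,dx\,dy\Big)^{1/q}<\infty$; (iii) $\displaystyle\sup_{a_1,a_2}\Big(\int_{B(e_1,a_1)}w_1(x)\,dx\Big)^{-1/p}\Big(\int_{B(e_2,a_2)}r_2(y)^{Q_2p'}W_2(r_2(y))^{-p'}w_2(y)\,dy\Big)^{1/p'}\Big(\int_{B(e_1,a_1)}\int_{G_2\setminus B(e_2,a_2)}r_1(x)^{Q_1q}v(x,y)\,dx\,dy\Big)^{1/q}<\infty$;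 (iv) $\displaystyle\sup_{a_1,a_2}\Big(\int_{B(e_1,a_1)}r_1(x)^{Q_1p'}W_1(r_1(x))^{-p'}w_1(x)\,dx\Big)^{1/p'}\Big(\int_{B(e_2,a_2)}w_2(y)\,dy\Big)^{-1/p}\Big(\int_{G_1\setminus B(e_1,a_1)}\int_{B(e_2,a_2)}r_2(y)^{Q_2q}v(x,y)\,dx\,dy\Big)^{1/q}<\infty$. -/

import Mathlib

open MeasureTheory Set
open scoped NNReal ENNReal ContDiff Manifold

noncomputable section

/-- A homogeneous group structure on a simply connected nilpotent real Lie group `G`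
(modelled on `E`, so that the Lie algebra `T_e G` has underlying vector space `E`).
`A` is a diagonalizable linear operator of the Lie algebra with positive eigenvalues, and
`δ t` (`t > 0`) is the one-parameter group of Lie group automorphisms of `G` induced by
`t ^ A = exp (log t • A)`: the automorphism of `G` whose differential at the neutral element is
`t ^ A`. By naturality of the exponential map of `G` this says `δ t = exp ∘ t ^ A ∘ exp⁻¹`. -/
structure HomogeneousGroup
    (E : Type*) [NormedAddCommGroup E] [NormedSpace ℝ E] [FiniteDimensional ℝ E]
    (G : Type*) [TopologicalSpace G] [T2Space G] [SecondCountableTopology G]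
    [ChartedSpace E G] [Group G] [LieGroup 𝓘(ℝ, E) ∞ G]
    [SimplyConnectedSpace G] [Group.IsNilpotent G] where
  /-- the generator of the dilations, an operator on the Lie algebra `T_e G`, which in Mathlib is
  `E` (identified through the preferred chart at the neutral element) -/
  A : E →L[ℝ] E
  /-- `A` is diagonalizable with positive eigenvalues -/
  diagonalizable : ∃ (b : Module.Basis (Fin (Module.finrank ℝ E)) ℝ E)
      (d : Fin (Module.finrank ℝ E) → ℝ), ∀ i, 0 < d i ∧ A (b i) = d i • b i
  /-- the dilations (only the values for `t > 0` matter) -/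
  δ : ℝ → G → G
  δ_one : ∀ x, δ 1 x = x
  δ_comp : ∀ s t, 0 < s → 0 < t → ∀ x, δ s (δ t x) = δ (s * t) x
  δ_mul : ∀ t, 0 < t → ∀ x y, δ t (x * y) = δ t x * δ t y
  δ_smooth : ∀ t, 0 < t → ContMDiff 𝓘(ℝ, E) 𝓘(ℝ, E) ∞ (δ t)
  δ_deriv : ∀ t, 0 < t →
    HasMFDerivAt 𝓘(ℝ, E) 𝓘(ℝ, E) (δ t) (1 : G)
      (NormedSpace.exp (Real.log t • A) : E →L[ℝ] E)

section

variable {E : Type*} [NormedAddCommGroup E] [NormedSpace ℝ E] [FiniteDimensional ℝ E]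
  {G : Type*} [TopologicalSpace G] [T2Space G] [SecondCountableTopology G]
  [ChartedSpace E G] [Group G] [LieGroup 𝓘(ℝ, E) ∞ G]
  [SimplyConnectedSpace G] [Group.IsNilpotent G]

/-- The homogeneous dimension `Q = tr A`. -/
def HomogeneousGroup.Q (D : HomogeneousGroup E G) : ℝ :=
  LinearMap.trace ℝ E D.A.toLinearMap

/-- `r` is a homogeneous norm on the homogeneous group `G`. -/
structure HomogeneousGroup.IsHomogeneousNorm (D : HomogeneousGroup E G) (r : G → ℝ) :
    Prop where
  nonneg : ∀ x, 0 ≤ r x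
  continuous : Continuous r
  smooth : ContMDiffOn 𝓘(ℝ, E) 𝓘(ℝ, ℝ) ∞ r {1}ᶜ
  inv : ∀ x, r x⁻¹ = r x
  dilation : ∀ x, ∀ t, 0 < t → r (D.δ t x) = t * r x
  eq_zero_iff : ∀ x, r x = 0 ↔ x = 1
  triangle : ∃ c₀ : ℝ, 0 < c₀ ∧ ∀ x y, r (x * y) ≤ c₀ * (r x + r y)

end

/-- The open ball `B(a, t) = {y | r (a y⁻¹) < t}`. -/
def hball {G : Type*} [Group G] (r : G → ℝ) (a : G) (t : ℝ) : Set G :=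
  {y | r (a * y⁻¹) < t}

/-- A weight: a measurable, everywhere positive (finite) function. -/
def IsWeight {X : Type*} [MeasurableSpace X] (μ : Measure X) (ρ : X → ℝ) : Prop :=
  AEMeasurable ρ μ ∧ ∀ x, 0 < ρ x

/-- `(∫ f ^ p ρ dμ) ^ (1 / p)` for a nonnegative function `f`. -/
def wNorm {X : Type*} [MeasurableSpace X] (μ : Measure X) (p : ℝ) (ρ : X → ℝ)
    (f : X → ℝ≥0∞) : ℝ≥0∞ :=
  (∫⁻ x, f x ^ p * ENNReal.ofReal (ρ x) ∂μ) ^ (1 / p)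

/-- `W(t) = ∫_{B(e, t)} w`. -/
def ballMass {G : Type*} [Group G] [MeasurableSpace G] (μ : Measure G) (r : G → ℝ)
    (w : G → ℝ) (t : ℝ) : ℝ≥0∞ :=
  ∫⁻ x in hball r 1 t, ENNReal.ofReal (w x) ∂μ

section

variable {G₁ G₂ : Type*} [Group G₁] [Group G₂]

/-- Radially decreasing functions on `G₁ × G₂`: functions of `(r₁ x, r₂ y)` that decrease in each
of these two variables in `(0, ∞)`. Unboundedness near the neutral elements is allowed, and the
values on the null set where `x = e₁` or `y = e₂` are irrelevant. -/
def RadiallyDecreasing (r₁ : G₁ → ℝ) (r₂ : G₂ → ℝ) (f : G₁ × G₂ → ℝ≥0) : Prop :=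
  ∃ φ : ℝ → ℝ → ℝ≥0,
    (∀ τ, 0 < τ → AntitoneOn (fun t => φ t τ) (Ioi 0)) ∧
    (∀ t, 0 < t → AntitoneOn (fun τ => φ t τ) (Ioi 0)) ∧
    ∀ x y, x ≠ 1 → y ≠ 1 → f (x, y) = φ (r₁ x) (r₂ y)

variable [MeasurableSpace G₁] [MeasurableSpace G₂]

/-- `W(t, τ) = ∫_{B(e₁, t) × B(e₂, τ)} w`. -/
def ballMass₂ (μ₁ : Measure G₁) (μ₂ : Measure G₂) (r₁ : G₁ → ℝ) (r₂ : G₂ → ℝ)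
    (w : G₁ × G₂ → ℝ) (t τ : ℝ) : ℝ≥0∞ :=
  ∫⁻ z in hball r₁ 1 t ×ˢ hball r₂ 1 τ, ENNReal.ofReal (w z) ∂(μ₁.prod μ₂)

/-- The cone `L^p_{dec,r}(w, G₁ × G₂)`. -/
def MemLpDec (μ₁ : Measure G₁) (μ₂ : Measure G₂) (r₁ : G₁ → ℝ) (r₂ : G₂ → ℝ) (p : ℝ)
    (w : G₁ × G₂ → ℝ) (f : G₁ × G₂ → ℝ≥0) : Prop :=
  AEMeasurable f (μ₁.prod μ₂) ∧ RadiallyDecreasing r₁ r₂ f ∧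
    wNorm (μ₁.prod μ₂) p w (fun z => (f z : ℝ≥0∞)) < ⊤

/-- The double Hardy operator `H^{a,b}`. -/
def doubleHardy (μ₁ : Measure G₁) (μ₂ : Measure G₂) (r₁ : G₁ → ℝ) (r₂ : G₂ → ℝ) (a b : ℝ)
    (f : G₁ × G₂ → ℝ≥0) (z : G₁ × G₂) : ℝ≥0∞ :=
  ∫⁻ s in hball r₁ 1 (a * r₁ z.1) ×ˢ hball r₂ 1 (b * r₂ z.2), (f s : ℝ≥0∞) ∂(μ₁.prod μ₂)

/-- `T` is bounded from `L^p_{dec,r}(w, G₁ × G₂)` to `L^q(v, G₁ × G₂)`. -/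
def BoundedOnDec (μ₁ : Measure G₁) (μ₂ : Measure G₂) (r₁ : G₁ → ℝ) (r₂ : G₂ → ℝ) (p q : ℝ)
    (w v : G₁ × G₂ → ℝ) (T : (G₁ × G₂ → ℝ≥0) → G₁ × G₂ → ℝ≥0∞) : Prop :=
  ∃ C : ℝ≥0, ∀ f : G₁ × G₂ → ℝ≥0, MemLpDec μ₁ μ₂ r₁ r₂ p w f →
    wNorm (μ₁.prod μ₂) q v (T f) ≤
      C * wNorm (μ₁.prod μ₂) p w (fun z => (f z : ℝ≥0∞))

end

end

/-! Everything happens on the scale of masses. Write `ρᵢ = wᵢ dx`, `Wᵢ(t) = ρᵢ(B(e, t))`, and let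
`Rᵢ` be the generalized inverse of `Wᵢ`, which is finite because `ρᵢ` has infinite total mass. Balls
have Haar measure `t ^ Q`, so spheres are null and `Wᵢ ∘ rᵢ` pushes `ρᵢ` forward to Lebesgue
measure, as in the probability integral transform.

Sufficiency. Let `g(l, m)` be `1 / (l m)` times the integral of `f` over `{W₁ ∘ r₁ ≤ l} × {W₂ ∘ r₂ ≤
m}` against `ρ₁ × ρ₂`. Monotonicity gives `f(x, y) ≤ ∬ g(l, m) dl dm / (l m)` over `l ≥ W₁(r₁ x)`,
`m ≥ W₂(r₂ y)` (`le_lintegral_massAverage`), and Hardy's inequality gives `‖g‖_p ≤ C ‖f‖_p`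
(`lintegral_massAverage_rpow_le`). Integrating the majorant over the product of balls, each variable
contributes `R(l) ^ Q` if `R(l) ≤ r(x)` and `r(x) ^ Q` otherwise. The product of two such sums is a
sum of four Hardy operators acting on the arbitrary function `g`: head or tail in each variable.
This replaces duality on the cone of decreasing functions.

Each of the four is controlled by one of the conditions (i)-(iv). This rests on `two_dim_hardy`: for
a kernel whose domain weight is a product and `p ≤ q`, a single Muckenhoupt-type condition suffices
in dimension two. The proof bounds the p-th power of the operator by the integral of p-th powers of
averages over the box `[X, 2X] × [Y, 2Y]`, where `X`, `Y` are the kernel masses; for each fixed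
point of the quadrant, the condition bounds the measure of the targets whose box contains it.

Necessity. Tensor products of one-dimensional test functions are used: the indicator of a ball, and
a tail integral of `k ^ (p' - 1) / W` with `k = r ^ Q / W`, whose norm is bounded by the dual Hardy
inequality (`hasHardyTests_ball`, `exists_hasHardyTests_compl`).

Geometry. That `|B(e, t)| = t ^ Q` has to be derived from the Lie group structure (`measure_ball`).
Uniqueness of Haar measure makes `t ↦ |B(e, t)|` multiplicative. In a chart Haar measure is
comparable with Lebesgue measure, and the dilation is differentiable with determinant `t ^ Q` at the
neutral element. Iterating the dilation and taking n-th roots removes the comparison constants. -/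

/-! ### Power integrals, and functions whose distribution is dominated by Lebesgue measure. -/

theorem measurableSet_le_and_le {α β : Type*} [MeasurableSpace α] [TopologicalSpace β]
    [MeasurableSpace β] [OpensMeasurableSpace β] [LinearOrder β] [OrderClosedTopology β]
    [SecondCountableTopology β] {f g f' g' : α → β} (hf : Measurable f) (hg : Measurable g) (hf' : Measurable f') (hg' : Measurable g') :
    MeasurableSet {a | f a ≤ g a ∧ f' a ≤ g' a} :=
  (measurableSet_le hf hg).inter (measurableSet_le hf' hg')

theorem lintegral_Ioi_rpow_tail {β : ℝ} (hβ : 0 < β) {x : ℝ≥0∞} (hx : x ≠ 0) :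
    ∫⁻ u in Ioi (0 : ℝ), (if x ≤ ENNReal.ofReal u then ENNReal.ofReal u ^ (-1 - β) else 0)
      = ENNReal.ofReal β⁻¹ * x ^ (-β) := by
  by_cases hxt : x = ⊤
  · subst hxt
    simp [hβ]
  lift x to ℝ≥0 using hxt
  have hx0 : 0 < (x : ℝ) := by
    have : x ≠ 0 := by simpa using hx
    positivity
  have h1 : ∀ u ∈ Ioi (0 : ℝ),
      (if (x : ℝ≥0∞) ≤ ENNReal.ofReal u then ENNReal.ofReal u ^ (-1 - β) else 0)
        = (Ici (x : ℝ)).indicator (fun u => ENNReal.ofReal (u ^ (-1 - β))) u := by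
    intro u hu
    have hu' : (0 : ℝ) < u := hu
    have : ((x : ℝ≥0∞) ≤ ENNReal.ofReal u) ↔ u ∈ Ici (x : ℝ) := by
      rw [← ENNReal.ofReal_coe_nnreal, ENNReal.ofReal_le_ofReal_iff hu'.le]; rfl
    by_cases h : u ∈ Ici (x : ℝ)
    · rw [if_pos (this.2 h), indicator_of_mem h, ENNReal.ofReal_rpow_of_pos hu']
    · rw [if_neg (fun h' => h (this.1 h')), indicator_of_notMem h]
  rw [setLIntegral_congr_fun measurableSet_Ioi h1, setLIntegral_indicator measurableSet_Ici,
    inter_eq_left.2 (Ici_subset_Ioi.2 hx0), ← setLIntegral_congr Ioi_ae_eq_Ici,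
    ← ofReal_integral_eq_lintegral_ofReal
      (integrableOn_Ioi_rpow_of_lt (by linarith) hx0)
      ((ae_restrict_mem measurableSet_Ioi).mono fun u hu =>
        Real.rpow_nonneg (hx0.trans hu).le _),
    integral_Ioi_rpow_of_lt (by linarith) hx0, ← ENNReal.ofReal_coe_nnreal,
    ENNReal.ofReal_rpow_of_pos hx0, ← ENNReal.ofReal_mul (by positivity)]
  congr 1
  rw [show -1 - β + 1 = -β by ring]
  field_simp

/-- At `x = 0` the right side is infinite, so as an inequality the formula needs no case distinction
in later use. -/
theorem lintegral_Ioi_rpow_tail_le {β : ℝ} (hβ : 0 < β) (x : ℝ≥0∞) :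
    ∫⁻ u in Ioi (0 : ℝ), (if x ≤ ENNReal.ofReal u then ENNReal.ofReal u ^ (-1 - β) else 0)
      ≤ ENNReal.ofReal β⁻¹ * x ^ (-β) := by
  by_cases hx : x = 0
  · subst hx
    rw [ENNReal.zero_rpow_of_neg (by linarith), ENNReal.mul_top (by simpa using hβ)]
    exact le_top
  · exact (lintegral_Ioi_rpow_tail hβ hx).le

theorem lintegral_Ioi_rpow_head {α : ℝ} (hα : α < 1) (x : ℝ≥0) :
    ∫⁻ u in Ioi (0 : ℝ), (if ENNReal.ofReal u ≤ x then ENNReal.ofReal u ^ (-α) else 0)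
      = ENNReal.ofReal (1 - α)⁻¹ * (x : ℝ≥0∞) ^ (1 - α) := by
  have h1 : ∀ u ∈ Ioi (0 : ℝ),
      (if ENNReal.ofReal u ≤ x then ENNReal.ofReal u ^ (-α) else 0)
        = (Iic (x : ℝ)).indicator (fun u => ENNReal.ofReal (u ^ (-α))) u := by
    intro u hu
    have hu' : (0 : ℝ) < u := hu
    have : (ENNReal.ofReal u ≤ (x : ℝ≥0∞)) ↔ u ∈ Iic (x : ℝ) := by
      rw [← ENNReal.ofReal_coe_nnreal (p := x), ENNReal.ofReal_le_ofReal_iff x.coe_nonneg]; rfl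
    by_cases h : u ∈ Iic (x : ℝ)
    · rw [if_pos (this.2 h), indicator_of_mem h, ENNReal.ofReal_rpow_of_pos hu']
    · rw [if_neg (fun h' => h (this.1 h')), indicator_of_notMem h]
  have hI : IntervalIntegrable (fun u : ℝ => u ^ (-α)) volume 0 x :=
    intervalIntegral.intervalIntegrable_rpow' (by linarith)
  rw [setLIntegral_congr_fun measurableSet_Ioi h1, setLIntegral_indicator measurableSet_Iic,
    inter_comm, Ioi_inter_Iic]
  rw [← ofReal_integral_eq_lintegral_ofReal
      ((intervalIntegrable_iff_integrableOn_Ioc_of_le x.coe_nonneg).1 hI)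
      ((ae_restrict_mem measurableSet_Ioc).mono fun u hu => Real.rpow_nonneg hu.1.le _),
    ← intervalIntegral.integral_of_le x.coe_nonneg, integral_rpow (Or.inl (by linarith)),
    ← ENNReal.ofReal_coe_nnreal, ENNReal.ofReal_rpow_of_nonneg x.coe_nonneg (by linarith),
    ← ENNReal.ofReal_mul (by rw [inv_nonneg]; linarith)]
  congr 1
  rw [show -α + 1 = 1 - α by ring, Real.zero_rpow (by linarith), sub_zero]
  field_simp

section distribution

variable {S : Type*} [MeasurableSpace S] {σ : Measure S} [SFinite σ] {Ψ : S → ℝ≥0∞}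

/-- If the distribution of `Ψ` is dominated by Lebesgue measure, so are integrals of its negative
powers over sublevel sets. -/
theorem lintegral_rpow_sublevel_le (hΨm : Measurable Ψ) (hΨ : ∀ c : ℝ≥0, σ {s | Ψ s ≤ c} ≤ c)
    {α : ℝ} (hα0 : 0 < α) (hα1 : α < 1) (x : ℝ≥0∞) :
    ∫⁻ s, (if Ψ s ≤ x then Ψ s ^ (-α) else 0) ∂σ ≤ ENNReal.ofReal (1 - α)⁻¹ * x ^ (1 - α) := by
  by_cases hxt : x = ⊤
  · subst hxt
    rw [ENNReal.top_rpow_of_pos (by linarith), ENNReal.mul_top (by simpa using hα1)]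
    exact le_top
  lift x to ℝ≥0 using hxt
  have h0 : ∀ᵐ s ∂σ, Ψ s ≠ 0 := by
    have := hΨ 0
    simp only [ENNReal.coe_zero, nonpos_iff_eq_zero] at this
    rw [ae_iff]; simpa using this
  -- Layer cake: `Ψ ^ (-α)` is `α` times the integral of `u ^ (-1 - α)` over `u ≥ Ψ`. After Fubini
  -- only `σ {Ψ ≤ min x u} ≤ min x u` is needed.
  have h1 : ∀ᵐ s ∂σ, (if Ψ s ≤ x then Ψ s ^ (-α) else 0) = ENNReal.ofReal α *
      ∫⁻ u in Ioi (0 : ℝ), (if Ψ s ≤ x ∧ Ψ s ≤ ENNReal.ofReal u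
        then ENNReal.ofReal u ^ (-1 - α) else 0) := by
    filter_upwards [h0] with s hs
    by_cases hsx : Ψ s ≤ x
    · simp only [hsx, true_and, if_true]
      rw [lintegral_Ioi_rpow_tail hα0 hs, ← mul_assoc, ← ENNReal.ofReal_mul hα0.le,
        mul_inv_cancel₀ hα0.ne', ENNReal.ofReal_one, one_mul]
    · simp [hsx]
  have hm : Measurable (fun z : S × ℝ => if Ψ z.1 ≤ x ∧ Ψ z.1 ≤ ENNReal.ofReal z.2
        then ENNReal.ofReal z.2 ^ (-1 - α) else 0) :=
    Measurable.ite (measurableSet_le_and_le (by fun_prop) (by fun_prop) (by fun_prop)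
      (by fun_prop)) (by fun_prop) (by fun_prop)
  have h2 : ∀ u ∈ Ioi (0 : ℝ), ∫⁻ s, (if Ψ s ≤ x ∧ Ψ s ≤ ENNReal.ofReal u
        then ENNReal.ofReal u ^ (-1 - α) else 0) ∂σ ≤
      (if ENNReal.ofReal u ≤ x then ENNReal.ofReal u ^ (-α) else 0) +
      x * (if (x : ℝ≥0∞) ≤ ENNReal.ofReal u then ENNReal.ofReal u ^ (-1 - α) else 0) := by
    intro u hu
    have hu0 : ENNReal.ofReal u ≠ 0 := by simpa using hu
    have : ∫⁻ s, (if Ψ s ≤ x ∧ Ψ s ≤ ENNReal.ofReal u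
        then ENNReal.ofReal u ^ (-1 - α) else 0) ∂σ =
        ENNReal.ofReal u ^ (-1 - α) * σ {s | Ψ s ≤ x ∧ Ψ s ≤ ENNReal.ofReal u} := by
      rw [← lintegral_indicator_const (measurableSet_le_and_le (by fun_prop) (by fun_prop) (by fun_prop)
      (by fun_prop))]
      exact lintegral_congr fun s => by simp [indicator_apply]
    rw [this]
    rcases le_total (ENNReal.ofReal u) x with h | h
    · refine le_trans ?_ le_self_add
      rw [if_pos h]
      calc _ ≤ ENNReal.ofReal u ^ (-1 - α) * ENNReal.ofReal u := by
            gcongr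
            exact (measure_mono fun s hs => hs.2).trans (hΨ (Real.toNNReal u))
        _ = _ := by
            nth_rewrite 2 [← ENNReal.rpow_one (ENNReal.ofReal u)]
            rw [← ENNReal.rpow_add _ _ hu0 ENNReal.ofReal_ne_top]; congr 1; ring
    · refine le_trans ?_ le_add_self
      rw [if_pos h, mul_comm]
      gcongr
      exact (measure_mono fun s hs => hs.1).trans (hΨ x)
  calc ∫⁻ s, (if Ψ s ≤ x then Ψ s ^ (-α) else 0) ∂σ
      = ENNReal.ofReal α * ∫⁻ u in Ioi (0 : ℝ), ∫⁻ s, (if Ψ s ≤ x ∧ Ψ s ≤ ENNReal.ofReal u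
        then ENNReal.ofReal u ^ (-1 - α) else 0) ∂σ := by
        rw [lintegral_congr_ae h1, lintegral_const_mul _ hm.lintegral_prod_right',
          lintegral_lintegral_swap hm.aemeasurable]
    _ ≤ ENNReal.ofReal α * ∫⁻ u in Ioi (0 : ℝ),
        ((if ENNReal.ofReal u ≤ x then ENNReal.ofReal u ^ (-α) else 0) +
      x * (if (x : ℝ≥0∞) ≤ ENNReal.ofReal u then ENNReal.ofReal u ^ (-1 - α) else 0)) := by
        gcongr ENNReal.ofReal α * ?_
        exact setLIntegral_mono' measurableSet_Ioi h2
    _ ≤ ENNReal.ofReal α * (ENNReal.ofReal (1 - α)⁻¹ * (x : ℝ≥0∞) ^ (1 - α) +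
        x * (ENNReal.ofReal α⁻¹ * (x : ℝ≥0∞) ^ (-α))) := by
        rw [lintegral_add_left, lintegral_Ioi_rpow_head hα1, lintegral_const_mul]
        · gcongr
          exact lintegral_Ioi_rpow_tail_le hα0 _
        · exact Measurable.ite (measurableSet_le (by fun_prop) (by fun_prop))
            (by fun_prop) (by fun_prop)
        · exact Measurable.ite (measurableSet_le (by fun_prop) (by fun_prop))
            (by fun_prop) (by fun_prop)
    _ ≤ ENNReal.ofReal α * (ENNReal.ofReal (1 - α)⁻¹ * (x : ℝ≥0∞) ^ (1 - α) +
        ENNReal.ofReal α⁻¹ * (x : ℝ≥0∞) ^ (1 - α)) := by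
        gcongr ENNReal.ofReal α * (_ + ?_)
        rw [mul_left_comm]
        gcongr
        by_cases hx0 : x = 0
        · simp [hx0]
        rw [show (1 - α) = 1 + (-α) by ring, ENNReal.rpow_add _ _ (by simpa using hx0) (by simp),
          ENNReal.rpow_one]
    _ = _ := by
        rw [← add_mul, ← mul_assoc, ← ENNReal.ofReal_add (by rw [inv_nonneg]; linarith)
          (by positivity), ← ENNReal.ofReal_mul hα0.le]
        congr 2
        have : 1 - α ≠ 0 := by linarith
        field_simp
        ring

/-- The same layer cake argument: levels `u < x` contribute nothing, and for `u ≥ x` the measure of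
`{x ≤ Ψ ≤ u}` is bounded crudely by `u`, which costs only the factor `1 + β`. -/
theorem lintegral_rpow_superlevel_le (hΨm : Measurable Ψ) (hΨ : ∀ c : ℝ≥0, σ {s | Ψ s ≤ c} ≤ c)
    {β : ℝ} (hβ : 0 < β) (x : ℝ≥0∞) :
    ∫⁻ s, (if x ≤ Ψ s then Ψ s ^ (-1 - β) else 0) ∂σ
      ≤ ENNReal.ofReal ((1 + β) * β⁻¹) * x ^ (-β) := by
  have h0 : ∀ᵐ s ∂σ, Ψ s ≠ 0 := by
    have := hΨ 0
    simp only [ENNReal.coe_zero, nonpos_iff_eq_zero] at this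
    rw [ae_iff]; simpa using this
  have h1 : ∀ᵐ s ∂σ, (if x ≤ Ψ s then Ψ s ^ (-1 - β) else 0) = ENNReal.ofReal (1 + β) *
      ∫⁻ u in Ioi (0 : ℝ), (if x ≤ Ψ s ∧ Ψ s ≤ ENNReal.ofReal u
        then ENNReal.ofReal u ^ (-1 - (1 + β)) else 0) := by
    filter_upwards [h0] with s hs
    by_cases hsx : x ≤ Ψ s
    · simp only [hsx, true_and, if_true]
      rw [lintegral_Ioi_rpow_tail (by linarith) hs, ← mul_assoc,
        ← ENNReal.ofReal_mul (by linarith), mul_inv_cancel₀ (by linarith), ENNReal.ofReal_one,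
        one_mul]
      congr 1; ring
    · simp [hsx]
  have hm : Measurable (fun z : S × ℝ => if x ≤ Ψ z.1 ∧ Ψ z.1 ≤ ENNReal.ofReal z.2
        then ENNReal.ofReal z.2 ^ (-1 - (1 + β)) else 0) :=
    Measurable.ite (measurableSet_le_and_le (by fun_prop) (by fun_prop) (by fun_prop)
      (by fun_prop)) (by fun_prop) (by fun_prop)
  have h2 : ∀ u ∈ Ioi (0 : ℝ), ∫⁻ s, (if x ≤ Ψ s ∧ Ψ s ≤ ENNReal.ofReal u
        then ENNReal.ofReal u ^ (-1 - (1 + β)) else 0) ∂σ ≤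
      (if x ≤ ENNReal.ofReal u then ENNReal.ofReal u ^ (-1 - β) else 0) := by
    intro u hu
    have hu0 : ENNReal.ofReal u ≠ 0 := by simpa using hu
    split_ifs with h
    · calc _ ≤ ∫⁻ s, {s | Ψ s ≤ ENNReal.ofReal u}.indicator
            (fun _ => ENNReal.ofReal u ^ (-1 - (1 + β))) s ∂σ := by
            refine lintegral_mono fun s => ?_
            by_cases h1 : Ψ s ≤ ENNReal.ofReal u
            · rw [indicator_of_mem (by exact h1)]; split_ifs <;> simp
            · simp [h1]
        _ = ENNReal.ofReal u ^ (-1 - (1 + β)) * σ {s | Ψ s ≤ ENNReal.ofReal u} :=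
            lintegral_indicator_const (measurableSet_le (by fun_prop) (by fun_prop)) _
        _ ≤ ENNReal.ofReal u ^ (-1 - (1 + β)) * ENNReal.ofReal u := by
            gcongr
            exact hΨ (Real.toNNReal u)
        _ = _ := by
            nth_rewrite 2 [← ENNReal.rpow_one (ENNReal.ofReal u)]
            rw [← ENNReal.rpow_add _ _ hu0 ENNReal.ofReal_ne_top]; congr 1; ring
    · rw [nonpos_iff_eq_zero]
      convert! lintegral_zero (μ := σ) with s
      rw [if_neg]
      exact fun h' => h (h'.1.trans h'.2)
  calc ∫⁻ s, (if x ≤ Ψ s then Ψ s ^ (-1 - β) else 0) ∂σ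
      = ENNReal.ofReal (1 + β) * ∫⁻ u in Ioi (0 : ℝ), ∫⁻ s, (if x ≤ Ψ s ∧ Ψ s ≤ ENNReal.ofReal u
        then ENNReal.ofReal u ^ (-1 - (1 + β)) else 0) ∂σ := by
        rw [lintegral_congr_ae h1, lintegral_const_mul _ hm.lintegral_prod_right',
          lintegral_lintegral_swap hm.aemeasurable]
    _ ≤ ENNReal.ofReal (1 + β) * ∫⁻ u in Ioi (0 : ℝ),
        (if x ≤ ENNReal.ofReal u then ENNReal.ofReal u ^ (-1 - β) else 0) := by
        gcongr ENNReal.ofReal (1 + β) * ?_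
        exact setLIntegral_mono' measurableSet_Ioi h2
    _ ≤ ENNReal.ofReal (1 + β) * (ENNReal.ofReal β⁻¹ * x ^ (-β)) := by
        gcongr
        exact lintegral_Ioi_rpow_tail_le hβ _
    _ = _ := by rw [← mul_assoc, ← ENNReal.ofReal_mul (by linarith)]

end distribution

/-! ### Cumulative distribution functions. -/

/-- A lower set may be an open half-line or the whole line. Exhausting it by closed half-lines with
endpoints inside it reduces measure bounds to those endpoints, by continuity from below. -/
theorem IsLowerSet.exists_monotone_seq {L : Set ℝ} (hL : IsLowerSet L) (hne : L.Nonempty) :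
    ∃ x : ℕ → ℝ, Monotone x ∧ (∀ n, x n ∈ L) ∧ L = ⋃ n, Iic (x n) := by
  suffices ∃ x : ℕ → ℝ, Monotone x ∧ (∀ n, x n ∈ L) ∧ ∀ t ∈ L, ∃ n, t ≤ x n by
    obtain ⟨x, hx, hxL, h⟩ := this
    refine ⟨x, hx, hxL, Subset.antisymm (fun t ht => mem_iUnion.2 (h t ht)) ?_⟩
    exact iUnion_subset fun n t ht => hL ht (hxL n)
  by_cases hb : BddAbove L
  · by_cases hm : sSup L ∈ L
    · exact ⟨fun _ => sSup L, monotone_const, fun _ => hm, fun t ht => ⟨0, le_csSup hb ht⟩⟩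
    · obtain ⟨x, hx, hlim, hxL⟩ := exists_seq_tendsto_sSup hne hb
      refine ⟨x, hx, hxL, fun t ht => ?_⟩
      have : t < sSup L := lt_of_le_of_ne (le_csSup hb ht) (fun h => hm (h ▸ ht))
      obtain ⟨n, hn⟩ := (hlim.eventually_const_lt this).exists
      exact ⟨n, hn.le⟩
  · refine ⟨fun n => n, Nat.mono_cast, fun n => ?_, fun t _ => exists_nat_ge t⟩
    rw [not_bddAbove_iff] at hb
    obtain ⟨y, hy, hny⟩ := hb n
    exact hL hny.le hy

/-- The distribution function of a measure, evaluated along the measure, is dominated by the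
identity. -/
theorem measure_cumulative_le {S : Type*} [MeasurableSpace S] {σ : Measure S} (a : S → ℝ)
    (c : ℝ≥0∞) : σ {s | σ {s' | a s' ≤ a s} ≤ c} ≤ c := by
  set L : Set ℝ := {t | σ {s' | a s' ≤ t} ≤ c}
  have hL : IsLowerSet L := fun t t' h ht =>
    (measure_mono fun s (hs : a s ≤ t') => (hs.trans h : a s ≤ t)).trans ht
  rcases L.eq_empty_or_nonempty with h | h
  · have : {s | σ {s' | a s' ≤ a s} ≤ c} = ∅ := by
      ext s
      simp only [mem_ofPred_eq, mem_empty_iff_false, iff_false]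
      intro hs
      have : a s ∈ L := hs
      simp [h] at this
    simp [this]
  · obtain ⟨x, hx, hxL, hU⟩ := hL.exists_monotone_seq h
    have : {s | σ {s' | a s' ≤ a s} ≤ c} = ⋃ n, {s | a s ≤ x n} := by
      ext s
      have : s ∈ {s | σ {s' | a s' ≤ a s} ≤ c} ↔ a s ∈ L := Iff.rfl
      rw [this, hU]; simp
    have hmono : Monotone fun n => {s | a s ≤ x n} :=
      fun m n hmn s (hs : a s ≤ x m) => (hs.trans (hx hmn) : a s ≤ x n)
    rw [this, hmono.measure_iUnion]
    exact iSup_le hxL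

/-! ### One-dimensional Hardy inequalities relative to the sublevel sets of a function. -/

section Hardy

variable {S : Type*} [MeasurableSpace S] {σ : Measure S} [SFinite σ] {Ψ : S → ℝ≥0∞}
  {p p' : ℝ}

/-- Hölder's inequality raised to the power `p`. -/
theorem lintegral_mul_rpow_le {σ : Measure S} (hp : p.HolderConjugate p') {f g : S → ℝ≥0∞}
    (hf : Measurable f) (hg : Measurable g) :
    (∫⁻ s, f s * g s ∂σ) ^ p ≤ (∫⁻ s, f s ^ p ∂σ) * (∫⁻ s, g s ^ p' ∂σ) ^ (p - 1) := by
  have h := ENNReal.lintegral_mul_le_Lp_mul_Lq σ hp hf.aemeasurable hg.aemeasurable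
  calc _ ≤ ((∫⁻ s, f s ^ p ∂σ) ^ (1 / p) * (∫⁻ s, g s ^ p' ∂σ) ^ (1 / p')) ^ p :=
        ENNReal.rpow_le_rpow h hp.nonneg
    _ = _ := by
      rw [ENNReal.mul_rpow_of_nonneg _ _ hp.nonneg, ← ENNReal.rpow_mul, ← ENNReal.rpow_mul,
        one_div_mul_cancel hp.ne_zero, ENNReal.rpow_one]
      congr 2
      have h1 : p'⁻¹ = 1 - p⁻¹ := by linarith [hp.inv_add_inv_eq_one]
      have := hp.ne_zero
      rw [one_div, h1]
      field_simp

theorem ae_ne_zero_of_measure_sublevel_le {σ : Measure S} (hΨ : ∀ c : ℝ≥0, σ {s | Ψ s ≤ c} ≤ c) :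
    ∀ᵐ s ∂σ, Ψ s ≠ 0 := by
  have := hΨ 0
  simp only [ENNReal.coe_zero, nonpos_iff_eq_zero] at this
  rw [ae_iff]; simpa using this

/-- Hardy's inequality for averages over the sublevel sets of `Ψ`. -/
theorem lintegral_average_sublevel_rpow_le (hp : p.HolderConjugate p') (hΨm : Measurable Ψ)
    (hΨ : ∀ c : ℝ≥0, σ {s | Ψ s ≤ c} ≤ c) {h : S → ℝ≥0∞} (hh : Measurable h) :
    ∫⁻ l in Ioi (0 : ℝ),
        ((ENNReal.ofReal l)⁻¹ * ∫⁻ s, (if Ψ s ≤ ENNReal.ofReal l then h s else 0) ∂σ) ^ p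
      ≤ ENNReal.ofReal p' ^ p * ∫⁻ s, h s ^ p ∂σ := by
  have hp0 := hp.pos
  have hp0' := hp.symm.pos
  have hp1 := hp.lt
  have hinv : 1 - p⁻¹ = p'⁻¹ := by linarith [hp.inv_add_inv_eq_one]
  -- Schur test with the weight `Ψ ^ γ`. The choice `γ = 1 / (p p')` turns the dual factor into `Ψ ^
  -- (-1/p)`, integrable over sublevel sets, and leaves `Ψ ^ (1/p')` on the side of `h`. Fubini then
  -- cancels the latter, and the resulting constant is the classical `p' ^ p`.
  set γ : ℝ := p⁻¹ * p'⁻¹ with hγ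
  have hγ0 : 0 < γ := by positivity
  have hΨ0 := ae_ne_zero_of_measure_sublevel_le hΨ
  have key : ∀ l ∈ Ioi (0 : ℝ),
      ((ENNReal.ofReal l)⁻¹ * ∫⁻ s, (if Ψ s ≤ ENNReal.ofReal l then h s else 0) ∂σ) ^ p ≤
      ENNReal.ofReal p' ^ (p - 1) *
        ∫⁻ s, h s ^ p * Ψ s ^ p'⁻¹ *
          (if Ψ s ≤ ENNReal.ofReal l then ENNReal.ofReal l ^ (-1 - p'⁻¹) else 0) ∂σ := by
    intro l hl
    have hl0 : ENNReal.ofReal l ≠ 0 := by simpa using hl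
    have hlt : ENNReal.ofReal l ≠ ⊤ := ENNReal.ofReal_ne_top
    have hms : MeasurableSet {s | Ψ s ≤ ENNReal.ofReal l} :=
      measurableSet_le hΨm measurable_const
    have e1 : ∫⁻ s, (if Ψ s ≤ ENNReal.ofReal l then h s else 0) ∂σ =
        ∫⁻ s, (if Ψ s ≤ ENNReal.ofReal l then h s * Ψ s ^ γ else 0) *
          (if Ψ s ≤ ENNReal.ofReal l then Ψ s ^ (-γ) else 0) ∂σ := by
      refine lintegral_congr_ae ?_
      filter_upwards [hΨ0] with s hs
      split_ifs with hsl
      · rw [mul_assoc, ← ENNReal.rpow_add _ _ hs (ne_top_of_le_ne_top hlt hsl)]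
        simp
      · simp
    have e2 : ∫⁻ s, (if Ψ s ≤ ENNReal.ofReal l then h s * Ψ s ^ γ else 0) ^ p ∂σ =
        ∫⁻ s, (if Ψ s ≤ ENNReal.ofReal l then h s ^ p * Ψ s ^ p'⁻¹ else 0) ∂σ := by
      refine lintegral_congr fun s => ?_
      split_ifs with hsl
      · rw [ENNReal.mul_rpow_of_nonneg _ _ hp0.le, ← ENNReal.rpow_mul]
        congr 2
        rw [hγ]; field_simp
      · exact ENNReal.zero_rpow_of_pos hp0
    have e3 : ∫⁻ s, (if Ψ s ≤ ENNReal.ofReal l then Ψ s ^ (-γ) else 0) ^ p' ∂σ ≤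
        ENNReal.ofReal p' * ENNReal.ofReal l ^ p'⁻¹ := by
      have := lintegral_rpow_sublevel_le hΨm hΨ (inv_pos.2 hp0) (inv_lt_one_of_one_lt₀ hp1)
        (ENNReal.ofReal l)
      rw [hinv, inv_inv] at this
      refine le_trans (lintegral_mono fun s => ?_) this
      split_ifs with hsl
      · rw [← ENNReal.rpow_mul, hγ]
        apply le_of_eq; congr 1; field_simp
      · rw [ENNReal.zero_rpow_of_pos hp0']
    have e4 := lintegral_mul_rpow_le hp (σ := σ)
      (f := fun s => if Ψ s ≤ ENNReal.ofReal l then h s * Ψ s ^ γ else 0)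
      (g := fun s => if Ψ s ≤ ENNReal.ofReal l then Ψ s ^ (-γ) else 0)
      (Measurable.ite hms (by fun_prop) (by fun_prop))
      (Measurable.ite hms (by fun_prop) (by fun_prop))
    rw [e2, ← e1] at e4
    rw [ENNReal.mul_rpow_of_nonneg _ _ hp0.le]
    calc _ ≤ (ENNReal.ofReal l)⁻¹ ^ p *
          ((∫⁻ s, (if Ψ s ≤ ENNReal.ofReal l then h s ^ p * Ψ s ^ p'⁻¹ else 0) ∂σ) *
            (ENNReal.ofReal p' * ENNReal.ofReal l ^ p'⁻¹) ^ (p - 1)) := by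
          gcongr
          refine e4.trans ?_
          gcongr
      _ = ENNReal.ofReal p' ^ (p - 1) * ((ENNReal.ofReal l ^ (-1 - p'⁻¹)) *
          ∫⁻ s, (if Ψ s ≤ ENNReal.ofReal l then h s ^ p * Ψ s ^ p'⁻¹ else 0) ∂σ) := by
          have : ENNReal.ofReal l ^ (-1 - p'⁻¹) =
              (ENNReal.ofReal l)⁻¹ ^ p * (ENNReal.ofReal l ^ p'⁻¹) ^ (p - 1) := by
            rw [← ENNReal.rpow_neg_one, ← ENNReal.rpow_mul, ← ENNReal.rpow_mul,
              ← ENNReal.rpow_add _ _ hl0 hlt, ← hinv]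
            congr 1
            field_simp
            ring
          rw [this, ENNReal.mul_rpow_of_nonneg _ _ (by linarith)]
          ring
      _ = _ := by
          rw [← lintegral_const_mul _ (Measurable.ite hms (by fun_prop) (by fun_prop))]
          congr 1
          refine lintegral_congr fun s => ?_
          split_ifs
          · ring
          · simp
  have hm : Measurable (fun z : ℝ × S => h z.2 ^ p * Ψ z.2 ^ p'⁻¹ *
          (if Ψ z.2 ≤ ENNReal.ofReal z.1 then ENNReal.ofReal z.1 ^ (-1 - p'⁻¹) else 0)) :=
    Measurable.mul (by fun_prop) (Measurable.ite (measurableSet_le (by fun_prop) (by fun_prop))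
      (by fun_prop) (by fun_prop))
  calc _ ≤ ∫⁻ l in Ioi (0 : ℝ), ENNReal.ofReal p' ^ (p - 1) *
        ∫⁻ s, h s ^ p * Ψ s ^ p'⁻¹ *
          (if Ψ s ≤ ENNReal.ofReal l then ENNReal.ofReal l ^ (-1 - p'⁻¹) else 0) ∂σ :=
        setLIntegral_mono' measurableSet_Ioi key
    _ = ENNReal.ofReal p' ^ (p - 1) * ∫⁻ s, h s ^ p * Ψ s ^ p'⁻¹ * (∫⁻ l in Ioi (0 : ℝ),
          (if Ψ s ≤ ENNReal.ofReal l then ENNReal.ofReal l ^ (-1 - p'⁻¹) else 0)) ∂σ := by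
        rw [lintegral_const_mul _ hm.lintegral_prod_right', lintegral_lintegral_swap
          hm.aemeasurable]
        congr 1
        refine lintegral_congr fun s => ?_
        dsimp only
        rw [lintegral_const_mul]
        exact Measurable.ite (measurableSet_le (by fun_prop) (by fun_prop))
          (by fun_prop) (by fun_prop)
    _ ≤ ENNReal.ofReal p' ^ (p - 1) * ∫⁻ s, ENNReal.ofReal p' * h s ^ p ∂σ := by
        gcongr ENNReal.ofReal _ ^ (p - 1) * ?_
        refine lintegral_mono fun s => ?_
        have := lintegral_Ioi_rpow_tail_le (inv_pos.2 hp0') (Ψ s)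
        rw [inv_inv] at this
        calc _ ≤ h s ^ p * Ψ s ^ p'⁻¹ * (ENNReal.ofReal p' * Ψ s ^ (-p'⁻¹)) := by gcongr
          _ = (ENNReal.ofReal p' * h s ^ p) * (Ψ s ^ p'⁻¹ * (Ψ s ^ p'⁻¹)⁻¹) := by
              rw [ENNReal.rpow_neg]; ring
          _ ≤ _ := mul_le_of_le_one_right' (ENNReal.mul_inv_le_one _)
    _ = _ := by
        rw [lintegral_const_mul _ (by fun_prop), ← mul_assoc]
        congr 1
        nth_rewrite 2 [← ENNReal.rpow_one (ENNReal.ofReal p')]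
        rw [← ENNReal.rpow_add _ _ (by simpa using hp0') ENNReal.ofReal_ne_top]
        congr 1; ring

/-- The dual Hardy inequality: tails with respect to `Ψ` of `h / Ψ`. -/
theorem lintegral_tail_rpow_le (hp : p.HolderConjugate p') (hΨm : Measurable Ψ)
    (hΨ : ∀ c : ℝ≥0, σ {s | Ψ s ≤ c} ≤ c) :
    ∃ C : ℝ≥0, ∀ h : S → ℝ≥0∞, Measurable h →
    ∫⁻ t, (∫⁻ s, (if Ψ t ≤ Ψ s then h s * (Ψ s)⁻¹ else 0) ∂σ) ^ p ∂σ ≤ C * ∫⁻ s, h s ^ p ∂σ := by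
  have hp0 := hp.pos
  have hp0' := hp.symm.pos
  have hp1 := hp.lt
  have hinv : 1 - p⁻¹ = p'⁻¹ := by linarith [hp.inv_add_inv_eq_one]
  set γ : ℝ := p⁻¹ * p'⁻¹ with hγ
  have hγ0 : 0 < γ := by positivity
  have hγ1 : γ < 1 := by
    have h1 : p⁻¹ < 1 := inv_lt_one_of_one_lt₀ hp1
    have h2 : p'⁻¹ < 1 := inv_lt_one_of_one_lt₀ hp.symm.lt
    have : 0 < p⁻¹ := by positivity
    nlinarith
  have hΨ0 := ae_ne_zero_of_measure_sublevel_le hΨ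
  -- The splitting is now `Ψ⁻¹ = Ψ ^ (-γ) * Ψ ^ (-(1 - γ))`. The dual factor has exponent `-(1 - γ)
  -- p' = -1 - β` with `β = (p' - 1) / p > 0`, so it is integrable over superlevel sets; `β (p - 1)
  -- = 1 / p` is the power of `Ψ t` that remains after Hölder.
  set β : ℝ := (1 - γ) * p' - 1 with hβ
  have hβe : β = p⁻¹ * (p' - 1) := by
    rw [hβ, hγ]
    have : p' = 1 + p' * p⁻¹ := by
      have := hp.inv_add_inv_eq_one; field_simp at this ⊢; linarith
    have h3 : p⁻¹ * p'⁻¹ * p' = p⁻¹ := by field_simp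
    nlinarith
  have hβ0 : 0 < β := by
    rw [hβe]
    have := hp.symm.lt
    have : 0 < p' - 1 := by linarith
    positivity
  have hβp : β * (p - 1) = p⁻¹ := by
    have : (p' - 1) * (p - 1) = 1 := by
      have := hp.inv_add_inv_eq_one; field_simp at this; nlinarith
    rw [hβe, mul_assoc, this, mul_one]
  refine ⟨Real.toNNReal ((1 + β) * β⁻¹) ^ (p - 1) * Real.toNNReal p', fun h hh => ?_⟩
  have key : ∀ t, (∫⁻ s, (if Ψ t ≤ Ψ s then h s * (Ψ s)⁻¹ else 0) ∂σ) ^ p ≤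
      ENNReal.ofReal ((1 + β) * β⁻¹) ^ (p - 1) *
        ∫⁻ s, h s ^ p * Ψ s ^ (-p'⁻¹) * (if Ψ t ≤ Ψ s then Ψ t ^ (-p⁻¹) else 0) ∂σ := by
    intro t
    have hms : MeasurableSet {s | Ψ t ≤ Ψ s} := measurableSet_le measurable_const hΨm
    have e1 : ∫⁻ s, (if Ψ t ≤ Ψ s then h s * (Ψ s)⁻¹ else 0) ∂σ =
        ∫⁻ s, (if Ψ t ≤ Ψ s then h s * Ψ s ^ (-γ) else 0) *
          (if Ψ t ≤ Ψ s then Ψ s ^ (-(1 - γ)) else 0) ∂σ := by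
      refine lintegral_congr_ae ?_
      filter_upwards [hΨ0] with s hs
      split_ifs with hsl
      · rw [mul_assoc]
        congr 1
        by_cases hst : Ψ s = ⊤
        · rw [hst, ENNReal.top_rpow_of_neg (by linarith)]; simp
        · rw [← ENNReal.rpow_add _ _ hs hst, ← ENNReal.rpow_neg_one]
          congr 1; ring
      · simp
    have e2 : ∫⁻ s, (if Ψ t ≤ Ψ s then h s * Ψ s ^ (-γ) else 0) ^ p ∂σ =
        ∫⁻ s, (if Ψ t ≤ Ψ s then h s ^ p * Ψ s ^ (-p'⁻¹) else 0) ∂σ := by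
      refine lintegral_congr fun s => ?_
      split_ifs with hsl
      · rw [ENNReal.mul_rpow_of_nonneg _ _ hp0.le, ← ENNReal.rpow_mul]
        congr 2
        rw [hγ]; field_simp
      · exact ENNReal.zero_rpow_of_pos hp0
    have e3 : ∫⁻ s, (if Ψ t ≤ Ψ s then Ψ s ^ (-(1 - γ)) else 0) ^ p' ∂σ ≤
        ENNReal.ofReal ((1 + β) * β⁻¹) * Ψ t ^ (-β) := by
      refine le_trans (lintegral_mono fun s => ?_)
        (lintegral_rpow_superlevel_le hΨm hΨ hβ0 (Ψ t))
      split_ifs with hsl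
      · rw [← ENNReal.rpow_mul, hβ]
        apply le_of_eq; congr 1; ring
      · rw [ENNReal.zero_rpow_of_pos hp0']
    have e4 := lintegral_mul_rpow_le hp (σ := σ)
      (f := fun s => if Ψ t ≤ Ψ s then h s * Ψ s ^ (-γ) else 0)
      (g := fun s => if Ψ t ≤ Ψ s then Ψ s ^ (-(1 - γ)) else 0)
      (Measurable.ite hms (by fun_prop) (by fun_prop))
      (Measurable.ite hms (by fun_prop) (by fun_prop))
    rw [e2, ← e1] at e4
    calc _ ≤ ((∫⁻ s, (if Ψ t ≤ Ψ s then h s ^ p * Ψ s ^ (-p'⁻¹) else 0) ∂σ) *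
            (ENNReal.ofReal ((1 + β) * β⁻¹) * Ψ t ^ (-β)) ^ (p - 1)) := by
          refine e4.trans ?_
          gcongr
      _ = ENNReal.ofReal ((1 + β) * β⁻¹) ^ (p - 1) * (Ψ t ^ (-p⁻¹) *
          ∫⁻ s, (if Ψ t ≤ Ψ s then h s ^ p * Ψ s ^ (-p'⁻¹) else 0) ∂σ) := by
          rw [ENNReal.mul_rpow_of_nonneg _ _ (by linarith), ← ENNReal.rpow_mul, neg_mul, hβp]
          ring
      _ = _ := by
          rw [← lintegral_const_mul _ (Measurable.ite hms (by fun_prop) (by fun_prop))]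
          congr 1
          refine lintegral_congr fun s => ?_
          split_ifs
          · ring
          · simp
  have hm : Measurable (fun z : S × S => h z.2 ^ p * Ψ z.2 ^ (-p'⁻¹) *
          (if Ψ z.1 ≤ Ψ z.2 then Ψ z.1 ^ (-p⁻¹) else 0)) :=
    Measurable.mul (by fun_prop) (Measurable.ite (measurableSet_le (by fun_prop) (by fun_prop))
      (by fun_prop) (by fun_prop))
  calc _ ≤ ∫⁻ t, ENNReal.ofReal ((1 + β) * β⁻¹) ^ (p - 1) *
        ∫⁻ s, h s ^ p * Ψ s ^ (-p'⁻¹) * (if Ψ t ≤ Ψ s then Ψ t ^ (-p⁻¹) else 0) ∂σ ∂σ :=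
        lintegral_mono key
    _ = ENNReal.ofReal ((1 + β) * β⁻¹) ^ (p - 1) * ∫⁻ s, h s ^ p * Ψ s ^ (-p'⁻¹) *
          (∫⁻ t, (if Ψ t ≤ Ψ s then Ψ t ^ (-p⁻¹) else 0) ∂σ) ∂σ := by
        rw [lintegral_const_mul _ hm.lintegral_prod_right', lintegral_lintegral_swap
          hm.aemeasurable]
        congr 1
        refine lintegral_congr fun s => ?_
        dsimp only
        rw [lintegral_const_mul]
        exact Measurable.ite (measurableSet_le (by fun_prop) (by fun_prop))
          (by fun_prop) (by fun_prop)
    _ ≤ ENNReal.ofReal ((1 + β) * β⁻¹) ^ (p - 1) * ∫⁻ s, ENNReal.ofReal p' * h s ^ p ∂σ := by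
        gcongr ENNReal.ofReal _ ^ (p - 1) * ?_
        refine lintegral_mono fun s => ?_
        have := lintegral_rpow_sublevel_le hΨm hΨ (inv_pos.2 hp0) (inv_lt_one_of_one_lt₀ hp1)
          (Ψ s)
        rw [hinv, inv_inv] at this
        calc _ ≤ h s ^ p * Ψ s ^ (-p'⁻¹) * (ENNReal.ofReal p' * Ψ s ^ p'⁻¹) :=
              mul_le_mul_right this _
          _ = (ENNReal.ofReal p' * h s ^ p) * (Ψ s ^ p'⁻¹ * (Ψ s ^ p'⁻¹)⁻¹) := by
              rw [ENNReal.rpow_neg]; ring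
          _ ≤ _ := mul_le_of_le_one_right' (ENNReal.mul_inv_le_one _)
    _ = _ := by
        rw [lintegral_const_mul _ (by fun_prop), ← mul_assoc, ENNReal.coe_mul,
          ENNReal.coe_rpow_of_nonneg _ (by linarith)]
        rfl

end Hardy

/-! ### Hardy's inequality for averages in two variables. -/

section Hardy₂

variable {S₁ S₂ : Type*} [MeasurableSpace S₁] [MeasurableSpace S₂]
  {σ₁ : Measure S₁} [SFinite σ₁] {σ₂ : Measure S₂} [SFinite σ₂]
  {Ψ₁ : S₁ → ℝ≥0∞} {Ψ₂ : S₂ → ℝ≥0∞} {p p' : ℝ}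

/-- The integral of `h` over the product of two sublevel sets. -/
noncomputable def sublevelIntegral (σ₁ : Measure S₁) (σ₂ : Measure S₂) (Ψ₁ : S₁ → ℝ≥0∞)
    (Ψ₂ : S₂ → ℝ≥0∞) (h : S₁ × S₂ → ℝ≥0∞) (l m : ℝ) : ℝ≥0∞ :=
  ∫⁻ t, (if Ψ₂ t ≤ ENNReal.ofReal m then
    ∫⁻ s, (if Ψ₁ s ≤ ENNReal.ofReal l then h (s, t) else 0) ∂σ₁ else 0) ∂σ₂

theorem measurable_sublevelIntegral_aux (hΨ₁m : Measurable Ψ₁) {h : S₁ × S₂ → ℝ≥0∞}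
    (hh : Measurable h) : Measurable fun z : ℝ × S₂ =>
      ∫⁻ s, (if Ψ₁ s ≤ ENNReal.ofReal z.1 then h (s, z.2) else 0) ∂σ₁ := by
  have : Measurable fun z : (ℝ × S₂) × S₁ =>
      (if Ψ₁ z.2 ≤ ENNReal.ofReal z.1.1 then h (z.2, z.1.2) else 0) :=
    Measurable.ite (measurableSet_le (by fun_prop) (by fun_prop)) (by fun_prop) (by fun_prop)
  exact this.lintegral_prod_right'

theorem measurable_sublevelIntegral (hΨ₁m : Measurable Ψ₁) (hΨ₂m : Measurable Ψ₂)
    {h : S₁ × S₂ → ℝ≥0∞} (hh : Measurable h) :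
    Measurable fun z : ℝ × ℝ => sublevelIntegral σ₁ σ₂ Ψ₁ Ψ₂ h z.1 z.2 := by
  have h1 := measurable_sublevelIntegral_aux (σ₁ := σ₁) hΨ₁m hh
  have : Measurable fun z : (ℝ × ℝ) × S₂ => (if Ψ₂ z.2 ≤ ENNReal.ofReal z.1.2 then
    ∫⁻ s, (if Ψ₁ s ≤ ENNReal.ofReal z.1.1 then h (s, z.2) else 0) ∂σ₁ else 0) :=
    Measurable.ite (measurableSet_le (by fun_prop) (by fun_prop))
      (h1.comp (g := fun z : ℝ × S₂ => _) (f := fun z : (ℝ × ℝ) × S₂ => (z.1.1, z.2))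
        (by fun_prop)) (by fun_prop)
  exact this.lintegral_prod_right'

theorem sublevelIntegral_eq (hΨ₁m : Measurable Ψ₁) (hΨ₂m : Measurable Ψ₂)
    {h : S₁ × S₂ → ℝ≥0∞} (hh : Measurable h) (l m : ℝ) :
    sublevelIntegral σ₁ σ₂ Ψ₁ Ψ₂ h l m = ∫⁻ z, (if Ψ₁ z.1 ≤ ENNReal.ofReal l ∧
      Ψ₂ z.2 ≤ ENNReal.ofReal m then h z else 0) ∂(σ₁.prod σ₂) := by
  rw [lintegral_prod_symm _ (Measurable.ite (measurableSet_le_and_le (by fun_prop) (by fun_prop)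
    (by fun_prop) (by fun_prop)) (by fun_prop) (by fun_prop)).aemeasurable]
  refine lintegral_congr fun t => ?_
  split_ifs with ht <;> simp [ht]

/-- Hardy's inequality for averages over products of sublevel sets. -/
theorem lintegral_sublevelIntegral_rpow_le (hp : p.HolderConjugate p')
    (hΨ₁m : Measurable Ψ₁) (hΨ₁ : ∀ c : ℝ≥0, σ₁ {s | Ψ₁ s ≤ c} ≤ c)
    (hΨ₂m : Measurable Ψ₂) (hΨ₂ : ∀ c : ℝ≥0, σ₂ {s | Ψ₂ s ≤ c} ≤ c)
    {h : S₁ × S₂ → ℝ≥0∞} (hh : Measurable h) :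
    ∫⁻ l in Ioi (0 : ℝ), ∫⁻ m in Ioi (0 : ℝ),
        ((ENNReal.ofReal l)⁻¹ * ((ENNReal.ofReal m)⁻¹ *
          sublevelIntegral σ₁ σ₂ Ψ₁ Ψ₂ h l m)) ^ p
      ≤ ENNReal.ofReal p' ^ p * (ENNReal.ofReal p' ^ p * ∫⁻ z, h z ^ p ∂(σ₁.prod σ₂)) := by
  have h1 := measurable_sublevelIntegral_aux (σ₁ := σ₁) hΨ₁m hh
  have hm : ∀ l : ℝ, Measurable fun t =>
      ∫⁻ s, (if Ψ₁ s ≤ ENNReal.ofReal l then h (s, t) else 0) ∂σ₁ := fun l =>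
    h1.comp (g := fun z : ℝ × S₂ => _) (f := fun t => (l, t)) (by fun_prop)
  have hg : Measurable fun z : ℝ × S₂ => ((ENNReal.ofReal z.1)⁻¹ *
      ∫⁻ s, (if Ψ₁ s ≤ ENNReal.ofReal z.1 then h (s, z.2) else 0) ∂σ₁) ^ p := by
    fun_prop
  -- For fixed `l` the double average is the average in the second variable of a partial average in
  -- the first, so the one-dimensional inequality applies twice, with an exchange of integrals in
  -- between.
  calc _ = ∫⁻ l in Ioi (0 : ℝ), ∫⁻ m in Ioi (0 : ℝ), ((ENNReal.ofReal m)⁻¹ *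
        ∫⁻ t, (if Ψ₂ t ≤ ENNReal.ofReal m then (ENNReal.ofReal l)⁻¹ *
        ∫⁻ s, (if Ψ₁ s ≤ ENNReal.ofReal l then h (s, t) else 0) ∂σ₁ else 0) ∂σ₂) ^ p := by
        refine lintegral_congr fun l => lintegral_congr fun m => ?_
        rw [mul_left_comm, sublevelIntegral, ← lintegral_const_mul _
          (Measurable.ite (measurableSet_le hΨ₂m measurable_const) (hm l) measurable_const)]
        congr 2
        refine lintegral_congr fun t => ?_
        split_ifs <;> simp
    _ ≤ ∫⁻ l in Ioi (0 : ℝ), ENNReal.ofReal p' ^ p * ∫⁻ t, ((ENNReal.ofReal l)⁻¹ *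
        ∫⁻ s, (if Ψ₁ s ≤ ENNReal.ofReal l then h (s, t) else 0) ∂σ₁) ^ p ∂σ₂ :=
        lintegral_mono fun l =>
          lintegral_average_sublevel_rpow_le hp hΨ₂m hΨ₂ ((hm l).const_mul _)
    _ = ENNReal.ofReal p' ^ p * ∫⁻ t, (∫⁻ l in Ioi (0 : ℝ), ((ENNReal.ofReal l)⁻¹ *
        ∫⁻ s, (if Ψ₁ s ≤ ENNReal.ofReal l then h (s, t) else 0) ∂σ₁) ^ p) ∂σ₂ := by
        rw [lintegral_const_mul _ hg.lintegral_prod_right',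
          lintegral_lintegral_swap hg.aemeasurable]
    _ ≤ ENNReal.ofReal p' ^ p * ∫⁻ t, ENNReal.ofReal p' ^ p * ∫⁻ s, h (s, t) ^ p ∂σ₁ ∂σ₂ := by
        gcongr ENNReal.ofReal _ ^ p * ?_
        exact lintegral_mono fun t =>
          lintegral_average_sublevel_rpow_le hp hΨ₁m hΨ₁ (h := fun s => h (s, t)) (by fun_prop)
    _ = _ := by
        rw [lintegral_const_mul _ (Measurable.lintegral_prod_left'
          (f := fun z : S₁ × S₂ => h z ^ p) (by fun_prop)),
          lintegral_prod_symm _ (by fun_prop)]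

end Hardy₂

/-! ### The two-dimensional Hardy operator with product weight on the domain side. -/

theorem IsUpperSet.exists_antitone_seq {U : Set ℝ} (hU : IsUpperSet U) (hne : U.Nonempty) :
    ∃ x : ℕ → ℝ, Antitone x ∧ (∀ n, x n ∈ U) ∧ ∀ t ∈ U, ∃ n, x n ≤ t := by
  have hL : IsLowerSet (-U) := fun a b hba ha => by
    rw [Set.mem_neg] at ha ⊢
    exact hU (neg_le_neg hba) ha
  obtain ⟨x, hx, hxL, h⟩ := hL.exists_monotone_seq hne.neg
  refine ⟨fun n => -x n, fun m n h => neg_le_neg (hx h), fun n => hxL n, fun t ht => ?_⟩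
  have : -t ∈ ⋃ n, Iic (x n) := h ▸ (by simpa using ht : -t ∈ -U)
  obtain ⟨n, hn⟩ := mem_iUnion.1 this
  exact ⟨n, by have : -t ≤ x n := hn
               linarith⟩

/-- Lebesgue measure on the quadrant `(0, ∞)²`. -/
noncomputable def quadrant : Measure (ℝ × ℝ) :=
  (volume.restrict (Ioi (0 : ℝ))).prod (volume.restrict (Ioi (0 : ℝ)))

instance : SFinite quadrant := by unfold quadrant; infer_instance

theorem ae_quadrant_pos : ∀ᵐ z ∂quadrant, 0 < z.1 ∧ 0 < z.2 := by
  rw [quadrant, Measure.prod_restrict]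
  exact (ae_restrict_mem (measurableSet_Ioi.prod measurableSet_Ioi)).mono fun z hz => hz

section TwoDim

variable {S₁ S₂ Z : Type*} [MeasurableSpace S₁] [MeasurableSpace S₂] [MeasurableSpace Z]
  {σ₁ : Measure S₁} {σ₂ : Measure S₂} {ν : Measure Z} {p p' q : ℝ}

/-- Passes from thresholds of position to thresholds of mass. Positions at which the mass is at
least `l` form an upper set, which is exhausted by closed half-lines; at their endpoints the
hypothesis applies with masses at least `l` and `m`. -/
theorem measure_cumulative_superlevel_le {a₁ : S₁ → ℝ} {a₂ : S₂ → ℝ} {b₁ b₂ : Z → ℝ}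
    {e : ℝ} {A : ℝ≥0} (he : 0 < e) (hq : 0 < q)
    (hA : ∀ t₁ t₂ : ℝ, σ₁ {s | a₁ s ≤ t₁} ^ e * σ₂ {s | a₂ s ≤ t₂} ^ e *
      ν {z | t₁ ≤ b₁ z ∧ t₂ ≤ b₂ z} ^ (1 / q) ≤ A)
    {l m : ℝ≥0∞} (hl : l ≠ 0) (hlt : l ≠ ⊤) (hm : m ≠ 0) (hmt : m ≠ ⊤) :
    ν {z | l ≤ σ₁ {s | a₁ s ≤ b₁ z} ∧ m ≤ σ₂ {s | a₂ s ≤ b₂ z}} ≤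
      A ^ q * (l * m) ^ (-(e * q)) := by
  set U : Set ℝ := {t | l ≤ σ₁ {s | a₁ s ≤ t}}
  set V : Set ℝ := {t | m ≤ σ₂ {s | a₂ s ≤ t}}
  have hU : IsUpperSet U := fun t t' h (ht : l ≤ _) =>
    (ht.trans (measure_mono fun s (hs : a₁ s ≤ t) => (hs.trans h : a₁ s ≤ t')) : l ≤ _)
  have hV : IsUpperSet V := fun t t' h (ht : m ≤ _) =>
    (ht.trans (measure_mono fun s (hs : a₂ s ≤ t) => (hs.trans h : a₂ s ≤ t')) : m ≤ _)
  have hset : {z | l ≤ σ₁ {s | a₁ s ≤ b₁ z} ∧ m ≤ σ₂ {s | a₂ s ≤ b₂ z}} =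
      {z | b₁ z ∈ U ∧ b₂ z ∈ V} := rfl
  rw [hset]
  rcases U.eq_empty_or_nonempty with hUe | hUe
  · simp [hUe]
  rcases V.eq_empty_or_nonempty with hVe | hVe
  · simp [hVe]
  obtain ⟨x, hx, hxU, hxx⟩ := hU.exists_antitone_seq hUe
  obtain ⟨y, hy, hyV, hyy⟩ := hV.exists_antitone_seq hVe
  have hun : {z | b₁ z ∈ U ∧ b₂ z ∈ V} = ⋃ n, {z | x n ≤ b₁ z ∧ y n ≤ b₂ z} := by
    ext z
    simp only [mem_ofPred_eq, mem_iUnion]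
    constructor
    · rintro ⟨h1, h2⟩
      obtain ⟨i, hi⟩ := hxx _ h1
      obtain ⟨j, hj⟩ := hyy _ h2
      exact ⟨max i j, (hx (le_max_left i j)).trans hi, (hy (le_max_right i j)).trans hj⟩
    · rintro ⟨n, h1, h2⟩
      exact ⟨hU h1 (hxU n), hV h2 (hyV n)⟩
  have hmono : Monotone fun n => {z | x n ≤ b₁ z ∧ y n ≤ b₂ z} :=
    fun i j hij z (hz : x i ≤ b₁ z ∧ y i ≤ b₂ z) =>
      (⟨(hx hij).trans hz.1, (hy hij).trans hz.2⟩ : x j ≤ b₁ z ∧ y j ≤ b₂ z)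
  rw [hun, hmono.measure_iUnion]
  refine iSup_le fun n => ?_
  have hlm0 : l * m ≠ 0 := mul_ne_zero hl hm
  have hlmt : l * m ≠ ⊤ := ENNReal.mul_ne_top hlt hmt
  have h1 : (l * m) ^ e * ν {z | x n ≤ b₁ z ∧ y n ≤ b₂ z} ^ (1 / q) ≤ A := by
    refine le_trans ?_ (hA (x n) (y n))
    rw [ENNReal.mul_rpow_of_nonneg _ _ he.le]
    gcongr
    · exact hxU n
    · exact hyV n
  have h2 := ENNReal.rpow_le_rpow h1 hq.le
  rw [ENNReal.mul_rpow_of_nonneg _ _ hq.le, ← ENNReal.rpow_mul, ← ENNReal.rpow_mul,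
    one_div_mul_cancel hq.ne', ENNReal.rpow_one] at h2
  rw [ENNReal.rpow_neg, mul_comm (_ ^ q), ← ENNReal.div_eq_inv_mul,
    ENNReal.le_div_iff_mul_le (Or.inl (by simp [hlm0, hlmt, ENNReal.rpow_eq_zero_iff]))
      (Or.inl (ENNReal.rpow_ne_top_of_nonneg (by positivity) hlmt)), mul_comm]
  exact h2

variable [SFinite σ₁] [SFinite σ₂] [SFinite ν]

/-- Two-dimensional Hardy inequality with a product weight on the domain side. -/
theorem two_dim_hardy (hp : p.HolderConjugate p') (hpq : p ≤ q)
    {a₁ : S₁ → ℝ} {a₂ : S₂ → ℝ} {b₁ b₂ : Z → ℝ} (ha₁ : Measurable a₁) (ha₂ : Measurable a₂)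
    (hb₁ : Measurable b₁) (hb₂ : Measurable b₂) {A : ℝ≥0}
    (hA : ∀ t₁ t₂ : ℝ, σ₁ {s | a₁ s ≤ t₁} ^ (1 / p') * σ₂ {s | a₂ s ≤ t₂} ^ (1 / p') *
      ν {z | t₁ ≤ b₁ z ∧ t₂ ≤ b₂ z} ^ (1 / q) ≤ A) :
    ∃ C : ℝ≥0, ∀ h : S₁ × S₂ → ℝ≥0∞, Measurable h →
      ∫⁻ z, (∫⁻ s, (if a₁ s.1 ≤ b₁ z ∧ a₂ s.2 ≤ b₂ z then h s else 0) ∂(σ₁.prod σ₂)) ^ q ∂ν ≤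
        C * (∫⁻ s, h s ^ p ∂(σ₁.prod σ₂)) ^ (q / p) := by
  have hp0 := hp.pos
  have hp0' := hp.symm.pos
  have hp1 := hp.lt
  have hq0 : 0 < q := hp0.trans_le hpq
  -- Bookkeeping of exponents: the estimate is made for p-th powers and then raised to `r = q / p ≥
  -- 1`, which turns the factor `(X Y) ^ (p - 1)` into `(X Y) ^ κ`, the homogeneity of the
  -- hypothesis raised to the power `q`.
  set κ : ℝ := 1 / p' * q with hκ
  have hκ0 : 0 < κ := by positivity
  set r : ℝ := q / p with hr
  have hr1 : 1 ≤ r := by rw [hr, le_div_iff₀ hp0]; linarith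
  have hrp : p * r = q := by rw [hr]; field_simp
  have hκr : (p - 1) * r = κ := by
    have h1 : 1 / p' = 1 - p⁻¹ := by rw [one_div]; linarith [hp.inv_add_inv_eq_one]
    rw [hκ, h1, ← hrp]; field_simp
  set Ψ₁ : ℝ → ℝ≥0∞ := fun t => σ₁ {s | a₁ s ≤ t} with hΨ₁def
  set Ψ₂ : ℝ → ℝ≥0∞ := fun t => σ₂ {s | a₂ s ≤ t} with hΨ₂def
  have hΨ₁mono : Monotone Ψ₁ := fun t t' h =>
    measure_mono fun s (hs : a₁ s ≤ t) => (hs.trans h : a₁ s ≤ t')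
  have hΨ₂mono : Monotone Ψ₂ := fun t t' h =>
    measure_mono fun s (hs : a₂ s ≤ t) => (hs.trans h : a₂ s ≤ t')
  have hΨ₁m : Measurable Ψ₁ := hΨ₁mono.measurable
  have hΨ₂m : Measurable Ψ₂ := hΨ₂mono.measurable
  have hν : ∀ {l m : ℝ≥0∞}, l ≠ 0 → l ≠ ⊤ → m ≠ 0 → m ≠ ⊤ →
      ν {z | l ≤ Ψ₁ (b₁ z) ∧ m ≤ Ψ₂ (b₂ z)} ≤ A ^ q * (l * m) ^ (-κ) :=
    fun h1 h2 h3 h4 => measure_cumulative_superlevel_le (by positivity) hq0 hA h1 h2 h3 h4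
  -- Masses may be infinite. Letting `l` tend to infinity in `hν`, with `m` bounded away from zero,
  -- shows that targets with one infinite and one positive mass are negligible.
  have hnull₁ : ν {z | Ψ₁ (b₁ z) = ⊤ ∧ Ψ₂ (b₂ z) ≠ 0} = 0 := by
    have : {z | Ψ₁ (b₁ z) = ⊤ ∧ Ψ₂ (b₂ z) ≠ 0} ⊆
        ⋃ n : ℕ, {z | Ψ₁ (b₁ z) = ⊤ ∧ ((n : ℝ≥0∞) + 1)⁻¹ ≤ Ψ₂ (b₂ z)} := by
      rintro z ⟨h1, h2⟩
      obtain ⟨n, hn⟩ := ENNReal.exists_inv_nat_lt h2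
      refine mem_iUnion.2 ⟨n, h1, le_trans ?_ hn.le⟩
      exact ENNReal.inv_le_inv.2 le_self_add
    refine measure_mono_null this (measure_iUnion_null fun n => ?_)
    have hc0 : ((n : ℝ≥0∞) + 1)⁻¹ ≠ 0 := by simp
    have hct : ((n : ℝ≥0∞) + 1)⁻¹ ≠ ⊤ := by simp
    have hb : ∀ k : ℕ, ν {z | Ψ₁ (b₁ z) = ⊤ ∧ ((n : ℝ≥0∞) + 1)⁻¹ ≤ Ψ₂ (b₂ z)} ≤
        A ^ q * (((k + 1 : ℕ) : ℝ≥0∞) * ((n : ℝ≥0∞) + 1)⁻¹) ^ (-κ) := fun k => by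
      refine le_trans (measure_mono ?_) (hν (l := ((k + 1 : ℕ) : ℝ≥0∞)) (by simp) (by simp)
        hc0 hct)
      rintro z ⟨h1, h2⟩
      exact ⟨by rw [h1]; exact le_top, h2⟩
    have hlim : Filter.Tendsto (fun k : ℕ => (A : ℝ≥0∞) ^ q *
        (((k + 1 : ℕ) : ℝ≥0∞) * ((n : ℝ≥0∞) + 1)⁻¹) ^ (-κ)) Filter.atTop (nhds 0) := by
      have h1 : Filter.Tendsto (fun k : ℕ => ((k + 1 : ℕ) : ℝ≥0∞) * ((n : ℝ≥0∞) + 1)⁻¹)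
          Filter.atTop (nhds ⊤) := by
        have := ENNReal.Tendsto.mul_const (b := ((n : ℝ≥0∞) + 1)⁻¹)
          ((Filter.tendsto_add_atTop_iff_nat 1).2 ENNReal.tendsto_nat_nhds_top) (Or.inl (by simp))
        rwa [ENNReal.top_mul hc0] at this
      have h2 := (ENNReal.continuous_rpow_const (y := -κ)).continuousAt.tendsto.comp h1
      rw [ENNReal.top_rpow_of_neg (by linarith)] at h2
      have h3 := ENNReal.Tendsto.const_mul (a := (A : ℝ≥0∞) ^ q) h2
        (Or.inr (ENNReal.rpow_ne_top_of_nonneg hq0.le ENNReal.coe_ne_top))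
      rwa [mul_zero] at h3
    exact le_antisymm (ge_of_tendsto' hlim hb) zero_le
  have hnull₂ : ν {z | Ψ₂ (b₂ z) = ⊤ ∧ Ψ₁ (b₁ z) ≠ 0} = 0 := by
    have : {z | Ψ₂ (b₂ z) = ⊤ ∧ Ψ₁ (b₁ z) ≠ 0} ⊆
        ⋃ n : ℕ, {z | Ψ₂ (b₂ z) = ⊤ ∧ ((n : ℝ≥0∞) + 1)⁻¹ ≤ Ψ₁ (b₁ z)} := by
      rintro z ⟨h1, h2⟩
      obtain ⟨n, hn⟩ := ENNReal.exists_inv_nat_lt h2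
      refine mem_iUnion.2 ⟨n, h1, le_trans ?_ hn.le⟩
      exact ENNReal.inv_le_inv.2 le_self_add
    refine measure_mono_null this (measure_iUnion_null fun n => ?_)
    have hc0 : ((n : ℝ≥0∞) + 1)⁻¹ ≠ 0 := by simp
    have hct : ((n : ℝ≥0∞) + 1)⁻¹ ≠ ⊤ := by simp
    have hb : ∀ k : ℕ, ν {z | Ψ₂ (b₂ z) = ⊤ ∧ ((n : ℝ≥0∞) + 1)⁻¹ ≤ Ψ₁ (b₁ z)} ≤
        A ^ q * (((n : ℝ≥0∞) + 1)⁻¹ * ((k + 1 : ℕ) : ℝ≥0∞)) ^ (-κ) := fun k => by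
      refine le_trans (measure_mono ?_) (hν (m := ((k + 1 : ℕ) : ℝ≥0∞)) hc0 hct (by simp)
        (by simp))
      rintro z ⟨h1, h2⟩
      exact ⟨h2, by rw [h1]; exact le_top⟩
    have hlim : Filter.Tendsto (fun k : ℕ => (A : ℝ≥0∞) ^ q *
        (((n : ℝ≥0∞) + 1)⁻¹ * ((k + 1 : ℕ) : ℝ≥0∞)) ^ (-κ)) Filter.atTop (nhds 0) := by
      have h1 : Filter.Tendsto (fun k : ℕ => ((n : ℝ≥0∞) + 1)⁻¹ * ((k + 1 : ℕ) : ℝ≥0∞))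
          Filter.atTop (nhds ⊤) := by
        have := ENNReal.Tendsto.const_mul (a := ((n : ℝ≥0∞) + 1)⁻¹)
          ((Filter.tendsto_add_atTop_iff_nat 1).2 ENNReal.tendsto_nat_nhds_top) (Or.inl (by simp))
        rwa [ENNReal.mul_top hc0] at this
      have h2 := (ENNReal.continuous_rpow_const (y := -κ)).continuousAt.tendsto.comp h1
      rw [ENNReal.top_rpow_of_neg (by linarith)] at h2
      have h3 := ENNReal.Tendsto.const_mul (a := (A : ℝ≥0∞) ^ q) h2
        (Or.inr (ENNReal.rpow_ne_top_of_nonneg hq0.le ENNReal.coe_ne_top))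
      rwa [mul_zero] at h3
    exact le_antisymm (ge_of_tendsto' hlim hb) zero_le
  refine ⟨4 ^ q * ((Real.toNNReal p' ^ p * Real.toNNReal p' ^ p) ^ r) * (A ^ q * 4 ^ κ),
    fun h hh => ?_⟩
  set T : Z → ℝ≥0∞ := fun z =>
    ∫⁻ s, (if a₁ s.1 ≤ b₁ z ∧ a₂ s.2 ≤ b₂ z then h s else 0) ∂(σ₁.prod σ₂) with hT
  set G : ℝ × ℝ → ℝ≥0∞ := fun w => ((ENNReal.ofReal w.1)⁻¹ * ((ENNReal.ofReal w.2)⁻¹ *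
    sublevelIntegral σ₁ σ₂ (Ψ₁ ∘ a₁) (Ψ₂ ∘ a₂) h w.1 w.2)) ^ p with hG
  have hGm : Measurable G := by
    have := measurable_sublevelIntegral (σ₁ := σ₁) (σ₂ := σ₂) (hΨ₁m.comp ha₁) (hΨ₂m.comp ha₂) hh
    fun_prop
  set N : ℝ≥0∞ := ∫⁻ w, G w ∂quadrant with hN
  have hNle : N ≤ ENNReal.ofReal p' ^ p *
      (ENNReal.ofReal p' ^ p * ∫⁻ z, h z ^ p ∂(σ₁.prod σ₂)) := by
    rw [hN, quadrant, lintegral_prod _ hGm.aemeasurable]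
    exact lintegral_sublevelIntegral_rpow_le hp (hΨ₁m.comp ha₁)
      (fun c => measure_cumulative_le a₁ c) (hΨ₂m.comp ha₂)
      (fun c => measure_cumulative_le a₂ c) hh
  -- `Φ z` is the part of `N = ‖average‖_p ^ p` that comes from the box `[X, 2X] × [Y, 2Y]` attached
  -- to `z`. The factor 2 makes the box have measure exactly `X Y` while the averages over it stay
  -- comparable.
  set Φ : Z → ℝ≥0∞ := fun z => ∫⁻ w,
    (if (Ψ₁ (b₁ z) ≤ ENNReal.ofReal w.1 ∧ ENNReal.ofReal w.1 ≤ 2 * Ψ₁ (b₁ z)) ∧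
      (Ψ₂ (b₂ z) ≤ ENNReal.ofReal w.2 ∧ ENNReal.ofReal w.2 ≤ 2 * Ψ₂ (b₂ z)) then G w else 0)
      ∂quadrant with hΦ
  have hΦN : ∀ z, Φ z ≤ N := fun z => lintegral_mono fun w => by
    split_ifs
    · exact le_rfl
    · exact zero_le
  have hTΦ : ∀ z, Ψ₁ (b₁ z) ≠ 0 → Ψ₁ (b₁ z) ≠ ⊤ → Ψ₂ (b₂ z) ≠ 0 → Ψ₂ (b₂ z) ≠ ⊤ →
      T z ^ p ≤ 4 ^ p * (Ψ₁ (b₁ z) * Ψ₂ (b₂ z)) ^ (p - 1) * Φ z := by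
    intro z hX0 hXt hY0 hYt
    set X := Ψ₁ (b₁ z)
    set Y := Ψ₂ (b₂ z)
    have hXY0 : X * Y ≠ 0 := mul_ne_zero hX0 hY0
    have hXYt : X * Y ≠ ⊤ := ENNReal.mul_ne_top hXt hYt
    have hx : 0 < X.toReal := ENNReal.toReal_pos hX0 hXt
    have hy : 0 < Y.toReal := ENNReal.toReal_pos hY0 hYt
    have hR : quadrant (Icc X.toReal (2 * X.toReal) ×ˢ Icc Y.toReal (2 * Y.toReal)) = X * Y := by
      rw [quadrant, Measure.prod_prod, Measure.restrict_apply measurableSet_Icc,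
        Measure.restrict_apply measurableSet_Icc,
        inter_eq_left.2 (Icc_subset_Ioi_iff (by linarith) |>.2 hx),
        inter_eq_left.2 (Icc_subset_Ioi_iff (by linarith) |>.2 hy),
        Real.volume_Icc, Real.volume_Icc, two_mul, two_mul, add_sub_cancel_right,
        add_sub_cancel_right, ENNReal.ofReal_toReal hXt, ENNReal.ofReal_toReal hYt]
    -- On the box the sublevel sets contain the domain of integration of `T z`, and the divisors
    -- `l`, `m` are at most `2X`, `2Y`.
    have hlow : ((2 * X)⁻¹ * ((2 * Y)⁻¹ * T z)) ^ p * (X * Y) ≤ Φ z := by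
      rw [← hR, ← lintegral_indicator_const (measurableSet_Icc.prod measurableSet_Icc)]
      refine lintegral_mono fun w => ?_
      by_cases hw : w ∈ Icc X.toReal (2 * X.toReal) ×ˢ Icc Y.toReal (2 * Y.toReal)
      · obtain ⟨⟨h1, h2⟩, h3, h4⟩ := hw
        rw [indicator_of_mem (show w ∈ Icc X.toReal (2 * X.toReal) ×ˢ Icc Y.toReal (2 * Y.toReal) from
          ⟨⟨h1, h2⟩, h3, h4⟩)]
        have e1 : X ≤ ENNReal.ofReal w.1 := (ENNReal.le_ofReal_iff_toReal_le hXt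
          (hx.le.trans h1)).2 h1
        have e3 : Y ≤ ENNReal.ofReal w.2 := (ENNReal.le_ofReal_iff_toReal_le hYt
          (hy.le.trans h3)).2 h3
        have e2 : ENNReal.ofReal w.1 ≤ 2 * X := by
          refine ENNReal.ofReal_le_of_le_toReal ?_
          rw [ENNReal.toReal_mul]; simpa using h2
        have e4 : ENNReal.ofReal w.2 ≤ 2 * Y := by
          refine ENNReal.ofReal_le_of_le_toReal ?_
          rw [ENNReal.toReal_mul]; simpa using h4
        rw [if_pos ⟨⟨e1, e2⟩, e3, e4⟩, hG]
        dsimp only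
        gcongr
        rw [sublevelIntegral_eq (hΨ₁m.comp ha₁) (hΨ₂m.comp ha₂) hh]
        refine lintegral_mono fun s => ?_
        split_ifs with i1 i2
        · exact le_rfl
        · exact absurd ⟨(hΨ₁mono i1.1).trans e1, (hΨ₂mono i1.2).trans e3⟩ i2
        · exact zero_le
        · exact le_rfl
      · rw [indicator_of_notMem hw]; exact zero_le
    have h4 : (2 * X)⁻¹ * ((2 * Y)⁻¹ * T z) = (4 * (X * Y))⁻¹ * T z := by
      rw [← mul_assoc, ← ENNReal.mul_inv (Or.inl (mul_ne_zero two_ne_zero hX0))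
        (Or.inl (ENNReal.mul_ne_top (by simp) hXt))]
      congr 2
      ring
    have h40 : 4 * (X * Y) ≠ 0 := mul_ne_zero (by norm_num) hXY0
    have h4t : 4 * (X * Y) ≠ ⊤ := ENNReal.mul_ne_top (by norm_num) hXYt
    calc T z ^ p = (4 * (X * Y)) ^ p * (X * Y)⁻¹ *
          (((4 * (X * Y))⁻¹ * T z) ^ p * (X * Y)) := by
          rw [ENNReal.mul_rpow_of_nonneg _ (T z) hp0.le, ENNReal.inv_rpow]
          calc _ = ((4 * (X * Y)) ^ p * ((4 * (X * Y)) ^ p)⁻¹) * ((X * Y)⁻¹ * (X * Y)) *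
                T z ^ p := by
                rw [ENNReal.mul_inv_cancel (by simp [h40, h4t, ENNReal.rpow_eq_zero_iff])
                  (ENNReal.rpow_ne_top_of_nonneg hp0.le h4t), ENNReal.inv_mul_cancel hXY0 hXYt,
                  one_mul, one_mul]
            _ = _ := by ring
      _ ≤ (4 * (X * Y)) ^ p * (X * Y)⁻¹ * Φ z := by rw [← h4]; gcongr
      _ = _ := by
          rw [ENNReal.mul_rpow_of_nonneg _ _ hp0.le, mul_assoc (4 ^ p), ← ENNReal.rpow_neg_one,
            ← ENNReal.rpow_add _ _ hXY0 hXYt]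
          rfl
  have hTq : ∀ᵐ z ∂ν, T z ^ q ≤ 4 ^ q * N ^ (r - 1) * ∫⁻ w, G w *
      (if ENNReal.ofReal w.1 / 2 ≤ Ψ₁ (b₁ z) ∧ ENNReal.ofReal w.2 / 2 ≤ Ψ₂ (b₂ z)
        then (ENNReal.ofReal w.1 * ENNReal.ofReal w.2) ^ κ else 0) ∂quadrant := by
    have hn1 : ∀ᵐ z ∂ν, ¬ (Ψ₁ (b₁ z) = ⊤ ∧ Ψ₂ (b₂ z) ≠ 0) := by
      rw [ae_iff]; simpa using hnull₁
    have hn2 : ∀ᵐ z ∂ν, ¬ (Ψ₂ (b₂ z) = ⊤ ∧ Ψ₁ (b₁ z) ≠ 0) := by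
      rw [ae_iff]; simpa using hnull₂
    filter_upwards [hn1, hn2] with z h1 h2
    by_cases hX0 : Ψ₁ (b₁ z) = 0
    -- A zero mass means integration over a null strip. Together with the null sets above this
    -- leaves only finite, nonzero `X` and `Y`.
    · have hz : T z = 0 := by
        refine le_antisymm ?_ zero_le
        calc T z ≤ ∫⁻ s, ({s | a₁ s ≤ b₁ z} ×ˢ univ).indicator (fun s => h s) s
              ∂(σ₁.prod σ₂) := by
              refine lintegral_mono fun s => ?_
              by_cases hs : a₁ s.1 ≤ b₁ z
              · rw [indicator_of_mem (show s ∈ _ ×ˢ _ from ⟨hs, mem_univ _⟩)]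
                split_ifs <;> simp
              · simp [hs]
          _ = 0 := by
              rw [lintegral_indicator ((measurableSet_le ha₁ measurable_const).prod
                MeasurableSet.univ), Measure.restrict_eq_zero.2, lintegral_zero_measure]
              rw [Measure.prod_prod]
              exact mul_eq_zero_of_left hX0 _
      rw [hz, ENNReal.zero_rpow_of_pos hq0]; exact zero_le
    by_cases hY0 : Ψ₂ (b₂ z) = 0
    · have hz : T z = 0 := by
        refine le_antisymm ?_ zero_le
        calc T z ≤ ∫⁻ s, (univ ×ˢ {s | a₂ s ≤ b₂ z}).indicator (fun s => h s) s
              ∂(σ₁.prod σ₂) := by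
              refine lintegral_mono fun s => ?_
              by_cases hs : a₂ s.2 ≤ b₂ z
              · rw [indicator_of_mem (show s ∈ _ ×ˢ _ from ⟨mem_univ _, hs⟩)]
                split_ifs <;> simp
              · simp [hs]
          _ = 0 := by
              rw [lintegral_indicator (MeasurableSet.univ.prod
                (measurableSet_le ha₂ measurable_const)), Measure.restrict_eq_zero.2,
                lintegral_zero_measure]
              rw [Measure.prod_prod]
              exact mul_eq_zero_of_right _ hY0
      rw [hz, ENNReal.zero_rpow_of_pos hq0]; exact zero_le
    have hXt : Ψ₁ (b₁ z) ≠ ⊤ := fun h => h1 ⟨h, hY0⟩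
    have hYt : Ψ₂ (b₂ z) ≠ ⊤ := fun h => h2 ⟨h, hX0⟩
    have key := hTΦ z hX0 hXt hY0 hYt
    set X := Ψ₁ (b₁ z) with hX
    set Y := Ψ₂ (b₂ z) with hY
    have hXY0 : X * Y ≠ 0 := mul_ne_zero hX0 hY0
    have hXYt : X * Y ≠ ⊤ := ENNReal.mul_ne_top hXt hYt
    -- Here `p ≤ q` enters: `r - 1 ≥ 0` allows all but one power of `Φ` to be replaced by its upper
    -- bound `N`. What remains is linear in `Φ`, so Fubini can be applied.
    have hΦ' : Φ z ^ r ≤ N ^ (r - 1) * Φ z := by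
      calc Φ z ^ r = Φ z ^ (r - 1) * Φ z ^ (1 : ℝ) := by
            rw [← ENNReal.rpow_add_of_nonneg _ _ (by linarith) zero_le_one]; congr 1; ring
        _ ≤ _ := by
            rw [ENNReal.rpow_one]
            gcongr
            exact hΦN z
    calc T z ^ q = (T z ^ p) ^ r := by rw [← ENNReal.rpow_mul, hrp]
      _ ≤ (4 ^ p * (X * Y) ^ (p - 1) * Φ z) ^ r := by gcongr
      _ = 4 ^ q * (X * Y) ^ κ * Φ z ^ r := by
          rw [ENNReal.mul_rpow_of_nonneg _ _ (by linarith),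
            ENNReal.mul_rpow_of_nonneg _ _ (by linarith), ← ENNReal.rpow_mul, ← ENNReal.rpow_mul,
            hrp, hκr]
      _ ≤ 4 ^ q * (X * Y) ^ κ * (N ^ (r - 1) * Φ z) := by gcongr
      _ = 4 ^ q * N ^ (r - 1) * ((X * Y) ^ κ * Φ z) := by ring
      _ ≤ _ := by
          gcongr
          rw [hΦ, ← lintegral_const_mul]
          · refine lintegral_mono fun w => ?_
            split_ifs with i1 i2
            · rw [mul_comm]
              gcongr
              · exact i1.1.1
              · exact i1.2.1
            · refine absurd ⟨?_, ?_⟩ i2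
              · rw [ENNReal.div_le_iff (by simp) (by simp), mul_comm]; exact i1.1.2
              · rw [ENNReal.div_le_iff (by simp) (by simp), mul_comm]; exact i1.2.2
            · simp
            · simp
          · refine Measurable.ite (MeasurableSet.inter (s₁ := {w : ℝ × ℝ | X ≤ ENNReal.ofReal w.1 ∧
                ENNReal.ofReal w.1 ≤ 2 * X}) (s₂ := {w : ℝ × ℝ | Y ≤ ENNReal.ofReal w.2 ∧
                ENNReal.ofReal w.2 ≤ 2 * Y}) ?_ ?_) hGm measurable_const
            · exact measurableSet_le_and_le (by fun_prop) (by fun_prop) (by fun_prop)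
                (by fun_prop)
            · exact measurableSet_le_and_le (by fun_prop) (by fun_prop) (by fun_prop)
                (by fun_prop)
  have hKm : Measurable fun y : Z × (ℝ × ℝ) => G y.2 *
      (if ENNReal.ofReal y.2.1 / 2 ≤ Ψ₁ (b₁ y.1) ∧ ENNReal.ofReal y.2.2 / 2 ≤ Ψ₂ (b₂ y.1)
        then (ENNReal.ofReal y.2.1 * ENNReal.ofReal y.2.2) ^ κ else 0) :=
    Measurable.mul (by fun_prop) (Measurable.ite (measurableSet_le_and_le (by fun_prop)
      (by fun_prop) (by fun_prop) (by fun_prop)) (by fun_prop) (by fun_prop))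
  calc ∫⁻ z, T z ^ q ∂ν ≤ ∫⁻ z, 4 ^ q * N ^ (r - 1) * ∫⁻ w, G w *
      (if ENNReal.ofReal w.1 / 2 ≤ Ψ₁ (b₁ z) ∧ ENNReal.ofReal w.2 / 2 ≤ Ψ₂ (b₂ z)
        then (ENNReal.ofReal w.1 * ENNReal.ofReal w.2) ^ κ else 0) ∂quadrant ∂ν :=
        lintegral_mono_ae hTq
    _ = 4 ^ q * N ^ (r - 1) * ∫⁻ w, G w * (∫⁻ z,
      (if ENNReal.ofReal w.1 / 2 ≤ Ψ₁ (b₁ z) ∧ ENNReal.ofReal w.2 / 2 ≤ Ψ₂ (b₂ z)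
        then (ENNReal.ofReal w.1 * ENNReal.ofReal w.2) ^ κ else 0) ∂ν) ∂quadrant := by
        rw [lintegral_const_mul _ hKm.lintegral_prod_right',
          lintegral_lintegral_swap hKm.aemeasurable]
        congr 1
        refine lintegral_congr fun w => ?_
        dsimp only
        rw [lintegral_const_mul]
        exact Measurable.ite (measurableSet_le_and_le (by fun_prop)
          (by fun_prop) (by fun_prop) (by fun_prop)) (by fun_prop) (by fun_prop)
    _ ≤ 4 ^ q * N ^ (r - 1) * ∫⁻ w, G w * (A ^ q * 4 ^ κ) ∂quadrant := by
        gcongr 4 ^ q * N ^ (r - 1) * ?_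
        refine lintegral_mono_ae ?_
        filter_upwards [ae_quadrant_pos] with w hw
        gcongr G w * ?_
        have hl0 : ENNReal.ofReal w.1 ≠ 0 := by simpa using hw.1
        have hm0 : ENNReal.ofReal w.2 ≠ 0 := by simpa using hw.2
        have hlt : ENNReal.ofReal w.1 ≠ ⊤ := ENNReal.ofReal_ne_top
        have hmt : ENNReal.ofReal w.2 ≠ ⊤ := ENNReal.ofReal_ne_top
        set l := ENNReal.ofReal w.1
        set m := ENNReal.ofReal w.2
        have hlm0 : l * m ≠ 0 := mul_ne_zero hl0 hm0
        have hlmt : l * m ≠ ⊤ := ENNReal.mul_ne_top hlt hmt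
        have e1 : ∫⁻ z, (if l / 2 ≤ Ψ₁ (b₁ z) ∧ m / 2 ≤ Ψ₂ (b₂ z) then (l * m) ^ κ else 0) ∂ν =
            (l * m) ^ κ * ν {z | l / 2 ≤ Ψ₁ (b₁ z) ∧ m / 2 ≤ Ψ₂ (b₂ z)} := by
          rw [← lintegral_indicator_const (measurableSet_le_and_le (by fun_prop) (by fun_prop)
            (by fun_prop) (by fun_prop))]
          exact lintegral_congr fun s => by simp [indicator_apply]
        rw [e1]
        -- A point `(l, m)` belongs only to boxes with `X ≥ l / 2` and `Y ≥ m / 2`; the two halves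
        -- produce the factor `4 ^ κ`.
        calc _ ≤ (l * m) ^ κ * (A ^ q * (l / 2 * (m / 2)) ^ (-κ)) := by
              gcongr
              exact hν (by simp [hl0]) (ENNReal.div_ne_top hlt (by simp)) (by simp [hm0])
                (ENNReal.div_ne_top hmt (by simp))
          _ = _ := by
              have h4 : l / 2 * (m / 2) = l * m * 4⁻¹ := by
                rw [div_eq_mul_inv, div_eq_mul_inv, mul_mul_mul_comm,
                  ← ENNReal.mul_inv (by simp) (by simp)]
                norm_num
              rw [h4, ENNReal.mul_rpow_of_ne_zero hlm0 (by simp), ENNReal.inv_rpow,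
                ENNReal.rpow_neg 4, inv_inv]
              calc _ = (A : ℝ≥0∞) ^ q * 4 ^ κ * ((l * m) ^ κ * (l * m) ^ (-κ)) := by ring
                _ = _ := by
                  rw [← ENNReal.rpow_add _ _ hlm0 hlmt, add_neg_cancel, ENNReal.rpow_zero, mul_one]
    _ = 4 ^ q * N ^ r * (A ^ q * 4 ^ κ) := by
        rw [lintegral_mul_const _ hGm, ← hN]
        have : N ^ r = N ^ (r - 1) * N := by
          nth_rewrite 3 [← ENNReal.rpow_one N]
          rw [← ENNReal.rpow_add_of_nonneg _ _ (by linarith) zero_le_one]; congr 1; ring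
        rw [this]; ring
    _ ≤ 4 ^ q * (ENNReal.ofReal p' ^ p *
      (ENNReal.ofReal p' ^ p * ∫⁻ z, h z ^ p ∂(σ₁.prod σ₂))) ^ r * (A ^ q * 4 ^ κ) := by
        gcongr
    _ = _ := by
        rw [← mul_assoc (ENNReal.ofReal p' ^ p), ENNReal.mul_rpow_of_nonneg _ _ (by linarith)]
        push_cast
        rw [ENNReal.coe_rpow_of_nonneg _ hq0.le, ENNReal.coe_rpow_of_nonneg _ hκ0.le,
          ENNReal.coe_rpow_of_nonneg _ hq0.le, ENNReal.coe_rpow_of_nonneg _ (by linarith : 0 ≤ r),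
          ENNReal.coe_mul, ENNReal.coe_rpow_of_nonneg _ hp0.le]
        simp only [ENNReal.coe_ofNat, ENNReal.ofReal]
        ring

end TwoDim

/-! ### Radial weights: mass of balls, its generalized inverse, and the change of variables. -/

/-- A gauge `r` whose balls have `μ`-measure `t ^ Q`, together with a measure `ρ` of infinite mass
equivalent to `μ`. -/
structure IsRadialWeight {X : Type*} [MeasurableSpace X] (μ ρ : Measure X) (r : X → ℝ)
    (Q : ℝ) : Prop where
  meas : Measurable r
  nonneg : ∀ x, 0 ≤ r x
  pos : 0 < Q
  ball : ∀ t, 0 < t → μ {x | r x < t} = ENNReal.ofReal t ^ Q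
  ac : ρ ≪ μ
  ac' : μ ≪ ρ
  top : ρ univ = ⊤

/-- The measure of the ball of radius `t`. -/
noncomputable def radialMass {X : Type*} [MeasurableSpace X] (ρ : Measure X) (r : X → ℝ)
    (t : ℝ) : ℝ≥0∞ := ρ {x | r x < t}

/-- The generalized inverse of `radialMass`. -/
noncomputable def massRadius {X : Type*} [MeasurableSpace X] (ρ : Measure X) (r : X → ℝ)
    (l : ℝ) : ℝ := sSup {t | 0 ≤ t ∧ radialMass ρ r t ≤ ENNReal.ofReal l}

namespace IsRadialWeight

variable {X : Type*} [MeasurableSpace X] {μ ρ : Measure X} {r : X → ℝ} {Q : ℝ}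

theorem measurableSet_ball (h : IsRadialWeight μ ρ r Q) (t : ℝ) : MeasurableSet {x | r x < t} :=
  measurableSet_lt h.meas measurable_const

theorem ball_eq (h : IsRadialWeight μ ρ r Q) (t : ℝ) :
    μ {x | r x < t} = ENNReal.ofReal t ^ Q := by
  rcases lt_or_ge 0 t with ht | ht
  · exact h.ball t ht
  · have : {x | r x < t} = ∅ := by
      ext x
      simpa using ht.trans (h.nonneg x)
    rw [this, measure_empty, ENNReal.ofReal_of_nonpos ht, ENNReal.zero_rpow_of_pos h.pos]

theorem tendsto_add_inv (t : ℝ) :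
    Filter.Tendsto (fun n : ℕ => t + ((n : ℝ) + 1)⁻¹) Filter.atTop (nhds t) := by
  have := (tendsto_one_div_add_atTop_nhds_zero_nat (𝕜 := ℝ)).const_add t
  simpa using this

theorem tendsto_sub_inv (t : ℝ) :
    Filter.Tendsto (fun n : ℕ => t - ((n : ℝ) + 1)⁻¹) Filter.atTop (nhds t) := by
  have := (tendsto_one_div_add_atTop_nhds_zero_nat (𝕜 := ℝ)).const_sub t
  simpa using this

theorem antitone_inv_succ : Antitone fun n : ℕ => ((n : ℝ) + 1)⁻¹ := fun m n h => by
  have : (m : ℝ) ≤ n := by exact_mod_cast h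
  exact inv_anti₀ (by positivity) (by linarith)

theorem closedBall_eq (h : IsRadialWeight μ ρ r Q) (t : ℝ) :
    μ {x | r x ≤ t} = ENNReal.ofReal t ^ Q := by
  refine le_antisymm ?_ ((h.ball_eq t).symm.le.trans
    (measure_mono fun x (hx : r x < t) => (hx.le : r x ≤ t)))
  have h1 : ∀ n : ℕ, μ {x | r x ≤ t} ≤ ENNReal.ofReal (t + ((n : ℝ) + 1)⁻¹) ^ Q := fun n => by
    rw [← h.ball_eq]
    refine measure_mono fun x (hx : r x ≤ t) => ?_
    have : (0 : ℝ) < ((n : ℝ) + 1)⁻¹ := by positivity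
    exact (by linarith : r x < t + ((n : ℝ) + 1)⁻¹)
  have h2 := ((ENNReal.continuous_rpow_const (y := Q)).comp
    ENNReal.continuous_ofReal).continuousAt.tendsto.comp (tendsto_add_inv t)
  exact ge_of_tendsto' h2 h1

/-- Closed and open balls have the same finite measure `t ^ Q`. Absolute continuity transfers the
nullity of spheres to `ρ`, so that the mass of balls has no jumps except possibly to infinity. -/
theorem sphere_eq (h : IsRadialWeight μ ρ r Q) (t : ℝ) : μ {x | r x = t} = 0 := by
  have h1 : {x | r x = t} = {x | r x ≤ t} \ {x | r x < t} := by
    ext x; simp [le_antisymm_iff]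
  have hsub : {x | r x < t} ⊆ {x | r x ≤ t} := fun x (hx : r x < t) => (hx.le : r x ≤ t)
  rw [h1, measure_sdiff hsub
    (h.measurableSet_ball t).nullMeasurableSet, h.closedBall_eq, h.ball_eq, tsub_self]
  rw [h.ball_eq]
  exact ENNReal.rpow_ne_top_of_nonneg h.pos.le ENNReal.ofReal_ne_top

theorem ae_pos (h : IsRadialWeight μ ρ r Q) : ∀ᵐ x ∂μ, 0 < r x := by
  rw [ae_iff]
  refine measure_mono_null (fun x hx => ?_) (h.sphere_eq 0)
  exact le_antisymm (not_lt.1 hx) (h.nonneg x)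

theorem weight_closedBall (h : IsRadialWeight μ ρ r Q) (t : ℝ) :
    ρ {x | r x ≤ t} = radialMass ρ r t := by
  refine measure_congr ?_
  have h0 : ρ {x | r x = t} = 0 := h.ac (h.sphere_eq t)
  have : ∀ᵐ x ∂ρ, r x ≠ t := by rw [ae_iff]; simpa using h0
  filter_upwards [this] with x hx
  exact propext ⟨fun (h1 : r x ≤ t) => lt_of_le_of_ne h1 hx, fun (h1 : r x < t) => h1.le⟩

theorem mass_mono (ρ : Measure X) (r : X → ℝ) : Monotone (radialMass ρ r) := fun _ t hst =>
  measure_mono fun x hx => (lt_of_lt_of_le hx hst : r x < t)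

theorem measurable_mass (ρ : Measure X) (r : X → ℝ) : Measurable (radialMass ρ r) :=
  (mass_mono ρ r).measurable

theorem mass_of_nonpos (h : IsRadialWeight μ ρ r Q) {t : ℝ} (ht : t ≤ 0) :
    radialMass ρ r t = 0 := by
  have : {x | r x < t} = ∅ := by
    ext x
    simpa using ht.trans (h.nonneg x)
  rw [radialMass, this, measure_empty]

theorem mass_ne_zero (h : IsRadialWeight μ ρ r Q) {t : ℝ} (ht : 0 < t) :
    radialMass ρ r t ≠ 0 := fun h0 => by
  have := h.ac' h0
  rw [h.ball t ht, ENNReal.rpow_eq_zero_iff] at this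
  rcases this with h1 | h1
  · exact (ENNReal.ofReal_pos.2 ht).ne' h1.1
  · exact ENNReal.ofReal_ne_top h1.1

/-- An annulus has positive `μ`-measure, because `t ^ Q` is strictly increasing, and `μ ≪ ρ`. -/
theorem mass_lt (h : IsRadialWeight μ ρ r Q) {s t : ℝ} (hs : 0 ≤ s) (hst : s < t)
    (hfin : radialMass ρ r s ≠ ⊤) : radialMass ρ r s < radialMass ρ r t := by
  refine lt_of_le_of_ne (mass_mono ρ r hst.le) fun heq => ?_
  have hsub : {x | r x < s} ⊆ {x | r x < t} := fun x (hx : r x < s) => (hx.trans hst : r x < t)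
  have h1 : ρ ({x | r x < t} \ {x | r x < s}) = 0 := by
    rw [measure_sdiff hsub
      (h.measurableSet_ball s).nullMeasurableSet hfin]
    change radialMass ρ r t - radialMass ρ r s = 0
    rw [heq, tsub_self]
  have h2 := h.ac' h1
  rw [measure_sdiff hsub
      (h.measurableSet_ball s).nullMeasurableSet (by
        rw [h.ball_eq]; exact ENNReal.rpow_ne_top_of_nonneg h.pos.le ENNReal.ofReal_ne_top),
      h.ball_eq, h.ball_eq, tsub_eq_zero_iff_le] at h2
  have h3 : ENNReal.ofReal s ^ Q < ENNReal.ofReal t ^ Q :=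
    ENNReal.rpow_lt_rpow ((ENNReal.ofReal_lt_ofReal_iff (hs.trans_lt hst)).2 hst) h.pos
  exact absurd h2 (not_le.2 h3)

theorem tendsto_mass_left (ρ : Measure X) (r : X → ℝ) (t : ℝ) :
    Filter.Tendsto (fun n : ℕ => radialMass ρ r (t - ((n : ℝ) + 1)⁻¹)) Filter.atTop
      (nhds (radialMass ρ r t)) := by
  have hmono : Monotone fun n : ℕ => {x | r x < t - ((n : ℝ) + 1)⁻¹} :=
    fun m n hmn x (hx : r x < _) =>
      (lt_of_lt_of_le hx (sub_le_sub_left (antitone_inv_succ hmn) t) : r x < _)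
  have hU : {x | r x < t} = ⋃ n : ℕ, {x | r x < t - ((n : ℝ) + 1)⁻¹} := by
    ext x
    simp only [mem_ofPred_eq, mem_iUnion]
    constructor
    · intro hx
      exact ((tendsto_sub_inv t).eventually_const_lt hx).exists
    · rintro ⟨n, hn⟩
      have : (0 : ℝ) < ((n : ℝ) + 1)⁻¹ := by positivity
      linarith
  rw [radialMass, hU]
  exact tendsto_measure_iUnion_atTop hmono

theorem mass_le_of_forall_lt {t : ℝ} {c : ℝ≥0∞} (hc : ∀ s < t, radialMass ρ r s ≤ c) :
    radialMass ρ r t ≤ c := by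
  refine le_of_tendsto' (tendsto_mass_left ρ r t) fun n => hc _ ?_
  have : (0 : ℝ) < ((n : ℝ) + 1)⁻¹ := by positivity
  linarith

/-- Right continuity of the mass. It needs finite mass slightly beyond `t`: the weight need not be
locally integrable, and the mass may jump to infinity at a finite radius. -/
theorem le_mass_of_forall_gt (h : IsRadialWeight μ ρ r Q) {t t' : ℝ} {c : ℝ≥0∞} (htt' : t < t')
    (hfin : radialMass ρ r t' ≠ ⊤) (hc : ∀ s, t < s → c ≤ radialMass ρ r s) :
    c ≤ radialMass ρ r t := by
  rw [← h.weight_closedBall]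
  have hanti : Antitone fun n : ℕ => {x | r x < t + ((n : ℝ) + 1)⁻¹} :=
    fun m n hmn x (hx : r x < _) =>
      (lt_of_lt_of_le hx (add_le_add_right (antitone_inv_succ hmn) t) : r x < _)
  have hI : {x | r x ≤ t} = ⋂ n : ℕ, {x | r x < t + ((n : ℝ) + 1)⁻¹} := by
    ext x
    simp only [mem_ofPred_eq, mem_iInter]
    constructor
    · intro hx n
      have : (0 : ℝ) < ((n : ℝ) + 1)⁻¹ := by positivity
      linarith
    · intro hx
      exact ge_of_tendsto' (tendsto_add_inv t) fun n => (hx n).le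
  rw [hI]
  obtain ⟨n, hn⟩ := ((tendsto_add_inv t).eventually_lt_const htt').exists
  refine ge_of_tendsto' (tendsto_measure_iInter_atTop
    (fun n => (h.measurableSet_ball _).nullMeasurableSet) hanti ⟨n, ?_⟩) fun n => ?_
  · exact ne_top_of_le_ne_top hfin (mass_mono ρ r hn.le)
  · refine hc _ ?_
    have : (0 : ℝ) < ((n : ℝ) + 1)⁻¹ := by positivity
    linarith

/-- This is where infinite total mass is used. It bounds the set whose supremum defines
`massRadius`. -/
theorem exists_mass_gt (h : IsRadialWeight μ ρ r Q) {c : ℝ≥0∞} (hc : c ≠ ⊤) :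
    ∃ t, 0 < t ∧ c < radialMass ρ r t := by
  have hU : (univ : Set X) = ⋃ n : ℕ, {x | r x < n} := by
    ext x; simpa using exists_nat_gt (r x)
  have hmono : Monotone fun n : ℕ => {x | r x < n} := fun m n hmn x (hx : r x < m) =>
    (lt_of_lt_of_le hx (by exact_mod_cast hmn) : r x < n)
  have htop := h.top
  rw [hU, hmono.measure_iUnion] at htop
  have : c < ⨆ n : ℕ, ρ {x | r x < n} := by rw [htop]; exact hc.lt_top
  obtain ⟨n, hn⟩ := lt_iSup_iff.1 this
  refine ⟨n, ?_, hn⟩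
  by_contra hn0
  have := h.mass_of_nonpos (not_lt.1 hn0)
  rw [radialMass] at this
  rw [this] at hn
  exact not_lt_zero hn

theorem bddAbove_radius (h : IsRadialWeight μ ρ r Q) (l : ℝ) :
    BddAbove {t | 0 ≤ t ∧ radialMass ρ r t ≤ ENNReal.ofReal l} := by
  obtain ⟨t, _, ht⟩ := h.exists_mass_gt (ENNReal.ofReal_ne_top (r := l))
  refine ⟨t, fun s hs => ?_⟩
  by_contra hst
  exact absurd (ht.trans_le (mass_mono ρ r (not_le.1 hst).le)) (not_lt.2 hs.2)

theorem zero_mem_radius (h : IsRadialWeight μ ρ r Q) (l : ℝ) :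
    (0 : ℝ) ∈ {t | 0 ≤ t ∧ radialMass ρ r t ≤ ENNReal.ofReal l} :=
  ⟨le_rfl, by rw [h.mass_of_nonpos le_rfl]; exact zero_le⟩

theorem le_radius (h : IsRadialWeight μ ρ r Q) {l t : ℝ} (ht : 0 ≤ t)
    (hl : radialMass ρ r t ≤ ENNReal.ofReal l) : t ≤ massRadius ρ r l :=
  le_csSup (h.bddAbove_radius l) ⟨ht, hl⟩

theorem radius_nonneg (h : IsRadialWeight μ ρ r Q) (l : ℝ) : 0 ≤ massRadius ρ r l :=
  le_csSup (h.bddAbove_radius l) (h.zero_mem_radius l)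

theorem mass_radius_le (h : IsRadialWeight μ ρ r Q) (l : ℝ) :
    radialMass ρ r (massRadius ρ r l) ≤ ENNReal.ofReal l := by
  refine mass_le_of_forall_lt fun s hs => ?_
  obtain ⟨t, ht, hst⟩ := exists_lt_of_lt_csSup ⟨0, h.zero_mem_radius l⟩ hs
  exact (mass_mono ρ r hst.le).trans ht.2

theorem mass_le_of_le_radius (h : IsRadialWeight μ ρ r Q) {l a : ℝ} (ha : a ≤ massRadius ρ r l) :
    radialMass ρ r a ≤ ENNReal.ofReal l :=
  (mass_mono ρ r ha).trans (h.mass_radius_le l)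

theorem lt_mass_of_radius_lt (h : IsRadialWeight μ ρ r Q) {l t : ℝ} (ht : massRadius ρ r l < t) :
    ENNReal.ofReal l < radialMass ρ r t := by
  by_contra hl
  exact absurd (h.le_radius ((h.radius_nonneg l).trans ht.le) (not_lt.1 hl)) (not_le.2 ht)

theorem radius_mono (h : IsRadialWeight μ ρ r Q) : Monotone (massRadius ρ r) := fun _ _ hlm =>
  h.le_radius (h.radius_nonneg _) ((h.mass_radius_le _).trans (ENNReal.ofReal_le_ofReal hlm))

theorem measurable_radius (h : IsRadialWeight μ ρ r Q) : Measurable (massRadius ρ r) :=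
  h.radius_mono.measurable

theorem radius_mass_le (h : IsRadialWeight μ ρ r Q) {s : ℝ} (hs : 0 ≤ s)
    (hfin : radialMass ρ r s ≠ ⊤) : massRadius ρ r (radialMass ρ r s).toReal ≤ s := by
  by_contra hlt
  have := h.mass_radius_le (radialMass ρ r s).toReal
  rw [ENNReal.ofReal_toReal hfin] at this
  exact absurd (h.mass_lt hs (not_le.1 hlt) hfin) (not_lt.2 this)

theorem weight_sublevel_le (h : IsRadialWeight μ ρ r Q) (c : ℝ≥0) :
    ρ {x | radialMass ρ r (r x) ≤ c} ≤ c := by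
  have := measure_cumulative_le (σ := ρ) r c
  simpa only [h.weight_closedBall] using this

/-- Probability integral transform. Both measures are finite, so it suffices to compare them on
half-lines `Iic c`; for `0 ≤ c` below the total mass, `weight_sublevel_le` gives one inequality and
right continuity of the mass at `massRadius ρ r c` the other. -/
theorem map_mass_eq (h : IsRadialWeight μ ρ r Q) {b : ℝ}
    (hfin : radialMass ρ r b ≠ ⊤) :
    volume.restrict {l : ℝ | 0 < l ∧ ENNReal.ofReal l < radialMass ρ r b} =
      (ρ.restrict {x | r x < b}).map fun x => (radialMass ρ r (r x)).toReal := by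
  have hm : Measurable fun x => (radialMass ρ r (r x)).toReal :=
    ((measurable_mass ρ r).comp h.meas).ennreal_toReal
  set B := (radialMass ρ r b).toReal with hB
  have hset : {l : ℝ | 0 < l ∧ ENNReal.ofReal l < radialMass ρ r b} = Ioo 0 B := by
    ext l
    simp only [mem_ofPred_eq, mem_Ioo]
    refine and_congr_right fun hl => ?_
    rw [hB, ← ENNReal.ofReal_lt_iff_lt_toReal hl.le hfin]
  rw [hset]
  have : IsFiniteMeasure (ρ.restrict {x | r x < b}) :=
    ⟨by rw [Measure.restrict_apply_univ]; exact hfin.lt_top⟩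
  refine Measure.ext_of_Iic _ _ fun c => ?_
  rw [Measure.restrict_apply measurableSet_Iic, Measure.map_apply hm measurableSet_Iic,
    Measure.restrict_apply (hm measurableSet_Iic)]
  rcases lt_or_ge c 0 with hc | hc
  · have h1 : Iic c ∩ Ioo 0 B = ∅ := by
      ext l
      simp only [mem_inter_iff, mem_Iic, mem_Ioo, mem_empty_iff_false, iff_false]
      rintro ⟨h1, h2, _⟩
      linarith
    have h2 : (fun x => (radialMass ρ r (r x)).toReal) ⁻¹' Iic c ∩ {x | r x < b} = ∅ := by
      ext x
      simp only [mem_inter_iff, mem_preimage, mem_Iic, mem_empty_iff_false, iff_false]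
      rintro ⟨h1, _⟩
      have : 0 ≤ (radialMass ρ r (r x)).toReal := ENNReal.toReal_nonneg
      linarith
    rw [h1, h2]; simp
  rcases le_or_gt B c with hcB | hcB
  · have h1 : Iic c ∩ Ioo 0 B = Ioo 0 B :=
      inter_eq_right.2 fun l hl => (hl.2.le.trans hcB : l ≤ c)
    have h2 : (fun x => (radialMass ρ r (r x)).toReal) ⁻¹' Iic c ∩ {x | r x < b} =
        {x | r x < b} := by
      refine inter_eq_right.2 fun x (hx : r x < b) => ?_
      have : (radialMass ρ r (r x)).toReal ≤ B :=
        ENNReal.toReal_mono hfin (mass_mono ρ r hx.le)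
      exact (this.trans hcB : _ ≤ c)
    rw [h1, h2, Real.volume_Ioo, sub_zero, hB, ENNReal.ofReal_toReal hfin]
    rfl
  · have h1 : Iic c ∩ Ioo 0 B = Ioc 0 c := by
      ext l
      simp only [mem_inter_iff, mem_Iic, mem_Ioo, mem_Ioc]
      constructor
      · rintro ⟨h1, h2, _⟩; exact ⟨h2, h1⟩
      · rintro ⟨h1, h2⟩; exact ⟨h2, h1, h2.trans_lt hcB⟩
    have h2 : (fun x => (radialMass ρ r (r x)).toReal) ⁻¹' Iic c ∩ {x | r x < b} =
        {x | radialMass ρ r (r x) ≤ ENNReal.ofReal c ∧ r x < b} := by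
      ext x
      simp only [mem_inter_iff, mem_preimage, mem_Iic, mem_ofPred_eq]
      refine and_congr_left fun hx => ?_
      rw [ENNReal.le_ofReal_iff_toReal_le
        (ne_top_of_le_ne_top hfin (mass_mono ρ r (le_of_lt hx))) hc]
    rw [h1, h2, Real.volume_Ioc, sub_zero]
    have hcW : ENNReal.ofReal c < radialMass ρ r b := by
      rw [ENNReal.ofReal_lt_iff_lt_toReal hc hfin]; exact hcB
    have hRb : massRadius ρ r c < b := by
      by_contra hn
      exact absurd (h.mass_le_of_le_radius (not_lt.1 hn)) (not_le.2 hcW)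
    apply le_antisymm
    · calc ENNReal.ofReal c ≤ radialMass ρ r (massRadius ρ r c) :=
            h.le_mass_of_forall_gt hRb hfin fun s hs => (h.lt_mass_of_radius_lt hs).le
        _ = ρ {x | r x ≤ massRadius ρ r c} := (h.weight_closedBall _).symm
        _ ≤ _ := measure_mono fun x (hx : r x ≤ massRadius ρ r c) =>
            (⟨h.mass_le_of_le_radius hx, hx.trans_lt hRb⟩ :
              radialMass ρ r (r x) ≤ ENNReal.ofReal c ∧ r x < b)
    · exact (measure_mono fun x (hx : _ ∧ _) => hx.1).trans (h.weight_sublevel_le (Real.toNNReal c))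

/-- Substitution `l = W(r x)`. Exhaustion by smaller radii permits infinite mass at `b` itself,
provided that it is finite strictly below. -/
theorem lintegral_mass_le (h : IsRadialWeight μ ρ r Q) {b : ℝ}
    (hfin : ∀ t < b, radialMass ρ r t ≠ ⊤) {F : ℝ → ℝ≥0∞} (hF : Measurable F) :
    ∫⁻ l in {l : ℝ | 0 < l ∧ ENNReal.ofReal l < radialMass ρ r b}, F l ≤
      ∫⁻ x in {x | r x < b}, F (radialMass ρ r (r x)).toReal ∂ρ := by
  have hm : Measurable fun x => (radialMass ρ r (r x)).toReal :=
    ((measurable_mass ρ r).comp h.meas).ennreal_toReal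
  have hlt : ∀ n : ℕ, b - ((n : ℝ) + 1)⁻¹ < b := fun n => by
    have : (0 : ℝ) < ((n : ℝ) + 1)⁻¹ := by positivity
    linarith
  have hU : {l : ℝ | 0 < l ∧ ENNReal.ofReal l < radialMass ρ r b} =
      ⋃ n : ℕ, {l : ℝ | 0 < l ∧ ENNReal.ofReal l < radialMass ρ r (b - ((n : ℝ) + 1)⁻¹)} := by
    ext l
    simp only [mem_ofPred_eq, mem_iUnion]
    constructor
    · rintro ⟨h1, h2⟩
      obtain ⟨n, hn⟩ := ((tendsto_mass_left ρ r b).eventually_const_lt h2).exists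
      exact ⟨n, h1, hn⟩
    · rintro ⟨n, h1, h2⟩
      exact ⟨h1, h2.trans_le (mass_mono ρ r (hlt n).le)⟩
  have hmono : Monotone fun n : ℕ =>
      {l : ℝ | 0 < l ∧ ENNReal.ofReal l < radialMass ρ r (b - ((n : ℝ) + 1)⁻¹)} := by
    rintro m n hmn l ⟨h1, h2⟩
    exact ⟨h1, h2.trans_le (mass_mono ρ r (sub_le_sub_left (antitone_inv_succ hmn) b))⟩
  rw [hU, setLIntegral_iUnion_of_directed _ hmono.directed_le]
  refine iSup_le fun n => ?_
  rw [h.map_mass_eq (hfin _ (hlt n)), lintegral_map hF hm]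
  exact lintegral_mono_set fun x (hx : r x < _) => (hx.trans (hlt n) : r x < b)

end IsRadialWeight

/-! ### Hardy operators with kernels on the mass scale. -/

/-- Two-dimensional Hardy inequality for kernels with product weights `ψ₁ ⊗ ψ₂`. -/
theorem two_dim_hardy_weighted {S₁ S₂ Z : Type*} [MeasurableSpace S₁] [MeasurableSpace S₂]
    [MeasurableSpace Z] {τ₁ : Measure S₁} {τ₂ : Measure S₂} {ν : Measure Z} [SFinite τ₁]
    [SFinite τ₂] [SFinite ν] {p p' q : ℝ} (hp : p.HolderConjugate p') (hpq : p ≤ q)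
    {ψ₁ : S₁ → ℝ≥0∞} {ψ₂ : S₂ → ℝ≥0∞} (hψ₁ : Measurable ψ₁) (hψ₂ : Measurable ψ₂)
    (hψ₁t : ∀ᵐ s ∂τ₁, ψ₁ s ≠ ⊤) (hψ₂t : ∀ᵐ s ∂τ₂, ψ₂ s ≠ ⊤)
    {a₁ : S₁ → ℝ} {a₂ : S₂ → ℝ} {b₁ b₂ : Z → ℝ} (ha₁ : Measurable a₁) (ha₂ : Measurable a₂)
    (hb₁ : Measurable b₁) (hb₂ : Measurable b₂) {A : ℝ≥0}
    (hA : ∀ t₁ t₂ : ℝ, (τ₁.withDensity fun s => ψ₁ s ^ p') {s | a₁ s ≤ t₁} ^ (1 / p') *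
      (τ₂.withDensity fun s => ψ₂ s ^ p') {s | a₂ s ≤ t₂} ^ (1 / p') *
      ν {z | t₁ ≤ b₁ z ∧ t₂ ≤ b₂ z} ^ (1 / q) ≤ A) :
    ∃ C : ℝ≥0, ∀ h : S₁ × S₂ → ℝ≥0∞, Measurable h →
      ∫⁻ z, (∫⁻ s, (if a₁ s.1 ≤ b₁ z ∧ a₂ s.2 ≤ b₂ z then h s * (ψ₁ s.1 * ψ₂ s.2) else 0)
        ∂(τ₁.prod τ₂)) ^ q ∂ν ≤ C * (∫⁻ s, h s ^ p ∂(τ₁.prod τ₂)) ^ (q / p) := by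
  obtain ⟨C, hC⟩ := two_dim_hardy hp hpq ha₁ ha₂ hb₁ hb₂ hA
  refine ⟨C, fun h hh => ?_⟩
  have hp0 := hp.pos
  have hp0' := hp.symm.pos
  have hq0 : 0 < q := hp0.trans_le hpq
  have hexp : p' + (1 - p') * p = 0 := by
    have := hp.inv_add_inv_eq_one; field_simp at this; nlinarith
  have hprod : (τ₁.withDensity fun s => ψ₁ s ^ p').prod (τ₂.withDensity fun s => ψ₂ s ^ p') =
      (τ₁.prod τ₂).withDensity fun z => ψ₁ z.1 ^ p' * ψ₂ z.2 ^ p' :=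
    prod_withDensity (by fun_prop) (by fun_prop)
  -- With `ψ = ψ₁ ψ₂`, the density `ψ ^ p'` times `ψ ^ (1 - p')` is `ψ`, which restores the kernel,
  -- and `ψ ^ p'` times `ψ ^ ((1 - p') p)` is 1 where `ψ ≠ 0`, which keeps the norm. The set `ψ = 0`
  -- only helps.
  set h' : S₁ × S₂ → ℝ≥0∞ := fun s => h s * (ψ₁ s.1 * ψ₂ s.2) ^ (1 - p') with hh'
  have hh'm : Measurable h' := by fun_prop
  have h1 : ∀ᵐ s ∂(τ₁.prod τ₂), ψ₁ s.1 ≠ ⊤ :=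
    Measure.quasiMeasurePreserving_fst.ae hψ₁t
  have h2 : ∀ᵐ s ∂(τ₁.prod τ₂), ψ₂ s.2 ≠ ⊤ :=
    Measure.quasiMeasurePreserving_snd.ae hψ₂t
  have key := hC h' hh'm
  rw [hprod] at key
  have e1 : ∀ z, ∫⁻ s, (if a₁ s.1 ≤ b₁ z ∧ a₂ s.2 ≤ b₂ z then h' s else 0)
      ∂((τ₁.prod τ₂).withDensity fun z => ψ₁ z.1 ^ p' * ψ₂ z.2 ^ p') =
      ∫⁻ s, (if a₁ s.1 ≤ b₁ z ∧ a₂ s.2 ≤ b₂ z then h s * (ψ₁ s.1 * ψ₂ s.2) else 0)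
        ∂(τ₁.prod τ₂) := by
    intro z
    have hms : MeasurableSet {s : S₁ × S₂ | a₁ s.1 ≤ b₁ z ∧ a₂ s.2 ≤ b₂ z} :=
      measurableSet_le_and_le (by fun_prop) (by fun_prop) (by fun_prop) (by fun_prop)
    rw [lintegral_withDensity_eq_lintegral_mul _ (by fun_prop)
      (Measurable.ite hms (by fun_prop) (by fun_prop))]
    refine lintegral_congr_ae ?_
    filter_upwards [h1, h2] with s hs1 hs2
    simp only [Pi.mul_apply]
    split_ifs
    · rw [← ENNReal.mul_rpow_of_nonneg _ _ hp0'.le, hh']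
      dsimp only
      have hst : ψ₁ s.1 * ψ₂ s.2 ≠ ⊤ := ENNReal.mul_ne_top hs1 hs2
      set y := ψ₁ s.1 * ψ₂ s.2
      by_cases hy : y = 0
      · simp [hy, hp0']
      · rw [mul_left_comm, ← ENNReal.rpow_add _ _ hy hst]
        simp
    · simp
  have e2 : ∫⁻ s, h' s ^ p ∂((τ₁.prod τ₂).withDensity fun z => ψ₁ z.1 ^ p' * ψ₂ z.2 ^ p') ≤
      ∫⁻ s, h s ^ p ∂(τ₁.prod τ₂) := by
    rw [lintegral_withDensity_eq_lintegral_mul _ (by fun_prop) (by fun_prop)]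
    refine lintegral_mono_ae ?_
    filter_upwards [h1, h2] with s hs1 hs2
    simp only [Pi.mul_apply]
    rw [← ENNReal.mul_rpow_of_nonneg _ _ hp0'.le, hh']
    dsimp only
    have hst : ψ₁ s.1 * ψ₂ s.2 ≠ ⊤ := ENNReal.mul_ne_top hs1 hs2
    set y := ψ₁ s.1 * ψ₂ s.2
    by_cases hy : y = 0
    · simp [hy, hp0']
    · rw [ENNReal.mul_rpow_of_nonneg _ _ hp0.le, mul_left_comm, ← ENNReal.rpow_mul,
        ← ENNReal.rpow_add _ _ hy hst, hexp]
      simp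
  simp only [e1] at key
  refine key.trans ?_
  gcongr

/-- The weight function of condition (ii) on balls. -/
noncomputable def radialDual {X : Type*} [MeasurableSpace X] (ρ : Measure X) (r : X → ℝ)
    (Q p' : ℝ) (t : ℝ) : ℝ≥0∞ :=
  ∫⁻ x in {x | r x < t}, ENNReal.ofReal (r x) ^ (Q * p') * radialMass ρ r (r x) ^ (-p') ∂ρ

/-- Densities of the dual measures in the two one-dimensional Hardy operators. -/
noncomputable def headKernel {X : Type*} [MeasurableSpace X] (ρ : Measure X) (r : X → ℝ)
    (Q : ℝ) (l : ℝ) : ℝ≥0∞ := ENNReal.ofReal (massRadius ρ r l) ^ Q * (ENNReal.ofReal l)⁻¹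

noncomputable def tailKernel (l : ℝ) : ℝ≥0∞ := (ENNReal.ofReal l)⁻¹

theorem measurable_tailKernel : Measurable tailKernel := by unfold tailKernel; fun_prop

theorem ae_tailKernel_ne_top : ∀ᵐ l ∂(volume.restrict (Ioi (0 : ℝ))), tailKernel l ≠ ⊤ := by
  filter_upwards [ae_restrict_mem measurableSet_Ioi] with l hl
  have : (0 : ℝ) < l := hl
  simpa [tailKernel] using this

namespace IsRadialWeight

variable {X : Type*} [MeasurableSpace X] {μ ρ : Measure X} {r : X → ℝ} {Q p' : ℝ}

theorem measurable_headKernel (h : IsRadialWeight μ ρ r Q) : Measurable (headKernel ρ r Q) := by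
  have := h.measurable_radius
  unfold headKernel; fun_prop

theorem ae_headKernel_ne_top (h : IsRadialWeight μ ρ r Q) :
    ∀ᵐ l ∂(volume.restrict (Ioi (0 : ℝ))), headKernel ρ r Q l ≠ ⊤ := by
  filter_upwards [ae_tailKernel_ne_top] with l hl
  exact ENNReal.mul_ne_top (ENNReal.rpow_ne_top_of_nonneg h.pos.le ENNReal.ofReal_ne_top) hl

/-- The set only contains `l` with `W(-t) ≤ l`, over which `l ^ (-p')` integrates explicitly. -/
theorem tail_measure_le (h : IsRadialWeight μ ρ r Q) (hp' : 1 < p') (t : ℝ) :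
    ((volume.restrict (Ioi (0 : ℝ))).withDensity fun l => tailKernel l ^ p')
      {l | -massRadius ρ r l ≤ t} ≤
      ENNReal.ofReal (p' - 1)⁻¹ * radialMass ρ r (-t) ^ (1 - p') := by
  have hms : MeasurableSet {l | -massRadius ρ r l ≤ t} :=
    measurableSet_le h.measurable_radius.neg measurable_const
  rw [withDensity_apply _ hms, ← lintegral_indicator hms]
  have := lintegral_Ioi_rpow_tail_le (β := p' - 1) (by linarith) (radialMass ρ r (-t))
  rw [neg_sub] at this
  refine le_trans (lintegral_mono fun l => ?_) this
  by_cases hl : -massRadius ρ r l ≤ t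
  · rw [indicator_of_mem (by exact hl), if_pos (h.mass_le_of_le_radius (by linarith))]
    apply le_of_eq
    rw [tailKernel, ENNReal.inv_rpow, ← ENNReal.rpow_neg]
    congr 1; ring
  · rw [indicator_of_notMem (by exact hl)]; exact zero_le

theorem radialDual_mono (ρ : Measure X) (r : X → ℝ) (Q p' : ℝ) :
    Monotone (radialDual ρ r Q p') := fun _ t hst =>
  lintegral_mono_set fun x hx => (lt_of_lt_of_le hx hst : r x < t)

/-- Under the substitution `l = W(r x)` one has `R(l) ≤ r x`, so the kernel on the mass scale turns
into the integrand of `radialDual`. -/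
theorem headKernel_rpow_mass_le (h : IsRadialWeight μ ρ r Q) (hp' : 1 < p') {x : X}
    (hfin : radialMass ρ r (r x) ≠ ⊤) :
    headKernel ρ r Q (radialMass ρ r (r x)).toReal ^ p' ≤
      ENNReal.ofReal (r x) ^ (Q * p') * radialMass ρ r (r x) ^ (-p') := by
  rw [headKernel, ENNReal.ofReal_toReal hfin, ENNReal.mul_rpow_of_nonneg _ _ (by linarith),
    ENNReal.inv_rpow, ← ENNReal.rpow_neg, ← ENNReal.rpow_mul]
  have := h.pos
  gcongr
  exact h.radius_mass_le (h.nonneg x) hfin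

theorem setLIntegral_headKernel_le (h : IsRadialWeight μ ρ r Q) (hp' : 1 < p') {b : ℝ}
    (hfin : ∀ t < b, radialMass ρ r t ≠ ⊤) :
    ∫⁻ l in {l : ℝ | 0 < l ∧ ENNReal.ofReal l < radialMass ρ r b}, headKernel ρ r Q l ^ p' ≤
      radialDual ρ r Q p' b := by
  have := h.measurable_headKernel
  refine (h.lintegral_mass_le hfin (by fun_prop)).trans ?_
  exact setLIntegral_mono' (h.measurableSet_ball b) fun x hx =>
    h.headKernel_rpow_mass_le hp' (hfin _ hx)

theorem radialDual_ne_zero (h : IsRadialWeight μ ρ r Q) (hp' : 1 < p') {b : ℝ} (hb : 0 < b)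
    (hfin : ∀ t < b, radialMass ρ r t ≠ ⊤) : radialDual ρ r Q p' b ≠ 0 := by
  have hm : Measurable fun x =>
      ENNReal.ofReal (r x) ^ (Q * p') * radialMass ρ r (r x) ^ (-p') := by
    have h1 := h.meas
    have h2 := (measurable_mass ρ r).comp h.meas
    exact Measurable.mul (by fun_prop) (h2.pow_const _)
  rw [radialDual, ← pos_iff_ne_zero, setLIntegral_pos_iff hm, pos_iff_ne_zero]
  intro h0
  refine h.mass_ne_zero hb (le_antisymm ?_ zero_le)
  have hpos : ∀ᵐ x ∂ρ, 0 < r x := h.ac.ae_le h.ae_pos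
  rw [← h0]
  refine measure_mono_ae ?_
  filter_upwards [hpos] with x hx (hxb : r x < b)
  refine ⟨?_, hxb⟩
  have h1 : ENNReal.ofReal (r x) ^ (Q * p') ≠ 0 := by
    simp [ENNReal.rpow_eq_zero_iff, hx]
  have h2 : radialMass ρ r (r x) ^ (-p') ≠ 0 := by
    rw [ENNReal.rpow_neg]
    exact ENNReal.inv_ne_zero.2 (ENNReal.rpow_ne_top_of_nonneg (by linarith) (hfin _ hxb))
  exact mul_ne_zero h1 h2

theorem head_measure_eq (h : IsRadialWeight μ ρ r Q) (t : ℝ) :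
    ((volume.restrict (Ioi (0 : ℝ))).withDensity fun l => headKernel ρ r Q l ^ p')
      {l | massRadius ρ r l ≤ t} =
    ∫⁻ l in {l | massRadius ρ r l ≤ t ∧ 0 < l}, headKernel ρ r Q l ^ p' := by
  have hms : MeasurableSet {l | massRadius ρ r l ≤ t} :=
    measurableSet_le h.measurable_radius measurable_const
  rw [withDensity_apply _ hms, Measure.restrict_restrict hms]
  rfl

theorem head_measure_le_of_mass_ne_top (h : IsRadialWeight μ ρ r Q) (hp' : 1 < p') {t t' : ℝ}
    (htt' : t < t') (hfin : radialMass ρ r t' ≠ ⊤) :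
    ((volume.restrict (Ioi (0 : ℝ))).withDensity fun l => headKernel ρ r Q l ^ p')
      {l | massRadius ρ r l ≤ t} ≤ radialDual ρ r Q p' t := by
  have hfin' : ∀ s < t', radialMass ρ r s ≠ ⊤ := fun s hs =>
    ne_top_of_le_ne_top hfin (mass_mono ρ r hs.le)
  rw [h.head_measure_eq]
  refine le_trans (lintegral_mono_set' ?_)
    (h.setLIntegral_headKernel_le hp' fun s hs => hfin' s (hs.trans htt'))
  -- `R(l) ≤ t` only yields `l ≤ W(t)`, while the change of variables covers `l < W(t)`; the
  -- endpoint is a null set.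
  have : ∀ᵐ l : ℝ, l ≠ (radialMass ρ r t).toReal := by
    rw [ae_iff]; simp
  filter_upwards [this] with l hl
  rintro ⟨h1, h2⟩
  refine ⟨h2, lt_of_le_of_ne ?_ fun heq => hl ?_⟩
  · exact h.le_mass_of_forall_gt htt' hfin fun s hs =>
      (h.lt_mass_of_radius_lt (lt_of_le_of_lt h1 hs)).le
  · rw [← heq, ENNReal.toReal_ofReal h2.le]

/-- When the mass becomes infinite beyond a finite radius `b`, levels `l ≥ W(b)` have `R(l) ≤ b` and
correspond to no points of the group. Their contribution is at most a constant `K`, and it matters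
only for `t ≥ b`, where `radialDual` is at least its value at `b`. The constant therefore depends on
the weight, which is harmless. -/
theorem exists_head_measure_le (h : IsRadialWeight μ ρ r Q) (hp' : 1 < p') :
    ∃ C : ℝ≥0, ∀ t : ℝ,
    ((volume.restrict (Ioi (0 : ℝ))).withDensity fun l => headKernel ρ r Q l ^ p')
      {l | massRadius ρ r l ≤ t} ≤ C * radialDual ρ r Q p' t := by
  by_cases hall : ∀ t, radialMass ρ r t ≠ ⊤
  · exact ⟨1, fun t => by
      simpa using h.head_measure_le_of_mass_ne_top hp' (lt_add_one t) (hall _)⟩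
  push Not at hall
  obtain ⟨t₀, ht₀⟩ := hall
  set B : Set ℝ := {t | radialMass ρ r t ≠ ⊤} with hB
  have hB0 : (0 : ℝ) ∈ B := by
    change radialMass ρ r 0 ≠ ⊤
    rw [h.mass_of_nonpos le_rfl]; simp
  have hBb : BddAbove B := ⟨t₀, fun t ht => by
    by_contra hlt
    exact ht (top_le_iff.1 (ht₀ ▸ mass_mono ρ r (not_le.1 hlt).le))⟩
  set b := sSup B with hb
  have hb0 : 0 ≤ b := le_csSup hBb hB0
  have hlt : ∀ t < b, ∃ t' > t, radialMass ρ r t' ≠ ⊤ := fun t ht => by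
    obtain ⟨t', ht', h'⟩ := exists_lt_of_lt_csSup ⟨0, hB0⟩ ht
    exact ⟨t', h', ht'⟩
  have hfin : ∀ t < b, radialMass ρ r t ≠ ⊤ := fun t ht => by
    obtain ⟨t', h1, h2⟩ := hlt t ht
    exact ne_top_of_le_ne_top h2 (mass_mono ρ r h1.le)
  have hR : ∀ l, massRadius ρ r l ≤ b := fun l =>
    le_csSup hBb (ne_top_of_le_ne_top ENNReal.ofReal_ne_top (h.mass_radius_le l))
  set K : ℝ≥0∞ := ENNReal.ofReal b ^ (Q * p') *
    (ENNReal.ofReal (p' - 1)⁻¹ * radialMass ρ r b ^ (1 - p')) with hK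
  have hQp : 0 < Q * p' := mul_pos h.pos (by linarith)
  have htotal : ∀ t, ((volume.restrict (Ioi (0 : ℝ))).withDensity
      fun l => headKernel ρ r Q l ^ p') {l | massRadius ρ r l ≤ t} ≤
      radialDual ρ r Q p' b + K := by
    intro t
    have hm := h.measurable_headKernel
    rw [h.head_measure_eq]
    calc _ ≤ ∫⁻ l in {l : ℝ | 0 < l ∧ ENNReal.ofReal l < radialMass ρ r b} ∪
          {l : ℝ | 0 < l ∧ radialMass ρ r b ≤ ENNReal.ofReal l}, headKernel ρ r Q l ^ p' := by
          refine lintegral_mono_set ?_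
          rintro l ⟨_, h2⟩
          rcases lt_or_ge (ENNReal.ofReal l) (radialMass ρ r b) with h3 | h3
          · exact Or.inl ⟨h2, h3⟩
          · exact Or.inr ⟨h2, h3⟩
      _ ≤ _ := lintegral_union_le _ _ _
      _ ≤ _ := by
          gcongr
          · exact h.setLIntegral_headKernel_le hp' hfin
          · have hms : MeasurableSet {l : ℝ | radialMass ρ r b ≤ ENNReal.ofReal l} :=
              measurableSet_le measurable_const (by fun_prop)
            have hset : {l : ℝ | 0 < l ∧ radialMass ρ r b ≤ ENNReal.ofReal l} =
              {l : ℝ | radialMass ρ r b ≤ ENNReal.ofReal l} ∩ Ioi 0 := by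
              ext l; exact and_comm
            rw [hset, ← Measure.restrict_restrict hms, ← lintegral_indicator hms]
            have h1 := lintegral_Ioi_rpow_tail_le (β := p' - 1) (by linarith) (radialMass ρ r b)
            rw [neg_sub] at h1
            calc _ ≤ ∫⁻ l in Ioi (0 : ℝ), ENNReal.ofReal b ^ (Q * p') *
                  (if radialMass ρ r b ≤ ENNReal.ofReal l
                    then ENNReal.ofReal l ^ (-1 - (p' - 1)) else 0) := by
                  refine lintegral_mono fun l => ?_
                  by_cases hl : radialMass ρ r b ≤ ENNReal.ofReal l
                  · rw [indicator_of_mem (by exact hl), if_pos hl, headKernel,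
                      ENNReal.mul_rpow_of_nonneg _ _ (by linarith), ENNReal.inv_rpow,
                      ← ENNReal.rpow_neg, ← ENNReal.rpow_mul]
                    rw [show -1 - (p' - 1) = -p' by ring]
                    gcongr
                    exact hR l
                  · rw [indicator_of_notMem (by exact hl)]; exact zero_le
              _ ≤ _ := by
                  rw [lintegral_const_mul _ (Measurable.ite hms (by fun_prop) (by fun_prop)), hK]
                  exact mul_le_mul_right h1 _
  -- If `b = 0` the factor `0 ^ (Q p')` kills `K`, since `0 * ⊤ = 0`. If `b > 0` then `K` is finite
  -- and `radialDual` at `b` is nonzero, so `K` is absorbed into the constant.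
  rcases hb0.eq_or_lt with hbz | hbpos
  · refine ⟨1, fun t => ?_⟩
    rcases lt_or_ge t b with ht | ht
    · obtain ⟨t', h1, h2⟩ := hlt t ht
      simpa using h.head_measure_le_of_mass_ne_top hp' h1 h2
    · refine (htotal t).trans ?_
      have hK0 : K = 0 := by rw [hK, ← hbz]; simp [hQp]
      rw [hK0, add_zero, ENNReal.coe_one, one_mul]
      exact radialDual_mono ρ r Q p' ht
  · have hI0 := h.radialDual_ne_zero hp' hbpos hfin
    have hKt : K ≠ ⊤ := by
      refine ENNReal.mul_ne_top (ENNReal.rpow_ne_top_of_nonneg hQp.le ENNReal.ofReal_ne_top)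
        (ENNReal.mul_ne_top ENNReal.ofReal_ne_top ?_)
      rw [show 1 - p' = -(p' - 1) by ring, ENNReal.rpow_neg]
      refine ENNReal.inv_ne_top.2 fun h0 => h.mass_ne_zero hbpos ?_
      rw [ENNReal.rpow_eq_zero_iff] at h0
      rcases h0 with h0 | h0
      · exact h0.1
      · linarith [h0.2]
    have hKI : K / radialDual ρ r Q p' b ≠ ⊤ := ENNReal.div_ne_top hKt hI0
    refine ⟨1 + (K / radialDual ρ r Q p' b).toNNReal, fun t => ?_⟩
    rcases lt_or_ge t b with ht | ht
    · obtain ⟨t', h1, h2⟩ := hlt t ht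
      refine (h.head_measure_le_of_mass_ne_top hp' h1 h2).trans ?_
      refine le_mul_of_one_le_left zero_le ?_
      push_cast
      exact le_self_add
    · refine (htotal t).trans ?_
      have hle := radialDual_mono ρ r Q p' ht
      push_cast
      rw [ENNReal.coe_toNNReal hKI, add_mul, one_mul]
      by_cases hIt : radialDual ρ r Q p' b = ⊤
      · rw [hIt] at hle
        simp [top_le_iff.1 hle]
      · gcongr
        calc K = K / radialDual ρ r Q p' b * radialDual ρ r Q p' b :=
              (ENNReal.div_mul_cancel hI0 hIt).symm
          _ ≤ _ := by gcongr

end IsRadialWeight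

/-- One-dimensional data of a Hardy-type operator: kernel `ψ` on `(0, ∞)` with position `a`,
target position `b`, and the bound of the kernel mass below `t` in terms of `coef`. -/
structure IsHardySide {X : Type*} [MeasurableSpace X] (μ : Measure X) (p' : ℝ) (ψ : ℝ → ℝ≥0∞)
    (a : ℝ → ℝ) (b : X → ℝ) (coef : ℝ → ℝ≥0∞) (region : ℝ → Set X) : Prop where
  meas_ψ : Measurable ψ
  ne_top : ∀ᵐ l ∂(volume.restrict (Ioi (0 : ℝ))), ψ l ≠ ⊤
  meas_a : Measurable a
  meas_b : Measurable b
  bound : ∃ C : ℝ≥0, ∀ t : ℝ,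
    ((volume.restrict (Ioi (0 : ℝ))).withDensity fun l => ψ l ^ p') {l | a l ≤ t} = 0 ∨
    μ {x | t ≤ b x} = 0 ∨
    ∃ s > 0, ((volume.restrict (Ioi (0 : ℝ))).withDensity fun l => ψ l ^ p') {l | a l ≤ t} ^
      (1 / p') ≤ C * coef s ∧ ∀ᵐ x ∂μ, t ≤ b x → x ∈ region s

namespace IsRadialWeight

variable {X : Type*} [MeasurableSpace X] {μ ρ : Measure X} {r : X → ℝ} {Q p p' : ℝ}

/-- Levels with `R(l) ≤ r x`. The testing conditions concern positive radii only; thresholds `t ≤ 0`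
carry no kernel mass because `radialDual` vanishes there. -/
theorem headSide (h : IsRadialWeight μ ρ r Q) (hp' : 1 < p') :
    IsHardySide μ p' (headKernel ρ r Q) (massRadius ρ r) r
      (fun a => radialDual ρ r Q p' a ^ (1 / p')) (fun a => {x | r x < a}ᶜ) where
  meas_ψ := h.measurable_headKernel
  ne_top := h.ae_headKernel_ne_top
  meas_a := h.measurable_radius
  meas_b := h.meas
  bound := by
    obtain ⟨C, hC⟩ := h.exists_head_measure_le hp'
    have hp0 : 0 ≤ 1 / p' := by positivity
    refine ⟨C ^ (1 / p'), fun t => ?_⟩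
    rcases le_or_gt t 0 with ht | ht
    · left
      have : radialDual ρ r Q p' t = 0 := by
        have he : {x | r x < t} = ∅ := by
          ext x
          simpa using ht.trans (h.nonneg x)
        rw [radialDual, he]; simp
      simpa [this] using hC t
    · right; right
      refine ⟨t, ht, ?_, .of_forall fun x hx => ?_⟩
      · rw [ENNReal.coe_rpow_of_nonneg _ hp0, ← ENNReal.mul_rpow_of_nonneg _ _ hp0]
        exact ENNReal.rpow_le_rpow (hC t) hp0
      · exact fun (hlt : r x < t) => absurd hx (not_le.2 hlt)

/-- Levels with `R(l) ≥ r x`; both positions are negated so that the relation again reads `a ≤ b`.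
The exponent comes from `(1 - p') / p' = -1 / p`. For thresholds `t ≥ 0` the target set is inside
`{r ≤ 0}`, hence null, and the region is an open ball up to a null sphere. -/
theorem tailSide (h : IsRadialWeight μ ρ r Q) (hp : p.HolderConjugate p') :
    IsHardySide μ p' tailKernel (fun l => -massRadius ρ r l) (fun x => -r x)
      (fun a => radialMass ρ r a ^ (-(1 / p))) (fun a => {x | r x < a}) where
  meas_ψ := measurable_tailKernel
  ne_top := ae_tailKernel_ne_top
  meas_a := h.measurable_radius.neg
  meas_b := h.meas.neg
  bound := by
    have hp'1 := hp.symm.lt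
    have hp0 : 0 ≤ 1 / p' := by positivity
    refine ⟨Real.toNNReal (p' - 1)⁻¹ ^ (1 / p'), fun t => ?_⟩
    rcases lt_or_ge t 0 with ht | ht
    · right; right
      refine ⟨-t, by linarith, ?_, ?_⟩
      · have := ENNReal.rpow_le_rpow (h.tail_measure_le hp'1 t) hp0
        rw [ENNReal.mul_rpow_of_nonneg _ _ hp0, ← ENNReal.rpow_mul,
          show (1 - p') * (1 / p') = -(1 / p) by
            have h1 := hp.inv_add_inv_eq_one
            have h2 := hp.symm.ne_zero
            have h3 := hp.ne_zero
            field_simp at h1 ⊢; linarith] at this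
        rw [ENNReal.coe_rpow_of_nonneg _ hp0]
        exact this
      · have h0 : ∀ᵐ x ∂μ, r x ≠ -t := by
          rw [ae_iff]; simpa using h.sphere_eq (-t)
        filter_upwards [h0] with x hx hxt
        exact lt_of_le_of_ne (by linarith) hx
    · right; left
      refine measure_mono_null (fun x (hx : t ≤ -r x) => (by linarith : r x ≤ 0))
        (?_ : μ {x | r x ≤ 0} = 0)
      rw [h.closedBall_eq]
      simp [h.pos]

/-- The left side is at most the measure of the smaller of the balls of radii `R(l)` and `r x`.
Writing it as a head term plus a tail term is what produces four Hardy operators in two variables.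
-/
theorem measure_inter_sublevel_le (h : IsRadialWeight μ ρ r Q) (x : X) (l : ℝ) :
    μ {s | r s < r x ∧ radialMass ρ r (r s) ≤ ENNReal.ofReal l} ≤
      (if massRadius ρ r l ≤ r x then ENNReal.ofReal (massRadius ρ r l) ^ Q else 0) +
      (if -massRadius ρ r l ≤ -r x then ENNReal.ofReal (r x) ^ Q else 0) := by
  rcases le_or_gt (massRadius ρ r l) (r x) with hl | hl
  · refine le_trans ?_ le_self_add
    rw [if_pos hl, ← h.closedBall_eq]
    exact measure_mono fun s hs => h.le_radius (h.nonneg s) hs.2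
  · refine le_trans ?_ le_add_self
    rw [if_pos (by linarith), ← h.ball_eq]
    exact measure_mono fun s hs => hs.1

end IsRadialWeight

/-! ### Pointwise majorants of decreasing functions and of their Hardy transforms. -/

section

variable {X₁ X₂ : Type*} [MeasurableSpace X₁] [MeasurableSpace X₂] {μ₁ ρ₁ : Measure X₁}
  {μ₂ ρ₂ : Measure X₂} {r₁ : X₁ → ℝ} {r₂ : X₂ → ℝ}
  {Q₁ Q₂ p p' q : ℝ} {ν : Measure (X₁ × X₂)}

/-- The two-dimensional Hardy operator with kernels `ψ₁, ψ₂` is measurable. -/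
theorem measurable_hardyOperator {ψ₁ ψ₂ : ℝ → ℝ≥0∞} {a₁ a₂ : ℝ → ℝ} {b₁ : X₁ → ℝ} {b₂ : X₂ → ℝ}
    (hψ₁ : Measurable ψ₁) (hψ₂ : Measurable ψ₂) (ha₁ : Measurable a₁) (ha₂ : Measurable a₂)
    (hb₁ : Measurable b₁) (hb₂ : Measurable b₂) {h : ℝ × ℝ → ℝ≥0∞} (hh : Measurable h) :
    Measurable fun z : X₁ × X₂ => ∫⁻ w, (if a₁ w.1 ≤ b₁ z.1 ∧ a₂ w.2 ≤ b₂ z.2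
        then h w * (ψ₁ w.1 * ψ₂ w.2) else 0) ∂quadrant := by
  have hms : MeasurableSet {y : (X₁ × X₂) × (ℝ × ℝ) | a₁ y.2.1 ≤ b₁ y.1.1 ∧
      a₂ y.2.2 ≤ b₂ y.1.2} :=
    measurableSet_le_and_le (by fun_prop) (by fun_prop) (by fun_prop) (by fun_prop)
  exact (Measurable.ite (f := fun y : (X₁ × X₂) × (ℝ × ℝ) => h y.2 * (ψ₁ y.2.1 * ψ₂ y.2.2))
      (g := fun _ => 0) hms (by fun_prop) (by fun_prop)).lintegral_prod_right'

/-- Treats the four combinations of head and tail at once: the factors `γ₁ γ₂` are absorbed into the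
target measure, and the alternatives of `IsHardySide.bound` are either trivial or reduce to the
testing condition `hA`. -/
theorem IsHardySide.exists_bound [SFinite ν] {ψ₁ ψ₂ : ℝ → ℝ≥0∞} {a₁ a₂ : ℝ → ℝ} {b₁ : X₁ → ℝ} {b₂ : X₂ → ℝ}
    {coef₁ coef₂ : ℝ → ℝ≥0∞} {region₁ : ℝ → Set X₁} {region₂ : ℝ → Set X₂}
    (h₁ : IsHardySide μ₁ p' ψ₁ a₁ b₁ coef₁ region₁)
    (h₂ : IsHardySide μ₂ p' ψ₂ a₂ b₂ coef₂ region₂)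
    (hp : p.HolderConjugate p') (hpq : p ≤ q) (hν : ν ≪ μ₁.prod μ₂)
    {γ₁ : X₁ → ℝ≥0∞} {γ₂ : X₂ → ℝ≥0∞} (hγ₁ : Measurable γ₁) (hγ₂ : Measurable γ₂) {A : ℝ≥0}
    (hA : ∀ s₁ s₂ : ℝ, 0 < s₁ → 0 < s₂ → coef₁ s₁ * coef₂ s₂ *
      (∫⁻ z in region₁ s₁ ×ˢ region₂ s₂, (γ₁ z.1 * γ₂ z.2) ^ q ∂ν) ^ (1 / q) ≤ A) :
    ∃ C : ℝ≥0, ∀ h : ℝ × ℝ → ℝ≥0∞, Measurable h →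
      ∫⁻ z, (γ₁ z.1 * γ₂ z.2 * ∫⁻ w, (if a₁ w.1 ≤ b₁ z.1 ∧ a₂ w.2 ≤ b₂ z.2
        then h w * (ψ₁ w.1 * ψ₂ w.2) else 0) ∂quadrant) ^ q ∂ν ≤
        C * (∫⁻ w, h w ^ p ∂quadrant) ^ (q / p) := by
  have hp0 := hp.pos
  have hp0' : 0 < 1 / p' := one_div_pos.2 hp.symm.pos
  have hq0 : 0 < q := hp0.trans_le hpq
  have hq0' : 0 < 1 / q := one_div_pos.2 hq0
  obtain ⟨C₁, hC₁⟩ := h₁.bound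
  obtain ⟨C₂, hC₂⟩ := h₂.bound
  have hψ₁ := h₁.meas_ψ
  have hψ₂ := h₂.meas_ψ
  have ha₁ := h₁.meas_a
  have ha₂ := h₂.meas_a
  have hb₁ := h₁.meas_b
  have hb₂ := h₂.meas_b
  have hac : (ν.withDensity fun z => (γ₁ z.1 * γ₂ z.2) ^ q) ≪ μ₁.prod μ₂ :=
    (withDensity_absolutelyContinuous _ _).trans hν
  obtain ⟨C, hC⟩ := two_dim_hardy_weighted (τ₁ := volume.restrict (Ioi (0 : ℝ)))
    (τ₂ := volume.restrict (Ioi (0 : ℝ))) (ν := ν.withDensity fun z => (γ₁ z.1 * γ₂ z.2) ^ q)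
    hp hpq hψ₁ hψ₂ h₁.ne_top h₂.ne_top ha₁ ha₂ (hb₁.comp measurable_fst)
    (hb₂.comp measurable_snd) (A := C₁ * C₂ * A) (by
      intro t₁ t₂
      rcases hC₁ t₁ with h0 | h0 | ⟨s₁, hs₁, hle₁, hae₁⟩
      · rw [h0, ENNReal.zero_rpow_of_pos hp0', zero_mul, zero_mul]; exact zero_le
      · have : (ν.withDensity fun z => (γ₁ z.1 * γ₂ z.2) ^ q)
            {z | t₁ ≤ (b₁ ∘ Prod.fst) z ∧ t₂ ≤ (b₂ ∘ Prod.snd) z} = 0 := by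
          refine hac (measure_mono_null (t := Prod.fst ⁻¹' {x | t₁ ≤ b₁ x}) (fun z hz => hz.1) ?_)
          exact Measure.quasiMeasurePreserving_fst.preimage_null h0
        rw [this, ENNReal.zero_rpow_of_pos hq0', mul_zero]
        exact zero_le
      rcases hC₂ t₂ with h0 | h0 | ⟨s₂, hs₂, hle₂, hae₂⟩
      · rw [h0, ENNReal.zero_rpow_of_pos hp0', mul_zero, zero_mul]; exact zero_le
      · have : (ν.withDensity fun z => (γ₁ z.1 * γ₂ z.2) ^ q)
            {z | t₁ ≤ (b₁ ∘ Prod.fst) z ∧ t₂ ≤ (b₂ ∘ Prod.snd) z} = 0 := by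
          refine hac (measure_mono_null (t := Prod.snd ⁻¹' {x | t₂ ≤ b₂ x}) (fun z hz => hz.2) ?_)
          exact Measure.quasiMeasurePreserving_snd.preimage_null h0
        rw [this, ENNReal.zero_rpow_of_pos hq0', mul_zero]
        exact zero_le
      have hνle : (ν.withDensity fun z => (γ₁ z.1 * γ₂ z.2) ^ q)
          {z | t₁ ≤ (b₁ ∘ Prod.fst) z ∧ t₂ ≤ (b₂ ∘ Prod.snd) z} ≤
          ∫⁻ z in region₁ s₁ ×ˢ region₂ s₂, (γ₁ z.1 * γ₂ z.2) ^ q ∂ν := by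
        rw [← withDensity_apply']
        refine measure_mono_ae (hac.ae_le ?_)
        filter_upwards [Measure.quasiMeasurePreserving_fst.ae hae₁,
          Measure.quasiMeasurePreserving_snd.ae hae₂] with z hz1 hz2 hz
        exact ⟨hz1 hz.1, hz2 hz.2⟩
      calc _ ≤ (C₁ * coef₁ s₁) * (C₂ * coef₂ s₂) *
            (∫⁻ z in region₁ s₁ ×ˢ region₂ s₂, (γ₁ z.1 * γ₂ z.2) ^ q ∂ν) ^ (1 / q) := by
            gcongr
        _ = C₁ * C₂ * (coef₁ s₁ * coef₂ s₂ *
            (∫⁻ z in region₁ s₁ ×ˢ region₂ s₂, (γ₁ z.1 * γ₂ z.2) ^ q ∂ν) ^ (1 / q)) := by ring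
        _ ≤ _ := by
            push_cast
            gcongr
            exact hA s₁ s₂ hs₁ hs₂)
  refine ⟨C, fun h hh => ?_⟩
  refine le_trans (le_of_eq ?_) (hC h hh)
  have hm := measurable_hardyOperator hψ₁ hψ₂ ha₁ ha₂ hb₁ hb₂ hh
  have hm' := hm.pow_const q
  symm
  refine (lintegral_withDensity_eq_lintegral_mul ν
    (f := fun z => (γ₁ z.1 * γ₂ z.2) ^ q) (by fun_prop) hm').trans ?_
  symm
  refine lintegral_congr fun z => ?_
  rw [Pi.mul_apply, ENNReal.mul_rpow_of_nonneg _ _ hq0.le]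

/-- The average `(l m)⁻¹ ∫ F` over `{W₁ ∘ r₁ ≤ l} × {W₂ ∘ r₂ ≤ m}`. -/
noncomputable def massAverage (ρ₁ : Measure X₁) (ρ₂ : Measure X₂) (r₁ : X₁ → ℝ) (r₂ : X₂ → ℝ)
    (F : X₁ × X₂ → ℝ≥0∞) (w : ℝ × ℝ) : ℝ≥0∞ :=
  (ENNReal.ofReal w.1)⁻¹ * ((ENNReal.ofReal w.2)⁻¹ *
    sublevelIntegral ρ₁ ρ₂ (radialMass ρ₁ r₁ ∘ r₁) (radialMass ρ₂ r₂ ∘ r₂) F w.1 w.2)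

theorem ae_prod_pos (h₁ : IsRadialWeight μ₁ ρ₁ r₁ Q₁) (h₂ : IsRadialWeight μ₂ ρ₂ r₂ Q₂) :
    ∀ᵐ z ∂(ρ₁.prod ρ₂), 0 < r₁ z.1 ∧ 0 < r₂ z.2 := by
  filter_upwards [Measure.quasiMeasurePreserving_fst.ae (h₁.ac.ae_le h₁.ae_pos),
    Measure.quasiMeasurePreserving_snd.ae (h₂.ac.ae_le h₂.ae_pos)] with z hz1 hz2
  exact ⟨hz1, hz2⟩

variable [SFinite ρ₁] [SFinite ρ₂]

theorem measurable_massAverage (h₁ : IsRadialWeight μ₁ ρ₁ r₁ Q₁) (h₂ : IsRadialWeight μ₂ ρ₂ r₂ Q₂)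
    {F : X₁ × X₂ → ℝ≥0∞} (hF : Measurable F) : Measurable (massAverage ρ₁ ρ₂ r₁ r₂ F) := by
  have := measurable_sublevelIntegral (σ₁ := ρ₁) (σ₂ := ρ₂)
    ((IsRadialWeight.measurable_mass ρ₁ r₁).comp h₁.meas)
    ((IsRadialWeight.measurable_mass ρ₂ r₂).comp h₂.meas) hF
  unfold massAverage
  fun_prop

/-- A function decreasing in both radii is dominated by a double tail integral of its averages. -/
theorem le_lintegral_massAverage (h₁ : IsRadialWeight μ₁ ρ₁ r₁ Q₁)
    (h₂ : IsRadialWeight μ₂ ρ₂ r₂ Q₂) (hp0 : 0 < p) {f : X₁ × X₂ → ℝ≥0}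
    (hdec : ∀ x y x' y', 0 < r₁ x' → 0 < r₂ y' → r₁ x' ≤ r₁ x → r₂ y' ≤ r₂ y →
      f (x, y) ≤ f (x', y'))
    (hN : ∫⁻ z, (f z : ℝ≥0∞) ^ p ∂(ρ₁.prod ρ₂) ≠ ⊤)
    {F : X₁ × X₂ → ℝ≥0∞} (hF : Measurable F)
    (hfF : (fun z => (f z : ℝ≥0∞)) =ᵐ[ρ₁.prod ρ₂] F) {x : X₁} {y : X₂} (hx : 0 < r₁ x)
    (hy : 0 < r₂ y) :
    (f (x, y) : ℝ≥0∞) ≤ ∫⁻ w, (if radialMass ρ₁ r₁ (r₁ x) ≤ ENNReal.ofReal w.1 ∧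
      radialMass ρ₂ r₂ (r₂ y) ≤ ENNReal.ofReal w.2 then
      massAverage ρ₁ ρ₂ r₁ r₂ F w * (tailKernel w.1 * tailKernel w.2) else 0) ∂quadrant := by
  set U := radialMass ρ₁ r₁ (r₁ x) with hU
  set V := radialMass ρ₂ r₂ (r₂ y) with hV
  have hU0 : U ≠ 0 := h₁.mass_ne_zero hx
  have hV0 : V ≠ 0 := h₂.mass_ne_zero hy
  have hbox : MeasurableSet ({s | r₁ s < r₁ x} ×ˢ {s | r₂ s < r₂ y}) :=
    (h₁.measurableSet_ball _).prod (h₂.measurableSet_ball _)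
  have hboxm : (ρ₁.prod ρ₂) ({s | r₁ s < r₁ x} ×ˢ {s | r₂ s < r₂ y}) = U * V :=
    Measure.prod_prod _ _
  have hpow : (f (x, y) : ℝ≥0∞) ^ p * (U * V) ≠ ⊤ := by
    refine ne_top_of_le_ne_top hN ?_
    rw [← hboxm, ← lintegral_indicator_const hbox]
    refine lintegral_mono_ae ?_
    filter_upwards [ae_prod_pos h₁ h₂] with s hs
    by_cases hsb : s ∈ {s | r₁ s < r₁ x} ×ˢ {s | r₂ s < r₂ y}
    · rw [indicator_of_mem hsb]
      gcongr
      exact hdec x y s.1 s.2 hs.1 hs.2 (le_of_lt hsb.1) (le_of_lt hsb.2)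
    · rw [indicator_of_notMem hsb]; exact zero_le
  -- On a box of infinite mass a decreasing function with finite norm must vanish at the outer
  -- corner.
  by_cases hUVt : U * V = ⊤
  · have : (f (x, y) : ℝ≥0∞) = 0 := by
      by_contra hf0
      rw [hUVt, ENNReal.mul_top] at hpow
      · exact hpow rfl
      · simpa [ENNReal.rpow_eq_zero_iff, hp0, hp0.le] using hf0
    rw [this]; exact zero_le
  have hUt : U ≠ ⊤ := fun h => hUVt (by rw [h, ENNReal.top_mul hV0])
  have hVt : V ≠ ⊤ := fun h => hUVt (by rw [h, ENNReal.mul_top hU0])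
  have hlow : ∀ w : ℝ × ℝ, U ≤ ENNReal.ofReal w.1 → V ≤ ENNReal.ofReal w.2 →
      (f (x, y) : ℝ≥0∞) * (U * V) ≤ sublevelIntegral ρ₁ ρ₂ (radialMass ρ₁ r₁ ∘ r₁)
        (radialMass ρ₂ r₂ ∘ r₂) F w.1 w.2 := by
    intro w hw1 hw2
    rw [sublevelIntegral_eq ((IsRadialWeight.measurable_mass ρ₁ r₁).comp h₁.meas)
      ((IsRadialWeight.measurable_mass ρ₂ r₂).comp h₂.meas) hF, ← hboxm,
      ← lintegral_indicator_const hbox]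
    refine lintegral_mono_ae ?_
    filter_upwards [ae_prod_pos h₁ h₂, hfF] with s hs hsF
    by_cases hsb : s ∈ {s | r₁ s < r₁ x} ×ˢ {s | r₂ s < r₂ y}
    · rw [indicator_of_mem hsb, if_pos, ← hsF]
      · exact ENNReal.coe_le_coe.2
          (hdec x y s.1 s.2 hs.1 hs.2 (le_of_lt hsb.1) (le_of_lt hsb.2))
      · exact ⟨(IsRadialWeight.mass_mono ρ₁ r₁ (le_of_lt hsb.1)).trans hw1,
          (IsRadialWeight.mass_mono ρ₂ r₂ (le_of_lt hsb.2)).trans hw2⟩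
    · rw [indicator_of_notMem hsb]; exact zero_le
  -- The integral of `l ^ (-2)` over `l ≥ c` is `1 / c`, so `f(x, y)` is recovered exactly from
  -- `f(x, y) U V`. One factor `l⁻¹` is the normalization of the average, the other is the kernel.
  have htail : ∀ c : ℝ≥0∞, c ≠ 0 → ∫⁻ l in Ioi (0 : ℝ),
      (if c ≤ ENNReal.ofReal l then ENNReal.ofReal l ^ (-1 - 1 : ℝ) else 0) = c⁻¹ := by
    intro c hc
    rw [lintegral_Ioi_rpow_tail one_pos hc]
    simp [ENNReal.rpow_neg_one]
  have hmt : ∀ c : ℝ≥0∞, Measurable fun l : ℝ =>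
      (if c ≤ ENNReal.ofReal l then ENNReal.ofReal l ^ (-1 - 1 : ℝ) else 0) := fun c =>
    Measurable.ite (measurableSet_le measurable_const (by fun_prop)) (by fun_prop) (by fun_prop)
  calc (f (x, y) : ℝ≥0∞) = (f (x, y) : ℝ≥0∞) * (U * V) * (U⁻¹ * V⁻¹) := by
        rw [mul_assoc, mul_mul_mul_comm, ENNReal.mul_inv_cancel hU0 hUt,
          ENNReal.mul_inv_cancel hV0 hVt, one_mul, mul_one]
    _ = ∫⁻ w, (f (x, y) : ℝ≥0∞) * (U * V) *
        ((if U ≤ ENNReal.ofReal w.1 then ENNReal.ofReal w.1 ^ (-1 - 1 : ℝ) else 0) *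
        (if V ≤ ENNReal.ofReal w.2 then ENNReal.ofReal w.2 ^ (-1 - 1 : ℝ) else 0)) ∂quadrant := by
        rw [lintegral_const_mul, quadrant, lintegral_prod_mul (hmt U).aemeasurable
          (hmt V).aemeasurable, htail U hU0, htail V hV0]
        exact ((hmt U).comp measurable_fst).mul ((hmt V).comp measurable_snd)
    _ ≤ _ := by
        refine lintegral_mono_ae ?_
        filter_upwards [ae_quadrant_pos] with w hw
        by_cases hw1 : U ≤ ENNReal.ofReal w.1
        · by_cases hw2 : V ≤ ENNReal.ofReal w.2
          · rw [if_pos hw1, if_pos hw2, if_pos ⟨hw1, hw2⟩, massAverage, tailKernel, tailKernel]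
            have e : ∀ u : ℝ, 0 < u → ENNReal.ofReal u ^ (-1 - 1 : ℝ) =
                (ENNReal.ofReal u)⁻¹ * (ENNReal.ofReal u)⁻¹ := fun u hu => by
              rw [sub_eq_add_neg, ENNReal.rpow_add _ _ (by simpa using hu) ENNReal.ofReal_ne_top,
                ENNReal.rpow_neg_one]
            rw [e _ hw.1, e _ hw.2]
            calc _ = (ENNReal.ofReal w.1)⁻¹ * ((ENNReal.ofReal w.2)⁻¹ *
                  ((f (x, y) : ℝ≥0∞) * (U * V))) *
                  ((ENNReal.ofReal w.1)⁻¹ * (ENNReal.ofReal w.2)⁻¹) := by ring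
              _ ≤ _ := by
                  gcongr
                  exact hlow w hw1 hw2
          · simp [hw2]
        · simp [hw1]

/-- Hardy's inequality applies because `W ∘ r` has distribution dominated by Lebesgue measure
(`weight_sublevel_le`). -/
theorem lintegral_massAverage_rpow_le (h₁ : IsRadialWeight μ₁ ρ₁ r₁ Q₁)
    (h₂ : IsRadialWeight μ₂ ρ₂ r₂ Q₂) (hp : p.HolderConjugate p')
    {F : X₁ × X₂ → ℝ≥0∞} (hF : Measurable F) :
    ∫⁻ w, massAverage ρ₁ ρ₂ r₁ r₂ F w ^ p ∂quadrant ≤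
      ENNReal.ofReal p' ^ p * (ENNReal.ofReal p' ^ p * ∫⁻ z, F z ^ p ∂(ρ₁.prod ρ₂)) := by
  have hm := measurable_massAverage h₁ h₂ hF
  rw [quadrant, lintegral_prod _ (hm.pow_const p).aemeasurable]
  exact lintegral_sublevelIntegral_rpow_le hp
    ((IsRadialWeight.measurable_mass ρ₁ r₁).comp h₁.meas) (fun c => h₁.weight_sublevel_le c)
    ((IsRadialWeight.measurable_mass ρ₂ r₂).comp h₂.meas) (fun c => h₂.weight_sublevel_le c) hF

variable [SFinite μ₁] [SFinite μ₂]

/-- Pointwise bound of the double Hardy operator on decreasing functions by four Hardy operators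
applied to averages. -/
theorem lintegral_ball_le_lintegral_massAverage (h₁ : IsRadialWeight μ₁ ρ₁ r₁ Q₁)
    (h₂ : IsRadialWeight μ₂ ρ₂ r₂ Q₂) (hp0 : 0 < p) {f : X₁ × X₂ → ℝ≥0}
    (hdec : ∀ x y x' y', 0 < r₁ x' → 0 < r₂ y' → r₁ x' ≤ r₁ x → r₂ y' ≤ r₂ y →
      f (x, y) ≤ f (x', y'))
    (hN : ∫⁻ z, (f z : ℝ≥0∞) ^ p ∂(ρ₁.prod ρ₂) ≠ ⊤)
    {F : X₁ × X₂ → ℝ≥0∞} (hF : Measurable F)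
    (hfF : (fun z => (f z : ℝ≥0∞)) =ᵐ[ρ₁.prod ρ₂] F) (z : X₁ × X₂) :
    ∫⁻ s in {s | r₁ s < r₁ z.1} ×ˢ {s | r₂ s < r₂ z.2}, (f s : ℝ≥0∞) ∂(μ₁.prod μ₂) ≤
      ∫⁻ w, massAverage ρ₁ ρ₂ r₁ r₂ F w * (tailKernel w.1 * tailKernel w.2) *
        (((if massRadius ρ₁ r₁ w.1 ≤ r₁ z.1
            then ENNReal.ofReal (massRadius ρ₁ r₁ w.1) ^ Q₁ else 0) +
          (if -massRadius ρ₁ r₁ w.1 ≤ -r₁ z.1 then ENNReal.ofReal (r₁ z.1) ^ Q₁ else 0)) *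
        ((if massRadius ρ₂ r₂ w.2 ≤ r₂ z.2
            then ENNReal.ofReal (massRadius ρ₂ r₂ w.2) ^ Q₂ else 0) +
          (if -massRadius ρ₂ r₂ w.2 ≤ -r₂ z.2 then ENNReal.ofReal (r₂ z.2) ^ Q₂ else 0)))
        ∂quadrant := by
  have hm := measurable_massAverage h₁ h₂ hF
  have hW₁ := (IsRadialWeight.measurable_mass ρ₁ r₁).comp h₁.meas
  have hW₂ := (IsRadialWeight.measurable_mass ρ₂ r₂).comp h₂.meas
  have htm := measurable_tailKernel
  have hbox : MeasurableSet ({s | r₁ s < r₁ z.1} ×ˢ {s | r₂ s < r₂ z.2}) :=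
    (h₁.measurableSet_ball _).prod (h₂.measurableSet_ball _)
  have hKm : Measurable fun y : (X₁ × X₂) × (ℝ × ℝ) =>
      (if (radialMass ρ₁ r₁ ∘ r₁) y.1.1 ≤ ENNReal.ofReal y.2.1 ∧
      (radialMass ρ₂ r₂ ∘ r₂) y.1.2 ≤ ENNReal.ofReal y.2.2 then
      massAverage ρ₁ ρ₂ r₁ r₂ F y.2 * (tailKernel y.2.1 * tailKernel y.2.2) else 0) :=
    Measurable.ite (measurableSet_le_and_le (hW₁.comp (measurable_fst.comp measurable_fst))
      (by fun_prop) (hW₂.comp (measurable_snd.comp measurable_fst)) (by fun_prop))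
      (by fun_prop) (by fun_prop)
  have hpos : ∀ᵐ s ∂((μ₁.prod μ₂).restrict ({s | r₁ s < r₁ z.1} ×ˢ {s | r₂ s < r₂ z.2})),
      0 < r₁ s.1 ∧ 0 < r₂ s.2 := by
    refine ae_restrict_of_ae ?_
    filter_upwards [Measure.quasiMeasurePreserving_fst.ae h₁.ae_pos,
      Measure.quasiMeasurePreserving_snd.ae h₂.ae_pos] with s hs1 hs2
    exact ⟨hs1, hs2⟩
  calc _ ≤ ∫⁻ s in {s | r₁ s < r₁ z.1} ×ˢ {s | r₂ s < r₂ z.2},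
        ∫⁻ w, (if (radialMass ρ₁ r₁ ∘ r₁) s.1 ≤ ENNReal.ofReal w.1 ∧
        (radialMass ρ₂ r₂ ∘ r₂) s.2 ≤ ENNReal.ofReal w.2 then
        massAverage ρ₁ ρ₂ r₁ r₂ F w * (tailKernel w.1 * tailKernel w.2) else 0) ∂quadrant
        ∂(μ₁.prod μ₂) := by
        refine lintegral_mono_ae ?_
        filter_upwards [hpos] with s hs
        exact le_lintegral_massAverage h₁ h₂ hp0 hdec hN hF hfF hs.1 hs.2
    _ = ∫⁻ w, ∫⁻ s in {s | r₁ s < r₁ z.1} ×ˢ {s | r₂ s < r₂ z.2},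
        (if (radialMass ρ₁ r₁ ∘ r₁) s.1 ≤ ENNReal.ofReal w.1 ∧
        (radialMass ρ₂ r₂ ∘ r₂) s.2 ≤ ENNReal.ofReal w.2 then
        massAverage ρ₁ ρ₂ r₁ r₂ F w * (tailKernel w.1 * tailKernel w.2) else 0)
        ∂(μ₁.prod μ₂) ∂quadrant := lintegral_lintegral_swap hKm.aemeasurable
    _ ≤ _ := by
        refine lintegral_mono fun w => ?_
        set c := massAverage ρ₁ ρ₂ r₁ r₂ F w * (tailKernel w.1 * tailKernel w.2)
        have hms : MeasurableSet {s : X₁ × X₂ |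
            (radialMass ρ₁ r₁ ∘ r₁) s.1 ≤ ENNReal.ofReal w.1 ∧
            (radialMass ρ₂ r₂ ∘ r₂) s.2 ≤ ENNReal.ofReal w.2} :=
          measurableSet_le_and_le (hW₁.comp measurable_fst) (by fun_prop)
            (hW₂.comp measurable_snd) (by fun_prop)
        have e1 : ∫⁻ s in {s | r₁ s < r₁ z.1} ×ˢ {s | r₂ s < r₂ z.2},
            (if (radialMass ρ₁ r₁ ∘ r₁) s.1 ≤ ENNReal.ofReal w.1 ∧
            (radialMass ρ₂ r₂ ∘ r₂) s.2 ≤ ENNReal.ofReal w.2 then c else 0) ∂(μ₁.prod μ₂) =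
            c * (μ₁.prod μ₂) ({s | r₁ s < r₁ z.1 ∧ radialMass ρ₁ r₁ (r₁ s) ≤ ENNReal.ofReal w.1}
              ×ˢ {s | r₂ s < r₂ z.2 ∧ radialMass ρ₂ r₂ (r₂ s) ≤ ENNReal.ofReal w.2}) := by
          have hset : {s | r₁ s < r₁ z.1 ∧ radialMass ρ₁ r₁ (r₁ s) ≤ ENNReal.ofReal w.1}
              ×ˢ {s | r₂ s < r₂ z.2 ∧ radialMass ρ₂ r₂ (r₂ s) ≤ ENNReal.ofReal w.2} =
              {s : X₁ × X₂ | (radialMass ρ₁ r₁ ∘ r₁) s.1 ≤ ENNReal.ofReal w.1 ∧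
                (radialMass ρ₂ r₂ ∘ r₂) s.2 ≤ ENNReal.ofReal w.2} ∩
              ({s | r₁ s < r₁ z.1} ×ˢ {s | r₂ s < r₂ z.2}) := by
            ext s
            simp only [mem_prod, mem_ofPred_eq, mem_inter_iff, Function.comp_apply]
            tauto
          rw [hset, ← Measure.restrict_apply hms, ← lintegral_indicator_const hms]
          exact lintegral_congr fun s => by simp [indicator_apply]
        rw [e1, Measure.prod_prod]
        gcongr
        · exact h₁.measure_inter_sublevel_le z.1 w.1
        · exact h₂.measure_inter_sublevel_le z.2 w.2

end

/-! ### Sufficiency of the four conditions. -/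

section

variable {X₁ X₂ : Type*} [MeasurableSpace X₁] [MeasurableSpace X₂] {μ₁ ρ₁ : Measure X₁}
  {μ₂ ρ₂ : Measure X₂} {r₁ : X₁ → ℝ} {r₂ : X₂ → ℝ} {Q₁ Q₂ p p' q : ℝ} {ν : Measure (X₁ × X₂)}

theorem rpow_add_four_le {q : ℝ} (hq : 1 ≤ q) (a b c d : ℝ≥0∞) :
    (a + b + (c + d)) ^ q ≤
      2 ^ (q - 1) * (2 ^ (q - 1) * (a ^ q + b ^ q) + 2 ^ (q - 1) * (c ^ q + d ^ q)) := by
  refine (ENNReal.rpow_add_le_mul_rpow_add_rpow _ _ hq).trans ?_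
  gcongr <;> exact ENNReal.rpow_add_le_mul_rpow_add_rpow _ _ hq

/-- Sufficiency of the four testing conditions. -/
theorem exists_lintegral_hardy_rpow_le [SFinite μ₁] [SFinite μ₂] [SFinite ρ₁] [SFinite ρ₂]
    [SFinite ν] (h₁ : IsRadialWeight μ₁ ρ₁ r₁ Q₁) (h₂ : IsRadialWeight μ₂ ρ₂ r₂ Q₂)
    (hp : p.HolderConjugate p') (hpq : p ≤ q) (hν : ν ≪ μ₁.prod μ₂) {A : ℝ≥0}
    (htt : ∀ s₁ s₂ : ℝ, 0 < s₁ → 0 < s₂ →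
      radialMass ρ₁ r₁ s₁ ^ (-(1 / p)) * radialMass ρ₂ r₂ s₂ ^ (-(1 / p)) *
      (∫⁻ z in {x | r₁ x < s₁} ×ˢ {x | r₂ x < s₂},
        (ENNReal.ofReal (r₁ z.1) ^ Q₁ * ENNReal.ofReal (r₂ z.2) ^ Q₂) ^ q ∂ν) ^ (1 / q) ≤ A)
    (hhh : ∀ s₁ s₂ : ℝ, 0 < s₁ → 0 < s₂ →
      radialDual ρ₁ r₁ Q₁ p' s₁ ^ (1 / p') * radialDual ρ₂ r₂ Q₂ p' s₂ ^ (1 / p') *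
      (∫⁻ _ in {x | r₁ x < s₁}ᶜ ×ˢ {x | r₂ x < s₂}ᶜ, (1 * 1) ^ q ∂ν) ^ (1 / q) ≤ A)
    (hth : ∀ s₁ s₂ : ℝ, 0 < s₁ → 0 < s₂ →
      radialMass ρ₁ r₁ s₁ ^ (-(1 / p)) * radialDual ρ₂ r₂ Q₂ p' s₂ ^ (1 / p') *
      (∫⁻ z in {x | r₁ x < s₁} ×ˢ {x | r₂ x < s₂}ᶜ,
        (ENNReal.ofReal (r₁ z.1) ^ Q₁ * 1) ^ q ∂ν) ^ (1 / q) ≤ A)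
    (hht : ∀ s₁ s₂ : ℝ, 0 < s₁ → 0 < s₂ →
      radialDual ρ₁ r₁ Q₁ p' s₁ ^ (1 / p') * radialMass ρ₂ r₂ s₂ ^ (-(1 / p)) *
      (∫⁻ z in {x | r₁ x < s₁}ᶜ ×ˢ {x | r₂ x < s₂},
        (1 * ENNReal.ofReal (r₂ z.2) ^ Q₂) ^ q ∂ν) ^ (1 / q) ≤ A) :
    ∃ C : ℝ≥0, ∀ f : X₁ × X₂ → ℝ≥0,
      (∀ x y x' y', 0 < r₁ x' → 0 < r₂ y' → r₁ x' ≤ r₁ x → r₂ y' ≤ r₂ y →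
        f (x, y) ≤ f (x', y')) →
      AEMeasurable f (ρ₁.prod ρ₂) → ∫⁻ z, (f z : ℝ≥0∞) ^ p ∂(ρ₁.prod ρ₂) ≠ ⊤ →
      ∫⁻ z, (∫⁻ s in {s | r₁ s < r₁ z.1} ×ˢ {s | r₂ s < r₂ z.2}, (f s : ℝ≥0∞)
        ∂(μ₁.prod μ₂)) ^ q ∂ν ≤ C * (∫⁻ z, (f z : ℝ≥0∞) ^ p ∂(ρ₁.prod ρ₂)) ^ (q / p) := by
  have hp0 := hp.pos
  have hq1 : 1 ≤ q := hp.lt.le.trans hpq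
  have hq0 : 0 < q := by linarith
  have hr₁ := h₁.meas
  have hr₂ := h₂.meas
  have hγ₁ : Measurable fun x => ENNReal.ofReal (r₁ x) ^ Q₁ := by fun_prop
  have hγ₂ : Measurable fun x => ENNReal.ofReal (r₂ x) ^ Q₂ := by fun_prop
  have hR₁ := h₁.measurable_radius
  have hR₂ := h₂.measurable_radius
  have hk₁ := h₁.measurable_headKernel
  have hk₂ := h₂.measurable_headKernel
  have hk := measurable_tailKernel
  obtain ⟨Ctt, htt⟩ := (h₁.tailSide hp).exists_bound (h₂.tailSide hp) hp hpq hν hγ₁ hγ₂ htt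
  obtain ⟨Chh, hhh⟩ := (h₁.headSide hp.symm.lt).exists_bound (h₂.headSide hp.symm.lt) hp hpq hν
    (γ₁ := fun _ => 1) (γ₂ := fun _ => 1) measurable_const measurable_const hhh
  obtain ⟨Cth, hth⟩ := (h₁.tailSide hp).exists_bound (h₂.headSide hp.symm.lt) hp hpq hν
    (γ₂ := fun _ => 1) hγ₁ measurable_const hth
  obtain ⟨Cht, hht⟩ := (h₁.headSide hp.symm.lt).exists_bound (h₂.tailSide hp) hp hpq hν
    (γ₁ := fun _ => 1) measurable_const hγ₂ hht
  set P : ℝ≥0 := Real.toNNReal p' ^ p with hP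
  set D : ℝ≥0 := 2 ^ (q - 1) with hD
  refine ⟨D * (D * (Chh + Cht) + D * (Cth + Ctt)) * (P * P) ^ (q / p), fun f hdec hfm hN => ?_⟩
  -- Averages are taken of a measurable representative `F`, while monotonicity is used for `f`
  -- itself.
  obtain ⟨F, hF, hfF⟩ := hfm.coe_nnreal_ennreal
  have hNF : ∫⁻ z, (f z : ℝ≥0∞) ^ p ∂(ρ₁.prod ρ₂) = ∫⁻ z, F z ^ p ∂(ρ₁.prod ρ₂) :=
    lintegral_congr_ae (by filter_upwards [hfF] with z hz using by rw [hz])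
  set g := massAverage ρ₁ ρ₂ r₁ r₂ F with hg
  have hgm : Measurable g := measurable_massAverage h₁ h₂ hF
  have hgp : ∫⁻ w, g w ^ p ∂quadrant ≤ (P * P : ℝ≥0) * ∫⁻ z, (f z : ℝ≥0∞) ^ p ∂(ρ₁.prod ρ₂) := by
    refine (lintegral_massAverage_rpow_le h₁ h₂ hp hF).trans (le_of_eq ?_)
    rw [hNF, hP, ENNReal.coe_mul, ENNReal.coe_rpow_of_nonneg _ hp0.le, mul_assoc]
    rfl
  have mhh := measurable_hardyOperator hk₁ hk₂ hR₁ hR₂ hr₁ hr₂ hgm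
  have mht := measurable_hardyOperator hk₁ hk hR₁ hR₂.neg hr₁ hr₂.neg hgm
  have mth := measurable_hardyOperator hk hk₂ hR₁.neg hR₂ hr₁.neg hr₂ hgm
  have hpt : ∀ z : X₁ × X₂, (∫⁻ s in {s | r₁ s < r₁ z.1} ×ˢ {s | r₂ s < r₂ z.2}, (f s : ℝ≥0∞)
        ∂(μ₁.prod μ₂)) ≤
      1 * 1 * (∫⁻ w, (if massRadius ρ₁ r₁ w.1 ≤ r₁ z.1 ∧ massRadius ρ₂ r₂ w.2 ≤ r₂ z.2
        then g w * (headKernel ρ₁ r₁ Q₁ w.1 * headKernel ρ₂ r₂ Q₂ w.2) else 0) ∂quadrant) +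
      1 * ENNReal.ofReal (r₂ z.2) ^ Q₂ *
        (∫⁻ w, (if massRadius ρ₁ r₁ w.1 ≤ r₁ z.1 ∧ -massRadius ρ₂ r₂ w.2 ≤ -r₂ z.2
        then g w * (headKernel ρ₁ r₁ Q₁ w.1 * tailKernel w.2) else 0) ∂quadrant) +
      (ENNReal.ofReal (r₁ z.1) ^ Q₁ * 1 *
        (∫⁻ w, (if -massRadius ρ₁ r₁ w.1 ≤ -r₁ z.1 ∧ massRadius ρ₂ r₂ w.2 ≤ r₂ z.2
        then g w * (tailKernel w.1 * headKernel ρ₂ r₂ Q₂ w.2) else 0) ∂quadrant) +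
      ENNReal.ofReal (r₁ z.1) ^ Q₁ * ENNReal.ofReal (r₂ z.2) ^ Q₂ *
        (∫⁻ w, (if -massRadius ρ₁ r₁ w.1 ≤ -r₁ z.1 ∧ -massRadius ρ₂ r₂ w.2 ≤ -r₂ z.2
        then g w * (tailKernel w.1 * tailKernel w.2) else 0) ∂quadrant)) := by
    intro z
    refine (lintegral_ball_le_lintegral_massAverage h₁ h₂ hp0 hdec hN hF hfF z).trans
      (le_of_eq ?_)
    have m1 : MeasurableSet {w : ℝ × ℝ | massRadius ρ₁ r₁ w.1 ≤ r₁ z.1} :=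
      measurableSet_le (hR₁.comp measurable_fst) measurable_const
    have m2 : MeasurableSet {w : ℝ × ℝ | massRadius ρ₂ r₂ w.2 ≤ r₂ z.2} :=
      measurableSet_le (hR₂.comp measurable_snd) measurable_const
    have m3 : MeasurableSet {w : ℝ × ℝ | -massRadius ρ₁ r₁ w.1 ≤ -r₁ z.1} :=
      measurableSet_le (hR₁.comp measurable_fst).neg measurable_const
    have m4 : MeasurableSet {w : ℝ × ℝ | -massRadius ρ₂ r₂ w.2 ≤ -r₂ z.2} :=
      measurableSet_le (hR₂.comp measurable_snd).neg measurable_const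
    have n1 : Measurable fun w : ℝ × ℝ =>
        (if massRadius ρ₁ r₁ w.1 ≤ r₁ z.1 ∧ massRadius ρ₂ r₂ w.2 ≤ r₂ z.2
        then g w * (headKernel ρ₁ r₁ Q₁ w.1 * headKernel ρ₂ r₂ Q₂ w.2) else 0) :=
      Measurable.ite (m1.inter m2) (by fun_prop) measurable_const
    have n2 : Measurable fun w : ℝ × ℝ =>
        (if massRadius ρ₁ r₁ w.1 ≤ r₁ z.1 ∧ -massRadius ρ₂ r₂ w.2 ≤ -r₂ z.2
        then g w * (headKernel ρ₁ r₁ Q₁ w.1 * tailKernel w.2) else 0) :=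
      Measurable.ite (m1.inter m4) (by fun_prop) measurable_const
    have n3 : Measurable fun w : ℝ × ℝ =>
        (if -massRadius ρ₁ r₁ w.1 ≤ -r₁ z.1 ∧ massRadius ρ₂ r₂ w.2 ≤ r₂ z.2
        then g w * (tailKernel w.1 * headKernel ρ₂ r₂ Q₂ w.2) else 0) :=
      Measurable.ite (m3.inter m2) (by fun_prop) measurable_const
    have n4 : Measurable fun w : ℝ × ℝ =>
        (if -massRadius ρ₁ r₁ w.1 ≤ -r₁ z.1 ∧ -massRadius ρ₂ r₂ w.2 ≤ -r₂ z.2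
        then g w * (tailKernel w.1 * tailKernel w.2) else 0) :=
      Measurable.ite (m3.inter m4) (by fun_prop) measurable_const
    rw [← lintegral_const_mul _ n1, ← lintegral_const_mul _ n2, ← lintegral_const_mul _ n3,
      ← lintegral_const_mul _ n4, ← lintegral_add_left (n1.const_mul _),
      ← lintegral_add_left (n3.const_mul _),
      ← lintegral_add_left ((n1.const_mul _).fun_add (n2.const_mul _))]
    refine lintegral_congr fun w => ?_
    -- Expanding the product of two sums; `R(l) ^ Q / l` is the head kernel, and `r ^ Q` leaves the
    -- tail integral as the factor `γ`.
    simp only [headKernel, tailKernel, ite_and]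
    split_ifs <;> ring
  have hscale : (∫⁻ w, g w ^ p ∂quadrant) ^ (q / p) ≤
      ((P * P) ^ (q / p) : ℝ≥0) * (∫⁻ z, (f z : ℝ≥0∞) ^ p ∂(ρ₁.prod ρ₂)) ^ (q / p) := by
    have hqp : 0 ≤ q / p := by positivity
    rw [ENNReal.coe_rpow_of_nonneg _ hqp, ← ENNReal.mul_rpow_of_nonneg _ _ hqp]
    exact ENNReal.rpow_le_rpow hgp hqp
  have e1 := hhh g hgm
  have e2 := hht g hgm
  have e3 := hth g hgm
  have e4 := htt g hgm
  calc _ ≤ ∫⁻ z, (D : ℝ≥0∞) * (D * ((1 * 1 * (∫⁻ w, (if massRadius ρ₁ r₁ w.1 ≤ r₁ z.1 ∧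
          massRadius ρ₂ r₂ w.2 ≤ r₂ z.2
        then g w * (headKernel ρ₁ r₁ Q₁ w.1 * headKernel ρ₂ r₂ Q₂ w.2) else 0) ∂quadrant)) ^ q +
      (1 * ENNReal.ofReal (r₂ z.2) ^ Q₂ *
        (∫⁻ w, (if massRadius ρ₁ r₁ w.1 ≤ r₁ z.1 ∧ -massRadius ρ₂ r₂ w.2 ≤ -r₂ z.2
        then g w * (headKernel ρ₁ r₁ Q₁ w.1 * tailKernel w.2) else 0) ∂quadrant)) ^ q) +
      D * ((ENNReal.ofReal (r₁ z.1) ^ Q₁ * 1 *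
        (∫⁻ w, (if -massRadius ρ₁ r₁ w.1 ≤ -r₁ z.1 ∧ massRadius ρ₂ r₂ w.2 ≤ r₂ z.2
        then g w * (tailKernel w.1 * headKernel ρ₂ r₂ Q₂ w.2) else 0) ∂quadrant)) ^ q +
      (ENNReal.ofReal (r₁ z.1) ^ Q₁ * ENNReal.ofReal (r₂ z.2) ^ Q₂ *
        (∫⁻ w, (if -massRadius ρ₁ r₁ w.1 ≤ -r₁ z.1 ∧ -massRadius ρ₂ r₂ w.2 ≤ -r₂ z.2
        then g w * (tailKernel w.1 * tailKernel w.2) else 0) ∂quadrant)) ^ q)) ∂ν := by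
        refine lintegral_mono fun z => ?_
        refine (ENNReal.rpow_le_rpow (hpt z) hq0.le).trans ?_
        rw [hD, ENNReal.coe_rpow_of_nonneg _ (by linarith : 0 ≤ q - 1)]
        exact rpow_add_four_le hq1 _ _ _ _
    _ = D * (D * ((∫⁻ z, (1 * 1 * (∫⁻ w, (if massRadius ρ₁ r₁ w.1 ≤ r₁ z.1 ∧
          massRadius ρ₂ r₂ w.2 ≤ r₂ z.2
        then g w * (headKernel ρ₁ r₁ Q₁ w.1 * headKernel ρ₂ r₂ Q₂ w.2) else 0) ∂quadrant)) ^ q ∂ν) +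
      (∫⁻ z, (1 * ENNReal.ofReal (r₂ z.2) ^ Q₂ *
        (∫⁻ w, (if massRadius ρ₁ r₁ w.1 ≤ r₁ z.1 ∧ -massRadius ρ₂ r₂ w.2 ≤ -r₂ z.2
        then g w * (headKernel ρ₁ r₁ Q₁ w.1 * tailKernel w.2) else 0) ∂quadrant)) ^ q ∂ν)) +
      D * ((∫⁻ z, (ENNReal.ofReal (r₁ z.1) ^ Q₁ * 1 *
        (∫⁻ w, (if -massRadius ρ₁ r₁ w.1 ≤ -r₁ z.1 ∧ massRadius ρ₂ r₂ w.2 ≤ r₂ z.2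
        then g w * (tailKernel w.1 * headKernel ρ₂ r₂ Q₂ w.2) else 0) ∂quadrant)) ^ q ∂ν) +
      (∫⁻ z, (ENNReal.ofReal (r₁ z.1) ^ Q₁ * ENNReal.ofReal (r₂ z.2) ^ Q₂ *
        (∫⁻ w, (if -massRadius ρ₁ r₁ w.1 ≤ -r₁ z.1 ∧ -massRadius ρ₂ r₂ w.2 ≤ -r₂ z.2
        then g w * (tailKernel w.1 * tailKernel w.2) else 0) ∂quadrant)) ^ q ∂ν))) := by
        rw [lintegral_const_mul' _ _ ENNReal.coe_ne_top, lintegral_add_left (by fun_prop),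
          lintegral_const_mul' _ _ ENNReal.coe_ne_top, lintegral_const_mul' _ _ ENNReal.coe_ne_top,
          lintegral_add_left (by fun_prop), lintegral_add_left (by fun_prop)]
    _ ≤ D * (D * (Chh * (∫⁻ w, g w ^ p ∂quadrant) ^ (q / p) +
          Cht * (∫⁻ w, g w ^ p ∂quadrant) ^ (q / p)) +
          D * (Cth * (∫⁻ w, g w ^ p ∂quadrant) ^ (q / p) +
          Ctt * (∫⁻ w, g w ^ p ∂quadrant) ^ (q / p))) := by
        gcongr
    _ = (D * (D * (Chh + Cht) + D * (Cth + Ctt))) * (∫⁻ w, g w ^ p ∂quadrant) ^ (q / p) := by ring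
    _ ≤ (D * (D * (Chh + Cht) + D * (Cth + Ctt))) * (((P * P) ^ (q / p) : ℝ≥0) *
          (∫⁻ z, (f z : ℝ≥0∞) ^ p ∂(ρ₁.prod ρ₂)) ^ (q / p)) := by
        gcongr
    _ = _ := by push_cast; ring

end

/-! ### Necessity of the four conditions: test functions. -/

/-- For every `c < coef a` there is a decreasing radial function whose Hardy average dominates
`c * γ` times its `L^p` norm on `region a`. -/
def HasHardyTests {X : Type*} [MeasurableSpace X] (μ ρ : Measure X) (r : X → ℝ) (p : ℝ) (C : ℝ≥0)
    (coef : ℝ → ℝ≥0∞) (γ : X → ℝ≥0∞) (region : ℝ → Set X) : Prop :=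
  ∀ a, 0 < a → ∀ c < coef a, ∃ φ : ℝ → ℝ≥0, Antitone φ ∧
    ∫⁻ x, (φ (r x) : ℝ≥0∞) ^ p ∂ρ ≠ 0 ∧ ∫⁻ x, (φ (r x) : ℝ≥0∞) ^ p ∂ρ ≠ ⊤ ∧
    ∀ x ∈ region a, c * γ x * (∫⁻ x, (φ (r x) : ℝ≥0∞) ^ p ∂ρ) ^ (1 / p) ≤
      C * ∫⁻ s in {s | r s < r x}, (φ (r s) : ℝ≥0∞) ∂μ

namespace IsRadialWeight

variable {X : Type*} [MeasurableSpace X] {μ ρ : Measure X} {r : X → ℝ} {Q p p' : ℝ}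

/-- The test function is the indicator of the ball: inside it the Hardy average is `r ^ Q` and the
norm is `W(a) ^ (1/p)`. If `W(a)` is infinite the coefficient is zero and there is no `c` to test.
-/
theorem hasHardyTests_ball (h : IsRadialWeight μ ρ r Q) (hp : 0 < p) :
    HasHardyTests μ ρ r p 1 (fun a => radialMass ρ r a ^ (-(1 / p)))
      (fun x => ENNReal.ofReal (r x) ^ Q) (fun a => {x | r x < a}) := by
  intro a ha c hc
  have hp0 : 0 < 1 / p := by positivity
  have e : ∫⁻ x, (((if r x < a then 1 else 0 : ℝ≥0) : ℝ≥0∞)) ^ p ∂ρ = radialMass ρ r a := by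
    rw [radialMass, ← lintegral_indicator_one (h.measurableSet_ball a)]
    exact lintegral_congr fun s => by
      by_cases hs : r s < a <;> simp [hs, hp]
  refine ⟨fun u => if u < a then 1 else 0, ?_, ?_, ?_, ?_⟩
  · intro u v huv
    by_cases hv : v < a
    · simp [hv, huv.trans_lt hv]
    · simp [hv]
  · rw [e]; exact h.mass_ne_zero ha
  · rw [e]; intro ht
    simp only [ht, ENNReal.rpow_neg, ENNReal.top_rpow_of_pos hp0, ENNReal.inv_top] at hc
    exact not_lt_zero hc
  · intro x (hx : r x < a)
    rw [e]
    have h2 : ∫⁻ s in {s | r s < r x}, (((if r s < a then 1 else 0 : ℝ≥0) : ℝ≥0∞)) ∂μ =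
        ENNReal.ofReal (r x) ^ Q := by
      rw [← h.ball_eq, ← setLIntegral_one]
      refine setLIntegral_congr_fun (h.measurableSet_ball _) fun s (hs : r s < r x) => ?_
      simp [hs.trans hx]
    rw [h2, mul_right_comm]
    gcongr
    calc _ ≤ radialMass ρ r a ^ (-(1 / p)) * radialMass ρ r a ^ (1 / p) := by gcongr
      _ ≤ 1 := by
        rw [ENNReal.rpow_neg]
        exact ENNReal.inv_mul_le_one _

theorem lintegral_mass_rpow_superlevel_ne_top (h : IsRadialWeight μ ρ r Q) [SFinite ρ]
    (hp' : 1 < p') {ε : ℝ} (hε : 0 < ε) :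
    ∫⁻ s in {s | ε ≤ r s}, radialMass ρ r (r s) ^ (-p') ∂ρ ≠ ⊤ := by
  have hms : MeasurableSet {s | ε ≤ r s} := measurableSet_le measurable_const h.meas
  have hb := lintegral_rpow_superlevel_le (σ := ρ) ((measurable_mass ρ r).comp h.meas)
    (fun c => h.weight_sublevel_le c) (β := p' - 1) (by linarith) (radialMass ρ r ε)
  refine ne_top_of_le_ne_top ?_ (le_trans ?_ hb)
  · refine ENNReal.mul_ne_top ENNReal.ofReal_ne_top ?_
    simp [ENNReal.rpow_eq_top_iff, h.mass_ne_zero hε, hp'.le]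
  · rw [← lintegral_indicator hms]
    refine lintegral_mono fun s => ?_
    by_cases hs : ε ≤ r s
    · rw [indicator_of_mem (by exact hs), Function.comp_apply, if_pos (mass_mono ρ r hs),
        show -1 - (p' - 1) = -p' by ring]
    · rw [indicator_of_notMem (by exact hs)]; exact zero_le

theorem mass_ball_inter_mass_le (h : IsRadialWeight μ ρ r Q) {s : X} {a : ℝ} (hs : r s < a) :
    ENNReal.ofReal (r s) ^ Q ≤ μ {t | r t < a ∧ radialMass ρ r (r t) ≤ radialMass ρ r (r s)} := by
  rw [← h.ball_eq]
  exact measure_mono fun t (ht : r t < r s) => ⟨ht.trans hs, mass_mono ρ r ht.le⟩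

/-- With `k = r ^ Q / W`, the dual quantity is the integral of `k ^ p'`, and its Hölder extremal is
`g = k ^ (p' - 1)`. Since `g` need not be decreasing, the test function is `Φ(u)`, the integral of
`g / W` over `{W ∘ r ≥ W(u)}`. The dual Hardy inequality bounds its p-th power norm by that of `g`,
with a constant independent of `a`. By Fubini its integral over the ball is at least the integral of
`g r ^ Q / W = k ^ p'`. -/
theorem exists_hasHardyTests_compl (h : IsRadialWeight μ ρ r Q) [SFinite μ] [SFinite ρ]
    (hp : p.HolderConjugate p') :
    ∃ C : ℝ≥0, HasHardyTests μ ρ r p C (fun a => radialDual ρ r Q p' a ^ (1 / p'))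
      (fun _ => 1) (fun a => {x | r x < a}ᶜ) := by
  have hp0 := hp.pos
  have hp0' := hp.symm.pos
  have hp1 := hp.symm.lt
  have hip : 0 < 1 / p := by positivity
  have hip' : 0 < 1 / p' := by positivity
  have hr := h.meas
  set W : X → ℝ≥0∞ := radialMass ρ r ∘ r with hW
  have hWm : Measurable W := (measurable_mass ρ r).comp hr
  have hW0 : ∀ x, 0 < r x → W x ≠ 0 := fun x hx => h.mass_ne_zero hx
  obtain ⟨C, hC⟩ := lintegral_tail_rpow_le hp hWm h.weight_sublevel_le
  refine ⟨C ^ (1 / p), fun a ha c hc => ?_⟩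
  set k : X → ℝ≥0∞ := fun s => ENNReal.ofReal (r s) ^ Q * (W s)⁻¹ with hk
  have hkm : Measurable k := by fun_prop
  -- The dual integral may diverge at the neutral element. Truncating away from it makes all norms
  -- finite, and monotone convergence recovers any `c` below the coefficient.
  set S : ℕ → Set X := fun n => {s | ((n : ℝ) + 1)⁻¹ ≤ r s ∧ r s < a} with hS
  have hSm : ∀ n, MeasurableSet (S n) := fun n =>
    (measurableSet_le measurable_const hr).inter (measurableSet_lt hr measurable_const)
  have hSmono : Monotone S := fun m n hmn x hx => ⟨(antitone_inv_succ hmn).trans hx.1, hx.2⟩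
  set I : ℕ → ℝ≥0∞ := fun n => ∫⁻ s in S n, k s ^ p' ∂ρ with hI
  have hkp : ∀ s, k s ^ p' = ENNReal.ofReal (r s) ^ (Q * p') * W s ^ (-p') := fun s => by
    rw [hk, ENNReal.mul_rpow_of_nonneg _ _ hp0'.le, ENNReal.inv_rpow, ← ENNReal.rpow_neg,
      ENNReal.rpow_mul]
  have hdual : radialDual ρ r Q p' a = ⨆ n, I n := by
    have hU : {x | r x < a} =ᵐ[ρ] ⋃ n, S n := by
      filter_upwards [h.ac.ae_le h.ae_pos] with x hx
      refine propext ⟨fun (hxa : r x < a) => ?_, fun hx => ?_⟩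
      · obtain ⟨n, hn⟩ := exists_nat_one_div_lt hx
        exact mem_iUnion.2 ⟨n, by simpa using hn.le, hxa⟩
      · obtain ⟨n, hn⟩ := mem_iUnion.1 hx
        exact hn.2
    rw [radialDual, setLIntegral_congr hU, setLIntegral_iUnion_of_directed _ hSmono.directed_le]
    simp only [hI, hkp]
    rfl
  obtain ⟨n, hn⟩ : ∃ n, c < I n ^ (1 / p') := by
    by_contra! hle
    refine absurd hc (not_lt.2 ?_)
    have : ∀ n, I n ≤ c ^ p' := fun n => by
      have := ENNReal.rpow_le_rpow (hle n) hp0'.le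
      rwa [← ENNReal.rpow_mul, one_div_mul_cancel hp0'.ne', ENNReal.rpow_one] at this
    have h2 := ENNReal.rpow_le_rpow (iSup_le this) hip'.le
    rwa [← ENNReal.rpow_mul, mul_one_div_cancel hp0'.ne', ENNReal.rpow_one, ← hdual] at h2
  set ε : ℝ := ((n : ℝ) + 1)⁻¹ with hε
  have hε0 : 0 < ε := by positivity
  have hI0 : I n ≠ 0 := fun h0 => by
    rw [h0, ENNReal.zero_rpow_of_pos hip'] at hn
    exact not_lt_zero hn
  have hfinW := h.lintegral_mass_rpow_superlevel_ne_top hp1 hε0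
  have hfin : ∀ α : ℝ, 0 ≤ α → ∫⁻ s in S n, ENNReal.ofReal (r s) ^ α * W s ^ (-p') ∂ρ ≠ ⊤ := by
    intro α hα
    refine ne_top_of_le_ne_top (ENNReal.mul_ne_top
      (ENNReal.rpow_ne_top_of_nonneg hα (ENNReal.ofReal_ne_top (r := a))) hfinW) ?_
    rw [← lintegral_const_mul' _ _ (ENNReal.rpow_ne_top_of_nonneg hα ENNReal.ofReal_ne_top)]
    refine (setLIntegral_mono' (hSm n) fun s hs => ?_).trans
      (lintegral_mono_set fun s hs => hs.1)
    exact mul_le_mul_left (ENNReal.rpow_le_rpow (ENNReal.ofReal_le_ofReal hs.2.le) hα) _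
  have hIt : I n ≠ ⊤ := by
    simp only [hI, hkp]
    exact hfin _ (mul_pos h.pos hp0').le
  set g : X → ℝ≥0∞ := (S n).indicator fun s => k s ^ (p' - 1) with hg
  have hgm : Measurable g := (hkm.pow_const _).indicator (hSm n)
  set Φ : ℝ → ℝ≥0∞ := fun u => ∫⁻ s, (if radialMass ρ r u ≤ W s then g s * (W s)⁻¹ else 0) ∂ρ
    with hΦ
  have hΦa : Antitone Φ := fun u v huv => lintegral_mono fun s => by
    by_cases hv : radialMass ρ r v ≤ W s
    · simp [hv, (mass_mono ρ r huv).trans hv]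
    · simp [hv]
  have hΦt : ∀ u, Φ u ≠ ⊤ := by
    intro u
    refine ne_top_of_le_ne_top (hfin (Q * (p' - 1)) (mul_nonneg h.pos.le (by linarith))) ?_
    rw [← lintegral_indicator (hSm n)]
    refine lintegral_mono fun s => ?_
    by_cases hs : s ∈ S n
    · rw [hg, indicator_of_mem hs, indicator_of_mem hs]
      split_ifs
      · have hw0 := hW0 s (hε0.trans_le hs.1)
        rw [hk, ENNReal.mul_rpow_of_nonneg _ _ (by linarith : 0 ≤ p' - 1), ← ENNReal.rpow_mul,
          mul_assoc, ENNReal.inv_rpow, ← ENNReal.rpow_neg, ← ENNReal.rpow_neg_one (W s)]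
        by_cases hwt : W s = ⊤
        · simp [hwt]
        · rw [← ENNReal.rpow_add _ _ hw0 hwt, show -(p' - 1) + -1 = -p' by ring]
      · exact zero_le
    · simp [hg, hs]
  have hφ : ∀ u, (((Φ u).toNNReal : ℝ≥0) : ℝ≥0∞) = Φ u := fun u => ENNReal.coe_toNNReal (hΦt u)
  have hnorm : ∫⁻ x, Φ (r x) ^ p ∂ρ ≤ C * I n := by
    refine (hC g hgm).trans (le_of_eq ?_)
    congr 1
    simp only [hI]
    rw [← lintegral_indicator (hSm n)]
    refine lintegral_congr fun s => ?_
    by_cases hs : s ∈ S n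
    · rw [hg, indicator_of_mem hs, indicator_of_mem hs, ← ENNReal.rpow_mul,
        hp.symm.sub_one_mul_conj]
    · simp [hg, hs, hp0]
  have hΦm : Measurable Φ := hΦa.measurable
  have hlow : I n ≤ ∫⁻ s in {s | r s < a}, Φ (r s) ∂μ := by
    have hKm : Measurable fun y : X × X => if W y.1 ≤ W y.2 then g y.2 * (W y.2)⁻¹ else 0 :=
      Measurable.ite (measurableSet_le (hWm.comp measurable_fst) (hWm.comp measurable_snd))
        (by fun_prop) measurable_const
    calc I n = ∫⁻ s, (S n).indicator (fun s => k s ^ p') s ∂ρ := (lintegral_indicator (hSm n) _).symm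
      _ ≤ ∫⁻ s, ∫⁻ t in {t | r t < a}, (if W t ≤ W s then g s * (W s)⁻¹ else 0) ∂μ ∂ρ := by
          refine lintegral_mono fun s => ?_
          by_cases hs : s ∈ S n
          · have hms : MeasurableSet {t | W t ≤ W s} := measurableSet_le hWm measurable_const
            have e : ∫⁻ t in {t | r t < a}, (if W t ≤ W s then g s * (W s)⁻¹ else 0) ∂μ =
                g s * (W s)⁻¹ * μ {t | r t < a ∧ W t ≤ W s} := by
              rw [show {t | r t < a ∧ W t ≤ W s} = {t | W t ≤ W s} ∩ {t | r t < a} from inter_comm _ _,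
                ← Measure.restrict_apply hms, ← lintegral_indicator_const hms]
              exact lintegral_congr fun t => by simp [indicator_apply]
            rw [e, indicator_of_mem hs, hg, indicator_of_mem hs]
            calc k s ^ p' = k s ^ (p' - 1 + 1) := by rw [sub_add_cancel]
              _ = k s ^ (p' - 1) * (W s)⁻¹ * ENNReal.ofReal (r s) ^ Q := by
                  rw [ENNReal.rpow_add_of_nonneg _ _ (by linarith) zero_le_one, ENNReal.rpow_one,
                    mul_assoc, mul_comm (W s)⁻¹]
              _ ≤ _ := by
                  gcongr
                  exact h.mass_ball_inter_mass_le hs.2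
          · simp [hs]
      _ = ∫⁻ t in {t | r t < a}, ∫⁻ s, (if W t ≤ W s then g s * (W s)⁻¹ else 0) ∂ρ ∂μ :=
          lintegral_lintegral_swap (hKm.comp measurable_swap).aemeasurable
      _ = _ := rfl
  refine ⟨fun u => (Φ u).toNNReal, fun u v huv => ENNReal.toNNReal_mono (hΦt u) (hΦa huv), ?_, ?_, ?_⟩
  -- The norm cannot vanish: otherwise `Φ ∘ r` would be zero `μ`-a.e., against `hlow` and `I n ≠ 0`.
  · simp only [hφ]
    intro h0
    rw [lintegral_eq_zero_iff (f := fun x => Φ (r x) ^ p) ((hΦm.comp hr).pow_const p)] at h0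
    have h1 : (fun x => Φ (r x)) =ᵐ[μ] 0 := by
      filter_upwards [h.ac'.ae_le h0] with x hx
      simpa [ENNReal.rpow_eq_zero_iff, hp0, hp0.not_gt] using hx
    rw [setLIntegral_congr_fun_ae (h.measurableSet_ball a) (g := fun _ => 0)
      (by filter_upwards [h1] with x hx _ using hx)] at hlow
    exact hI0 (by simpa using hlow)
  · simp only [hφ]
    exact ne_top_of_le_ne_top (ENNReal.mul_ne_top ENNReal.coe_ne_top hIt) hnorm
  · intro x hx
    have hax : a ≤ r x := not_lt.1 hx
    simp only [hφ, mul_one]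
    calc _ ≤ I n ^ (1 / p') * (C * I n) ^ (1 / p) := by
          gcongr
      _ = C ^ (1 / p) * I n := by
          rw [ENNReal.mul_rpow_of_nonneg _ _ hip.le, mul_left_comm,
            ← ENNReal.rpow_add_of_nonneg _ _ hip'.le hip.le]
          have : 1 / p' + 1 / p = 1 := by
            have := hp.inv_add_inv_eq_one
            rw [one_div, one_div]; linarith
          rw [this, ENNReal.rpow_one]
      _ ≤ _ := by
          rw [ENNReal.coe_rpow_of_nonneg _ hip.le]
          gcongr
          exact hlow.trans (lintegral_mono_set fun s (hs : r s < a) => (hs.trans_le hax : r s < r x))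

end IsRadialWeight

section

variable {X₁ X₂ : Type*} [MeasurableSpace X₁] [MeasurableSpace X₂] {μ₁ ρ₁ : Measure X₁}
  {μ₂ ρ₂ : Measure X₂} {r₁ : X₁ → ℝ} {r₂ : X₂ → ℝ} {p q : ℝ} {ν : Measure (X₁ × X₂)}

/-- Necessity of the testing conditions. -/
theorem HasHardyTests.le [SFinite μ₁] [SFinite μ₂] [SFinite ρ₁] [SFinite ρ₂]
    (hr₁ : Measurable r₁) (hr₂ : Measurable r₂) (hp : 0 < p) (hq : 0 < q) {C₁ C₂ K : ℝ≥0}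
    {coef₁ coef₂ : ℝ → ℝ≥0∞} {γ₁ : X₁ → ℝ≥0∞} {γ₂ : X₂ → ℝ≥0∞}
    {region₁ : ℝ → Set X₁} {region₂ : ℝ → Set X₂}
    (h₁ : HasHardyTests μ₁ ρ₁ r₁ p C₁ coef₁ γ₁ region₁)
    (h₂ : HasHardyTests μ₂ ρ₂ r₂ p C₂ coef₂ γ₂ region₂)
    (hm₁ : ∀ a, MeasurableSet (region₁ a)) (hm₂ : ∀ a, MeasurableSet (region₂ a))
    (hK : ∀ φ₁ φ₂ : ℝ → ℝ≥0, Antitone φ₁ → Antitone φ₂ →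
      ∫⁻ z, ((φ₁ (r₁ z.1) * φ₂ (r₂ z.2) : ℝ≥0) : ℝ≥0∞) ^ p ∂(ρ₁.prod ρ₂) ≠ ⊤ →
      (∫⁻ z, (∫⁻ s in {s | r₁ s < r₁ z.1} ×ˢ {s | r₂ s < r₂ z.2},
        ((φ₁ (r₁ s.1) * φ₂ (r₂ s.2) : ℝ≥0) : ℝ≥0∞) ∂(μ₁.prod μ₂)) ^ q ∂ν) ^ (1 / q) ≤
      K * (∫⁻ z, ((φ₁ (r₁ z.1) * φ₂ (r₂ z.2) : ℝ≥0) : ℝ≥0∞) ^ p ∂(ρ₁.prod ρ₂)) ^ (1 / p))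
    {a₁ a₂ : ℝ} (ha₁ : 0 < a₁) (ha₂ : 0 < a₂) :
    coef₁ a₁ * coef₂ a₂ *
      (∫⁻ z in region₁ a₁ ×ˢ region₂ a₂, (γ₁ z.1 * γ₂ z.2) ^ q ∂ν) ^ (1 / q) ≤ C₁ * C₂ * K := by
  have hq0 : 0 < 1 / q := by positivity
  have hp0 : 0 < 1 / p := by positivity
  rw [mul_assoc]
  -- The coefficients may be infinite or not attained, so each is replaced by an arbitrary smaller,
  -- hence finite, number.
  refine ENNReal.mul_le_of_forall_lt fun c₁ hc₁ d hd => ?_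
  refine (mul_le_mul_right hd.le c₁).trans ?_
  rw [mul_left_comm]
  refine ENNReal.mul_le_of_forall_lt fun c₂ hc₂ e he => ?_
  refine (mul_le_mul_right he.le c₂).trans ?_
  obtain ⟨φ₁, hφ₁, hz₁, ht₁, hb₁⟩ := h₁ a₁ ha₁ c₁ hc₁
  obtain ⟨φ₂, hφ₂, hz₂, ht₂, hb₂⟩ := h₂ a₂ ha₂ c₂ hc₂
  have m₁ : Measurable fun x => (φ₁ (r₁ x) : ℝ≥0∞) := (hφ₁.measurable.comp hr₁).coe_nnreal_ennreal
  have m₂ : Measurable fun x => (φ₂ (r₂ x) : ℝ≥0∞) := (hφ₂.measurable.comp hr₂).coe_nnreal_ennreal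
  set N₁ := ∫⁻ x, (φ₁ (r₁ x) : ℝ≥0∞) ^ p ∂ρ₁
  set N₂ := ∫⁻ x, (φ₂ (r₂ x) : ℝ≥0∞) ^ p ∂ρ₂
  have hN : ∫⁻ z, ((φ₁ (r₁ z.1) * φ₂ (r₂ z.2) : ℝ≥0) : ℝ≥0∞) ^ p ∂(ρ₁.prod ρ₂) = N₁ * N₂ := by
    rw [← lintegral_prod_mul (m₁.pow_const p).aemeasurable (m₂.pow_const p).aemeasurable]
    exact lintegral_congr fun z => by
      rw [ENNReal.coe_mul, ENNReal.mul_rpow_of_nonneg _ _ hp.le]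
  have hH : ∀ z : X₁ × X₂, ∫⁻ s in {s | r₁ s < r₁ z.1} ×ˢ {s | r₂ s < r₂ z.2},
        ((φ₁ (r₁ s.1) * φ₂ (r₂ s.2) : ℝ≥0) : ℝ≥0∞) ∂(μ₁.prod μ₂) =
      (∫⁻ s in {s | r₁ s < r₁ z.1}, (φ₁ (r₁ s) : ℝ≥0∞) ∂μ₁) *
      ∫⁻ s in {s | r₂ s < r₂ z.2}, (φ₂ (r₂ s) : ℝ≥0∞) ∂μ₂ := by
    intro z
    rw [← Measure.prod_restrict, ← lintegral_prod_mul m₁.aemeasurable m₂.aemeasurable]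
    simp only [ENNReal.coe_mul]
  have key := hK φ₁ φ₂ hφ₁ hφ₂ (by rw [hN]; exact ENNReal.mul_ne_top ht₁ ht₂)
  rw [hN, ENNReal.mul_rpow_of_nonneg _ _ hp0.le] at key
  set M₁ := N₁ ^ (1 / p) with hM₁
  set M₂ := N₂ ^ (1 / p) with hM₂
  have hMt : M₁ * M₂ ≠ ⊤ := ENNReal.mul_ne_top (ENNReal.rpow_ne_top_of_nonneg hp0.le ht₁)
    (ENNReal.rpow_ne_top_of_nonneg hp0.le ht₂)
  have hMz : M₁ * M₂ ≠ 0 := mul_ne_zero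
    (by simpa [hM₁, ENNReal.rpow_eq_zero_iff, hp0.not_gt, ht₁] using fun h0 => absurd h0 hz₁)
    (by simpa [hM₂, ENNReal.rpow_eq_zero_iff, hp0.not_gt, ht₂] using fun h0 => absurd h0 hz₂)
  have hc₁t : c₁ ≠ ⊤ := hc₁.ne_top
  have hc₂t : c₂ ≠ ⊤ := hc₂.ne_top
  -- The norms of the tests are finite and nonzero, so both sides may be multiplied by their
  -- product; tensor tests then factor the inequality.
  rw [← ENNReal.mul_le_mul_iff_left hMz hMt]
  set J := ∫⁻ z in region₁ a₁ ×ˢ region₂ a₂, (γ₁ z.1 * γ₂ z.2) ^ q ∂ν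
  have hpow : ∀ c : ℝ≥0∞, c ≠ ⊤ → ∀ f : X₁ × X₂ → ℝ≥0∞, ∀ τ : Measure (X₁ × X₂),
      (∫⁻ z, (c * f z) ^ q ∂τ) ^ (1 / q) = c * (∫⁻ z, f z ^ q ∂τ) ^ (1 / q) := by
    intro c hc f τ
    simp_rw [ENNReal.mul_rpow_of_nonneg _ _ hq.le]
    rw [lintegral_const_mul' _ _ (ENNReal.rpow_ne_top_of_nonneg hq.le hc),
      ENNReal.mul_rpow_of_nonneg _ _ hq0.le, ← ENNReal.rpow_mul, mul_one_div_cancel hq.ne',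
      ENNReal.rpow_one]
  calc c₂ * (c₁ * J ^ (1 / q)) * (M₁ * M₂) = (c₁ * c₂ * (M₁ * M₂)) * J ^ (1 / q) := by ring
    _ = (∫⁻ z in region₁ a₁ ×ˢ region₂ a₂, (c₁ * c₂ * (M₁ * M₂) * (γ₁ z.1 * γ₂ z.2)) ^ q ∂ν)
          ^ (1 / q) := (hpow _ (by finiteness) _ _).symm
    _ ≤ (∫⁻ z in region₁ a₁ ×ˢ region₂ a₂, (C₁ * C₂ *
          (∫⁻ s in {s | r₁ s < r₁ z.1} ×ˢ {s | r₂ s < r₂ z.2},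
            ((φ₁ (r₁ s.1) * φ₂ (r₂ s.2) : ℝ≥0) : ℝ≥0∞) ∂(μ₁.prod μ₂))) ^ q ∂ν) ^ (1 / q) := by
        refine ENNReal.rpow_le_rpow (setLIntegral_mono' ((hm₁ _).prod (hm₂ _)) fun z hz => ?_) hq0.le
        refine ENNReal.rpow_le_rpow ?_ hq.le
        rw [hH]
        calc _ = (c₁ * γ₁ z.1 * M₁) * (c₂ * γ₂ z.2 * M₂) := by ring
          _ ≤ _ := mul_le_mul' (hb₁ _ hz.1) (hb₂ _ hz.2)
          _ = _ := by ring
    _ ≤ (∫⁻ z, (C₁ * C₂ *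
          (∫⁻ s in {s | r₁ s < r₁ z.1} ×ˢ {s | r₂ s < r₂ z.2},
            ((φ₁ (r₁ s.1) * φ₂ (r₂ s.2) : ℝ≥0) : ℝ≥0∞) ∂(μ₁.prod μ₂))) ^ q ∂ν) ^ (1 / q) :=
        ENNReal.rpow_le_rpow (setLIntegral_le_lintegral _ _) hq0.le
    _ = C₁ * C₂ * _ := hpow _ (by finiteness) _ _
    _ ≤ C₁ * C₂ * (K * (M₁ * M₂)) := by gcongr
    _ = _ := by ring

end

/-! ### Linear algebra of the dilations on the Lie algebra. -/

section

variable {E : Type*} [NormedAddCommGroup E] [NormedSpace ℝ E]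

theorem NormedSpace.exp_apply_of_apply_eq_smul [CompleteSpace E] {A : E →L[ℝ] E} {v : E} {c : ℝ}
    (h : A v = c • v) : (NormedSpace.exp A : E →L[ℝ] E) v = Real.exp c • v := by
  have h1 := NormedSpace.exp_series_hasSum_exp' (𝕂 := ℝ) A
  have h2 := h1.mapL (ContinuousLinearMap.apply ℝ E v)
  have hpow : ∀ n : ℕ, (A ^ n) v = c ^ n • v := by
    intro n
    induction n with
    | zero => simp
    | succ n ih =>
      rw [pow_succ', pow_succ, mul_smul, ← h, ← map_smul, ← ih]
      rfl
  have h3 := (NormedSpace.exp_series_hasSum_exp' (𝕂 := ℝ) c).smul_const v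
  rw [← Real.exp_eq_exp_ℝ] at h3
  refine h2.unique ?_
  convert h3 using 2 with n
  simp [hpow, smul_smul]

variable {A : E →L[ℝ] E} {b : Module.Basis (Fin (Module.finrank ℝ E)) ℝ E}
  {d : Fin (Module.finrank ℝ E) → ℝ}

theorem trace_eq_sum_of_apply_basis (h : ∀ i, A (b i) = d i • b i) :
    LinearMap.trace ℝ E A.toLinearMap = ∑ i, d i := by
  rw [LinearMap.trace_eq_matrix_trace ℝ b, Matrix.trace]
  refine Finset.sum_congr rfl fun i _ => ?_
  simp [LinearMap.toMatrix_apply, h]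

variable [FiniteDimensional ℝ E]

theorem exp_log_smul_apply_basis (h : ∀ i, A (b i) = d i • b i) {t : ℝ} (ht : 0 < t)
    (i : Fin (Module.finrank ℝ E)) :
    (NormedSpace.exp (Real.log t • A) : E →L[ℝ] E) (b i) = t ^ d i • b i := by
  have := FiniteDimensional.complete ℝ E
  rw [NormedSpace.exp_apply_of_apply_eq_smul (c := Real.log t * d i), Real.rpow_def_of_pos ht]
  rw [smul_apply, h, smul_smul]

theorem det_exp_log_smul (h : ∀ i, A (b i) = d i • b i) {t : ℝ} (ht : 0 < t) :
    (NormedSpace.exp (Real.log t • A) : E →L[ℝ] E).det =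
      t ^ LinearMap.trace ℝ E A.toLinearMap := by
  rw [trace_eq_sum_of_apply_basis h, ContinuousLinearMap.det, ← LinearMap.det_toMatrix b]
  have : LinearMap.toMatrix b b (NormedSpace.exp (Real.log t • A) : E →L[ℝ] E).toLinearMap =
      Matrix.diagonal fun i => t ^ d i := by
    ext i j
    rw [LinearMap.toMatrix_apply]
    simp only [ContinuousLinearMap.coe_coe, exp_log_smul_apply_basis h ht, map_smul,
      Module.Basis.repr_self, Finsupp.smul_apply, Matrix.diagonal_apply, smul_eq_mul]
    by_cases hij : i = j
    · simp [hij]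
    · simp [hij]
  rw [this, Matrix.det_diagonal, Real.rpow_sum_of_pos ht]

/-- Eigenvalues `t ^ d i` tend to 0 with `t`, and an operator norm is controlled by the values on a
basis. The bound `(4 C)⁻¹` on basis vectors gives norm at most `1/4`. -/
theorem exists_norm_exp_log_smul_lt (h : ∀ i, 0 < d i ∧ A (b i) = d i • b i) :
    ∃ t : ℝ, 0 < t ∧ t < 1 ∧ ‖(NormedSpace.exp (Real.log t • A) : E →L[ℝ] E)‖ < 1 / 2 := by
  obtain ⟨C, hC, hb⟩ := b.exists_opNorm_le (F := E)
  have hlim : ∀ i, Filter.Tendsto (fun t : ℝ => ‖t ^ d i • b i‖) (nhdsWithin 0 (Ioi 0)) (nhds 0) := by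
    intro i
    have h1 : Filter.Tendsto (fun t : ℝ => t ^ d i) (nhds 0) (nhds 0) := by
      have := Real.continuousAt_rpow_const 0 (d i) (Or.inr (h i).1.le)
      simpa [ContinuousAt, Real.zero_rpow (h i).1.ne'] using this
    have := ((h1.mono_left (nhdsWithin_le_nhds (s := Ioi 0))).smul_const (b i)).norm
    simpa using this
  have hev : ∀ᶠ t in nhdsWithin (0 : ℝ) (Ioi 0), (∀ i, ‖t ^ d i • b i‖ ≤ (4 * C)⁻¹) ∧ t < 1 ∧ 0 < t := by
    refine (Filter.eventually_all.2 fun i =>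
      (hlim i).eventually_le_const (by positivity)).and (Filter.Eventually.and ?_ ?_)
    · exact nhdsWithin_le_nhds (Iio_mem_nhds one_pos)
    · exact self_mem_nhdsWithin
  obtain ⟨t, h1, h2, h3⟩ := hev.exists
  refine ⟨t, h3, h2, lt_of_le_of_lt (hb (M := (4 * C)⁻¹) (by positivity) fun i => ?_) ?_⟩
  · rw [exp_log_smul_apply_basis (fun i => (h i).2) h3]
    exact h1 i
  · rw [mul_inv, mul_left_comm, mul_inv_cancel₀ hC.ne']; norm_num

end

/-! ### Haar measure near the neutral element of a Lie group. -/

section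

variable {E : Type*} [NormedAddCommGroup E] [NormedSpace ℝ E]
  {G : Type*} [TopologicalSpace G] [ChartedSpace E G] [Group G] [LieGroup 𝓘(ℝ, E) ∞ G]

/-- In the chart at the neutral element, right translations by elements near the neutral element
are uniformly Lipschitz. -/
theorem exists_lipschitzOnWith_chart_mul_right :
    ∃ (K : ℝ≥0) (N : Set G), IsOpen N ∧ 1 ∈ N ∧ N ⊆ (chartAt E (1 : G)).source ∧
      Bornology.IsBounded (chartAt E (1 : G) '' N) ∧
      ∀ x ∈ N, LipschitzOnWith K (fun u => chartAt E (1 : G) ((chartAt E (1 : G)).symm u * x))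
        (chartAt E (1 : G) '' N) := by
  have : IsTopologicalGroup G := topologicalGroup_of_lieGroup 𝓘(ℝ, E) ∞
  set ψ := chartAt E (1 : G) with hψ
  have h1s : (1 : G) ∈ ψ.source := mem_chart_source E 1
  have hsymm : ContMDiffAt 𝓘(ℝ, E) 𝓘(ℝ, E) 1 ψ.symm (ψ 1) := by
    have := (contMDiffOn_chart_symm (I := 𝓘(ℝ, E)) (n := ∞) (x := (1 : G)))
    exact (this.contMDiffAt (ψ.open_target.mem_nhds (ψ.map_source h1s))).of_le (by simp)
  have hchart : ContMDiffAt 𝓘(ℝ, E) 𝓘(ℝ, E) 1 ψ (1 : G) := by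
    have := (contMDiffOn_chart (I := 𝓘(ℝ, E)) (n := ∞) (x := (1 : G)))
    exact (this.contMDiffAt (ψ.open_source.mem_nhds h1s)).of_le (by simp)
  have hmul : ContMDiff (𝓘(ℝ, E).prod 𝓘(ℝ, E)) 𝓘(ℝ, E) 1 fun p : G × G => p.1 * p.2 :=
    (contMDiff_mul 𝓘(ℝ, E) ∞).of_le (by simp)
  have hF : ContDiffAt ℝ 1 (fun p : E × E => ψ (ψ.symm p.1 * ψ.symm p.2)) (ψ 1, ψ 1) := by
    rw [← contMDiffAt_iff_contDiffAt]
    have a1 : ContMDiffAt 𝓘(ℝ, E × E) 𝓘(ℝ, E) 1 (fun p : E × E => ψ.symm p.1) (ψ 1, ψ 1) :=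
      ContMDiffAt.comp (ψ 1, ψ 1) (g := ψ.symm) (f := Prod.fst) hsymm
        contDiff_fst.contMDiff.contMDiffAt
    have a2 : ContMDiffAt 𝓘(ℝ, E × E) 𝓘(ℝ, E) 1 (fun p : E × E => ψ.symm p.2) (ψ 1, ψ 1) :=
      ContMDiffAt.comp (ψ 1, ψ 1) (g := ψ.symm) (f := Prod.snd) hsymm
        contDiff_snd.contMDiff.contMDiffAt
    have a3 := hmul.contMDiffAt.comp (ψ 1, ψ 1) (a1.prodMk a2)
    refine ContMDiffAt.comp (ψ 1, ψ 1) (g := ψ) ?_ a3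
    simpa [ψ.left_inv h1s] using hchart
  -- A map that is C¹ at a point is Lipschitz near it. Freezing the second variable gives a
  -- Lipschitz constant common to all small right translations.
  obtain ⟨K, T, hT, hL⟩ := hF.exists_lipschitzOnWith
  obtain ⟨U, hU, V, hV, hUV⟩ := mem_nhds_prod_iff.1 hT
  set B := U ∩ V ∩ Metric.ball (ψ 1) 1 with hB
  have hBn : B ∈ nhds (ψ 1) :=
    Filter.inter_mem (Filter.inter_mem hU hV) (Metric.ball_mem_nhds _ one_pos)
  have hNn : ψ.source ∩ ψ ⁻¹' B ∈ nhds (1 : G) :=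
    Filter.inter_mem (ψ.open_source.mem_nhds h1s) ((ψ.continuousAt h1s).preimage_mem_nhds hBn)
  obtain ⟨N, hN, hNo, h1N⟩ := mem_nhds_iff.1 hNn
  have himg : ψ '' N ⊆ B := by
    rintro _ ⟨x, hx, rfl⟩
    exact (hN hx).2
  refine ⟨K, N, hNo, h1N, fun x hx => (hN hx).1,
    Metric.isBounded_ball.subset (himg.trans inter_subset_right), fun x hx => ?_⟩
  refine LipschitzOnWith.of_dist_le_mul fun u hu v hv => ?_
  have hxV : ψ x ∈ V := (hN hx).2.1.2
  have := hL.dist_le_mul (u, ψ x) (hUV ⟨(himg hu).1.1, hxV⟩) (v, ψ x) (hUV ⟨(himg hv).1.1, hxV⟩)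
  simpa [Prod.dist_eq, ψ.left_inv (hN hx).1] using this

open Measure in
/-- Near the neutral element a Haar measure is comparable with Lebesgue measure in the chart. -/
theorem exists_haar_comparable_chart [FiniteDimensional ℝ E] [MeasurableSpace E] [BorelSpace E]
    [SecondCountableTopology G] [MeasurableSpace G] [BorelSpace G] (μ : Measure G) [μ.IsHaarMeasure] :
    ∃ (C : ℝ≥0) (N : Set G), IsOpen N ∧ 1 ∈ N ∧ N ⊆ (chartAt E (1 : G)).source ∧
      ∀ A ⊆ N, IsOpen A →
        μH[Module.finrank ℝ E] (chartAt E (1 : G) '' A) ≤ C * μ A ∧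
        μ A ≤ C * μH[Module.finrank ℝ E] (chartAt E (1 : G) '' A) := by
  have : IsTopologicalGroup G := topologicalGroup_of_lieGroup 𝓘(ℝ, E) ∞
  have : LocallyCompactSpace G := Manifold.locallyCompact_of_finiteDimensional 𝓘(ℝ, E)
  have := FiniteDimensional.proper_real E
  obtain ⟨K, N₀, hN₀o, h1N₀, hN₀s, hN₀b, hL⟩ :=
    exists_lipschitzOnWith_chart_mul_right (E := E) (G := G)
  set ψ := chartAt E (1 : G) with hψ
  set lam : Measure E := μH[Module.finrank ℝ E] with hlam
  obtain ⟨P, h1P, hPo, hPt⟩ := μ.exists_isOpen_measure_lt_top (1 : G)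
  -- Whenever `y * x = a` with `y`, `a` in `N₁`, the translation `x = y⁻¹ * a` lies in a set of
  -- finite measure and the inverse translation is Lipschitz.
  obtain ⟨N₁, hN₁o, h1N₁, hN₁N₀, hN₁⟩ : ∃ N₁ : Set G, IsOpen N₁ ∧ 1 ∈ N₁ ∧ N₁ ⊆ N₀ ∧
      ∀ y ∈ N₁, ∀ a ∈ N₁, y⁻¹ * a ∈ P ∧ (y⁻¹ * a)⁻¹ ∈ N₀ := by
    have hc : Continuous fun p : G × G => p.1⁻¹ * p.2 := by fun_prop
    have hS : {p : G × G | p.1⁻¹ * p.2 ∈ P ∩ N₀⁻¹} ∈ nhds ((1 : G), (1 : G)) :=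
      hc.continuousAt.preimage_mem_nhds ((hPo.inter hN₀o.inv).mem_nhds (by simp [h1P, h1N₀]))
    obtain ⟨u, v, hu, h1u, hv, h1v, huv⟩ := mem_nhds_prod_iff'.1 hS
    exact ⟨u ∩ v ∩ N₀, (hu.inter hv).inter hN₀o, ⟨⟨h1u, h1v⟩, h1N₀⟩, inter_subset_right,
      fun y hy a ha => huv (mk_mem_prod hy.1.1 ha.1.2)⟩
  obtain ⟨N₂, hN₂o, h1N₂, hN₂N₁, hN₂⟩ : ∃ N₂ : Set G, IsOpen N₂ ∧ 1 ∈ N₂ ∧ N₂ ⊆ N₁ ∧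
      ∀ a ∈ N₂, ∀ x ∈ N₂, a * x⁻¹ ∈ N₁ := by
    have hc : Continuous fun p : G × G => p.1 * p.2⁻¹ := by fun_prop
    have hS : {p : G × G | p.1 * p.2⁻¹ ∈ N₁} ∈ nhds ((1 : G), (1 : G)) :=
      hc.continuousAt.preimage_mem_nhds (hN₁o.mem_nhds (by simp [h1N₁]))
    obtain ⟨u, v, hu, h1u, hv, h1v, huv⟩ := mem_nhds_prod_iff'.1 hS
    exact ⟨u ∩ v ∩ N₁, (hu.inter hv).inter hN₁o, ⟨⟨h1u, h1v⟩, h1N₁⟩, inter_subset_right,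
      fun y hy a ha => huv (mk_mem_prod hy.1.1 ha.1.2)⟩
  have hN₁s := hN₁N₀.trans hN₀s
  set Ω : Set E := ψ '' N₁ with hΩ
  have hΩo : IsOpen Ω := ψ.isOpen_image_of_subset_source hN₁o hN₁s
  have hΩ0 : lam Ω ≠ 0 := (hΩo.measure_pos lam ⟨ψ 1, mem_image_of_mem _ h1N₁⟩).ne'
  have hΩt : lam Ω ≠ ⊤ := (hN₀b.subset (image_mono hN₁N₀)).measure_lt_top.ne
  have hN₂0 : μ N₂ ≠ 0 := (hN₂o.measure_pos μ ⟨1, h1N₂⟩).ne'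
  have hN₂t : μ N₂ ≠ ⊤ := ne_top_of_le_ne_top hPt.ne (measure_mono fun x hx => by
    simpa using (hN₁ 1 h1N₁ x (hN₂N₁ hx)).1)
  set L : ℝ≥0∞ := (K : ℝ≥0∞) ^ (Module.finrank ℝ E : ℝ) with hLdef
  have hLt : L ≠ ⊤ := ENNReal.rpow_ne_top_of_nonneg (Nat.cast_nonneg _) ENNReal.coe_ne_top
  have himg : ∀ x ∈ N₀, ∀ S ⊆ ψ '' N₀, lam ((fun u => ψ (ψ.symm u * x)) '' S) ≤ L * lam S :=
    fun x hx S hS => ((hL x hx).mono hS).hausdorffMeasure_image_le (Nat.cast_nonneg _)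
  have hsymmΩ : ∀ u ∈ Ω, ψ.symm u ∈ N₁ ∧ ψ (ψ.symm u) = u := by
    rintro _ ⟨y, hy, rfl⟩
    rw [ψ.left_inv (hN₁s hy)]
    exact ⟨hy, rfl⟩
  have hC₁ : L * lam Ω / μ N₂ ≠ ⊤ := ENNReal.div_ne_top (ENNReal.mul_ne_top hLt hΩt) hN₂0
  have hC₂ : L * μ P / lam Ω ≠ ⊤ := ENNReal.div_ne_top (ENNReal.mul_ne_top hLt hPt.ne) hΩ0
  have key : ∀ A ⊆ N₂, IsOpen A → lam (ψ '' A) ≤ L * lam Ω / μ N₂ * μ A ∧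
      μ A ≤ L * μ P / lam Ω * lam (ψ '' A) := by
    intro A hA hAo
    have hAN₀ : A ⊆ N₀ := hA.trans (hN₂N₁.trans hN₁N₀)
    -- The measure of `O` is computed in two ways. Slices at `u ∈ Ω` are left translates of `A`,
    -- giving exactly `lam Ω * μ A`. Slices at `x` are right translates seen in the chart,
    -- comparable with `ψ '' A` by the Lipschitz bounds. No density of Haar measure is needed.
    set O : Set (E × G) := (Ω ×ˢ univ) ∩ (fun p : E × G => ψ.symm p.1 * p.2) ⁻¹' A with hO
    have hOo : IsOpen O := by
      have hsymmc : ContinuousOn (fun p : E × G => ψ.symm p.1) (Ω ×ˢ univ) :=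
        ψ.continuousOn_symm.comp continuousOn_fst fun p hp => by
          obtain ⟨y, hy, he⟩ := hp.1
          rw [← he]
          exact ψ.map_source (hN₁s hy)
      exact (hsymmc.mul continuousOn_snd).isOpen_inter_preimage (hΩo.prod isOpen_univ) hAo
    have e₁ : (lam.prod μ) O = lam Ω * μ A := by
      rw [Measure.prod_apply hOo.measurableSet, mul_comm, ← lintegral_indicator_const
        hΩo.measurableSet]
      refine lintegral_congr fun u => ?_
      by_cases hu : u ∈ Ω
      · rw [indicator_of_mem hu, ← measure_preimage_mul μ (ψ.symm u) A]
        congr 1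
        ext x
        simp [hO, hu]
      · rw [indicator_of_notMem hu]
        convert measure_empty (μ := μ)
        ext x
        simp [hO, hu]
    have e₂ := Measure.prod_apply_symm (μ := lam) (ν := μ) hOo.measurableSet
    rw [e₁] at e₂
    have hup : ∀ x, lam ((fun u => (u, x)) ⁻¹' O) ≤ P.indicator (fun _ => L * lam (ψ '' A)) x := by
      intro x
      rcases eq_empty_or_nonempty ((fun u => (u, x)) ⁻¹' O) with he | ⟨u, hu⟩
      · rw [he, measure_empty]; exact zero_le
      have hx := hN₁ _ (hsymmΩ u hu.1.1).1 _ (hN₂N₁ (hA hu.2))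
      simp only [inv_mul_cancel_left] at hx
      rw [indicator_of_mem hx.1]
      refine (measure_mono ?_).trans (himg x⁻¹ hx.2 _ (image_mono hAN₀))
      intro u' hu'
      refine ⟨_, mem_image_of_mem ψ hu'.2, ?_⟩
      have hs : ψ.symm u' * x ∈ ψ.source := hN₀s (hAN₀ hu'.2)
      simp only [ψ.left_inv hs, mul_inv_cancel_right]
      exact (hsymmΩ u' hu'.1.1).2
    have hlow : ∀ x ∈ N₂, lam (ψ '' A) ≤ L * lam ((fun u => (u, x)) ⁻¹' O) := by
      intro x hx
      refine (measure_mono ?_).trans (himg x (hN₁N₀ (hN₂N₁ hx)) _ ?_)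
      · rintro _ ⟨a, ha, rfl⟩
        have hy := hN₂ a (hA ha) x hx
        refine ⟨ψ (a * x⁻¹), ⟨⟨mem_image_of_mem _ hy, mem_univ _⟩, ?_⟩, ?_⟩
        · simpa [ψ.left_inv (hN₁s hy)] using ha
        · simp [ψ.left_inv (hN₁s hy)]
      · intro u hu
        exact image_mono hN₁N₀ hu.1.1
    constructor
    · rw [div_eq_mul_inv, mul_right_comm, ← div_eq_mul_inv,
        ENNReal.le_div_iff_mul_le (Or.inl hN₂0) (Or.inl hN₂t)]
      calc _ = ∫⁻ _ in N₂, lam (ψ '' A) ∂μ := (setLIntegral_const _ _).symm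
        _ ≤ ∫⁻ x in N₂, L * lam ((fun u => (u, x)) ⁻¹' O) ∂μ :=
            setLIntegral_mono' hN₂o.measurableSet hlow
        _ ≤ ∫⁻ x, L * lam ((fun u => (u, x)) ⁻¹' O) ∂μ := setLIntegral_le_lintegral _ _
        _ = _ := by rw [lintegral_const_mul' _ _ hLt, ← e₂, mul_assoc]
    · rw [div_eq_mul_inv, mul_right_comm, ← div_eq_mul_inv,
        ENNReal.le_div_iff_mul_le (Or.inl hΩ0) (Or.inl hΩt), mul_comm, e₂]
      refine (lintegral_mono hup).trans (le_of_eq ?_)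
      rw [lintegral_indicator_const hPo.measurableSet, mul_right_comm]
  refine ⟨(L * lam Ω / μ N₂).toNNReal + (L * μ P / lam Ω).toNNReal, N₂, hN₂o, h1N₂,
    hN₂N₁.trans hN₁s, fun A hA hAo => ?_⟩
  obtain ⟨h1, h2⟩ := key A hA hAo
  rw [ENNReal.coe_add, ENNReal.coe_toNNReal hC₁, ENNReal.coe_toNNReal hC₂, add_mul, add_mul]
  exact ⟨h1.trans le_self_add, h2.trans le_add_self⟩

end

/-! ### Contraction by dilations and the measure of balls. -/

/-- Taking n-th roots: multiplicative constants disappear in the limit. This turns comparability of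
Haar and Lebesgue measure into an exact formula. -/
theorem ENNReal.le_of_forall_pow_mul_le {x m a C : ℝ≥0∞} (ha : a ≠ 0) (hC : C ≠ ⊤)
    (h : ∀ n : ℕ, x ^ n * a ≤ C * m ^ n) : x ≤ m := by
  by_contra! hlt
  obtain ⟨y, hmy, hyx⟩ := ENNReal.lt_iff_exists_nnreal_btwn.1 hlt
  have hy0 : (y : ℝ≥0∞) ≠ 0 := (zero_le.trans_lt hmy).ne'
  have hr : m / y < 1 := by
    rw [ENNReal.div_lt_iff (Or.inl hy0) (Or.inl ENNReal.coe_ne_top), one_mul]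
    exact hmy
  have hlim := ENNReal.Tendsto.const_mul (ENNReal.tendsto_pow_atTop_nhds_zero_of_lt_one hr)
    (Or.inr hC)
  rw [mul_zero] at hlim
  refine ha (le_antisymm (ge_of_tendsto' hlim fun n => ?_) zero_le)
  have hyn0 : (y : ℝ≥0∞) ^ n ≠ 0 := pow_ne_zero _ hy0
  rw [div_eq_mul_inv, mul_pow, ← ENNReal.inv_pow, ← div_eq_mul_inv, ← mul_div_assoc, ENNReal.le_div_iff_mul_le (Or.inl hyn0)
    (Or.inl (ENNReal.pow_ne_top ENNReal.coe_ne_top)), mul_comm]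
  exact (mul_le_mul_left (pow_le_pow_left' hyx.le n) a).trans (h n)

/-- If a continuous automorphism contracts all orbits to `1` and scales a gauge `r` by a factor
less than one, then the balls of `r` form a neighborhood basis at `1`. -/
theorem exists_gauge_ball_subset {G : Type*} [TopologicalSpace G] [T2Space G] [LocallyCompactSpace G]
    [One G] {f g : G → G} (hg : Continuous g) (hgf : ∀ x, g (f x) = x)
    (hlim : ∀ x, Filter.Tendsto (fun n => f^[n] x) Filter.atTop (nhds 1)) {r : G → ℝ}
    (hr : Continuous r) (hr0 : ∀ x, 0 ≤ r x) (hr1 : ∀ x, r x = 0 ↔ x = 1)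
    (hf : ∀ x, r (f x) ≤ r x) {N : Set G} (hN : N ∈ nhds 1) :
    ∃ s > 0, {x | r x < s} ⊆ N := by
  obtain ⟨K, hK, hKN, hKc⟩ := LocallyCompactSpace.local_compact_nhds 1 N hN
  -- An orbit starting outside `N` finally enters the interior of `K`; the last point before the
  -- first entry lies in `L`. This set is compact and avoids 1, so `r` has a positive minimum there,
  -- and `r` does not increase along orbits.
  set L : Set G := g '' K ∩ (interior K)ᶜ with hL
  have hLc : IsCompact L := (hKc.image hg).inter_right isOpen_interior.isClosed_compl
  have hiter : ∀ n x, r (f^[n] x) ≤ r x := by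
    intro n
    induction n with
    | zero => simp
    | succ n ih => intro x; rw [Function.iterate_succ_apply']; exact (hf _).trans (ih x)
  have hexit : ∀ x, x ∉ N → ∃ y ∈ L, r y ≤ r x := by
    intro x hx
    have hev : ∃ n, f^[n] x ∈ interior K :=
      ((hlim x).eventually (isOpen_interior.mem_nhds (mem_interior_iff_mem_nhds.2 hK))).exists
    classical
    obtain ⟨m, hm⟩ := Nat.exists_eq_succ_of_ne_zero (n := Nat.find hev) fun h0 => by
      have := Nat.find_spec hev
      rw [h0] at this
      exact hx (hKN (interior_subset this))
    refine ⟨f^[m] x, ⟨⟨f (f^[m] x), ?_, hgf _⟩, Nat.find_min hev (by omega)⟩, hiter m x⟩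
    have := Nat.find_spec hev
    rw [hm, Function.iterate_succ_apply'] at this
    exact interior_subset this
  rcases L.eq_empty_or_nonempty with he | hne
  · refine ⟨1, one_pos, fun x _ => ?_⟩
    by_contra hx
    obtain ⟨y, hy, -⟩ := hexit x hx
    rw [he] at hy
    exact hy
  · obtain ⟨y₀, hy₀, hmin⟩ := hLc.exists_isMinOn hne hr.continuousOn
    refine ⟨r y₀, lt_of_le_of_ne (hr0 _) fun h0 => ?_, fun x hx => ?_⟩
    · rw [(hr1 y₀).1 h0.symm] at hy₀
      exact hy₀.2 (mem_interior_iff_mem_nhds.2 hK)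
    · by_contra hxN
      obtain ⟨y, hy, hyx⟩ := hexit x hxN
      exact absurd (lt_of_lt_of_le hx ((hmin hy).trans hyx)) (lt_irrefl _)

namespace HomogeneousGroup

variable {E : Type*} [NormedAddCommGroup E] [NormedSpace ℝ E] [FiniteDimensional ℝ E]
  {G : Type*} [TopologicalSpace G] [T2Space G] [SecondCountableTopology G]
  [ChartedSpace E G] [Group G] [LieGroup 𝓘(ℝ, E) ∞ G]
  [SimplyConnectedSpace G] [Group.IsNilpotent G] (D : HomogeneousGroup E G)

theorem δ_inv_apply {t : ℝ} (ht : 0 < t) (x : G) : D.δ t⁻¹ (D.δ t x) = x := by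
  rw [D.δ_comp _ _ (inv_pos.2 ht) ht, inv_mul_cancel₀ ht.ne', D.δ_one]

/-- A dilation as an automorphism. -/
noncomputable def dilationEquiv {t : ℝ} (ht : 0 < t) : G ≃* G where
  toFun := D.δ t
  invFun := D.δ t⁻¹
  left_inv := D.δ_inv_apply ht
  right_inv x := by simpa using D.δ_inv_apply (inv_pos.2 ht) x
  map_mul' := D.δ_mul t ht

theorem continuous_δ {t : ℝ} (ht : 0 < t) : Continuous (D.δ t) := (D.δ_smooth t ht).continuous

theorem δ_apply_one {t : ℝ} (ht : 0 < t) : D.δ t 1 = 1 := map_one (D.dilationEquiv ht)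

/-- Smoothness upgrades the prescribed differential at the neutral element to a strict derivative,
which yields Lipschitz and linear approximation bounds on whole neighborhoods. -/
theorem hasStrictFDerivAt_chart_δ {t : ℝ} (ht : 0 < t) :
    HasStrictFDerivAt (chartAt E (1 : G) ∘ D.δ t ∘ (chartAt E (1 : G)).symm)
      (NormedSpace.exp (Real.log t • D.A) : E →L[ℝ] E) (chartAt E (1 : G) 1) := by
  have h1 := (D.δ_deriv t ht).2
  have h2 := (contMDiffAt_iff.1 (D.δ_smooth t ht (1 : G))).2
  have h0 := D.δ_apply_one ht
  rw [writtenInExtChartAt] at h1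
  rw [h0] at h1 h2
  simp only [modelWithCornersSelf_coe, range_id] at h1
  simp only [modelWithCornersSelf_coe, range_id, contDiffWithinAt_univ] at h2
  have h3 := h2.hasStrictFDerivAt' (hasFDerivWithinAt_univ.1 h1) (by simp)
  simpa using h3

/-- The dilations contract to the neutral element. -/
theorem exists_contracting_δ : ∃ t : ℝ, 0 < t ∧ t < 1 ∧
    ∀ x, Filter.Tendsto (fun n => (D.δ t)^[n] x) Filter.atTop (nhds 1) := by
  have : IsTopologicalGroup G := topologicalGroup_of_lieGroup 𝓘(ℝ, E) ∞
  obtain ⟨b, d, hbd⟩ := D.diagonalizable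
  obtain ⟨t, ht, ht1, hnorm⟩ := exists_norm_exp_log_smul_lt hbd
  refine ⟨t, ht, ht1, ?_⟩
  set ψ := chartAt E (1 : G) with hψ
  have h1s : (1 : G) ∈ ψ.source := mem_chart_source E 1
  obtain ⟨T, hT, hL⟩ := (D.hasStrictFDerivAt_chart_δ ht).exists_lipschitzOnWith_of_nnnorm_lt (1 / 2)
    (by rw [← NNReal.coe_lt_coe]; simpa using hnorm)
  have hc : ContinuousAt (fun u => D.δ t (ψ.symm u)) (ψ 1) :=
    (D.continuous_δ ht).continuousAt.comp (ψ.continuousAt_symm (ψ.map_source h1s))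
  have hsrc : (fun u => D.δ t (ψ.symm u)) ⁻¹' ψ.source ∈ nhds (ψ 1) :=
    hc.preimage_mem_nhds (ψ.open_source.mem_nhds (by
      simpa [ψ.left_inv h1s, D.δ_apply_one ht] using h1s))
  obtain ⟨ε, hε, hball⟩ := Metric.mem_nhds_iff.1
    (Filter.inter_mem hT hsrc)
  set S : Set G := ψ.source ∩ ψ ⁻¹' Metric.ball (ψ 1) ε with hS
  have hstep : ∀ x ∈ S, D.δ t x ∈ S ∧ dist (ψ (D.δ t x)) (ψ 1) ≤ 1 / 2 * dist (ψ x) (ψ 1) := by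
    intro x hx
    have h1 := hball hx.2
    have h2 := hball (Metric.mem_ball_self hε)
    have h3 : D.δ t x ∈ ψ.source := by simpa [ψ.left_inv hx.1] using h1.2
    have h4 : dist (ψ (D.δ t (ψ.symm (ψ x)))) (ψ (D.δ t (ψ.symm (ψ 1)))) ≤ _ :=
      hL.dist_le_mul _ h1.1 _ h2.1
    rw [ψ.left_inv hx.1, ψ.left_inv h1s, D.δ_apply_one ht] at h4
    have h5 : dist (ψ (D.δ t x)) (ψ 1) ≤ 1 / 2 * dist (ψ x) (ψ 1) := by simpa using h4
    refine ⟨⟨h3, ?_⟩, h5⟩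
    have h6 : dist (ψ x) (ψ 1) < ε := hx.2
    have h7 : 0 ≤ dist (ψ x) (ψ 1) := dist_nonneg
    exact Metric.mem_ball.2 (by linarith)
  have hSlim : ∀ x ∈ S, Filter.Tendsto (fun n => (D.δ t)^[n] x) Filter.atTop (nhds 1) := by
    intro x hx
    have hn : ∀ n : ℕ, (D.δ t)^[n] x ∈ S ∧
        dist (ψ ((D.δ t)^[n] x)) (ψ 1) ≤ (1 / 2) ^ n * dist (ψ x) (ψ 1) := by
      intro n
      induction n with
      | zero => simpa using hx
      | succ n ih =>
        rw [Function.iterate_succ_apply']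
        refine ⟨(hstep _ ih.1).1, (hstep _ ih.1).2.trans ?_⟩
        rw [pow_succ', mul_assoc]
        exact mul_le_mul_of_nonneg_left ih.2 (by norm_num)
    have h1 : Filter.Tendsto (fun n => ψ ((D.δ t)^[n] x)) Filter.atTop (nhds (ψ 1)) := by
      rw [tendsto_iff_dist_tendsto_zero]
      refine squeeze_zero (fun _ => dist_nonneg) (fun n => (hn n).2) ?_
      simpa using (tendsto_pow_atTop_nhds_zero_of_lt_one (by norm_num) (by norm_num :
        (1 / 2 : ℝ) < 1)).mul_const (dist (ψ x) (ψ 1))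
    have h2 := (ψ.continuousAt_symm (ψ.map_source h1s)).tendsto.comp h1
    rw [ψ.left_inv h1s] at h2
    exact h2.congr fun n => ψ.left_inv (hn n).1.1
  set F : G →* G := (D.dilationEquiv ht).toMonoidHom with hF
  have hFδ : ∀ n x, (D.δ t)^[n] x = F^[n] x := fun n x => rfl
  -- Near 1 the dilation contracts by 1/2 in the chart. Since it is an automorphism, the points
  -- attracted to 1 form a subgroup; it is open, hence closed, hence all of the connected group.
  set U : Subgroup G :=
    { carrier := {x | Filter.Tendsto (fun n => F^[n] x) Filter.atTop (nhds 1)}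
      mul_mem' := fun {x y} hx hy => by
        have : Filter.Tendsto (fun n => F^[n] x * F^[n] y) Filter.atTop (nhds (1 * 1)) :=
          Filter.Tendsto.mul hx hy
        simpa only [mem_ofPred_eq, iterate_map_mul, mul_one] using this
      one_mem' := by
        simp only [mem_ofPred_eq, iterate_map_one]
        exact tendsto_const_nhds
      inv_mem' := fun {x} hx => by
        have : Filter.Tendsto (fun n => (F^[n] x)⁻¹) Filter.atTop (nhds 1⁻¹) := Filter.Tendsto.inv hx
        simpa only [mem_ofPred_eq, iterate_map_inv, inv_one] using this } with hU
  have hUo : IsOpen (U : Set G) := by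
    refine U.isOpen_of_mem_nhds (g := 1) (Filter.mem_of_superset (Filter.inter_mem
      (ψ.open_source.mem_nhds h1s) ((ψ.continuousAt h1s).preimage_mem_nhds
        (Metric.ball_mem_nhds _ hε))) fun x hx => hSlim x hx)
  have hUu : (U : Set G) = univ :=
    IsClopen.eq_univ ⟨U.isClosed_of_isOpen hUo, hUo⟩ ⟨1, U.one_mem⟩
  intro x
  exact (hUu ▸ mem_univ x : x ∈ (U : Set G))

variable {D} {r : G → ℝ}

theorem IsHomogeneousNorm.exists_ball_subset (hr : D.IsHomogeneousNorm r) {N : Set G}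
    (hN : N ∈ nhds 1) : ∃ s > 0, {x | r x < s} ⊆ N := by
  have : LocallyCompactSpace G := Manifold.locallyCompact_of_finiteDimensional 𝓘(ℝ, E)
  obtain ⟨t, ht, ht1, hlim⟩ := D.exists_contracting_δ
  refine exists_gauge_ball_subset (D.continuous_δ (inv_pos.2 ht)) (D.δ_inv_apply ht) hlim
    hr.continuous hr.nonneg hr.eq_zero_iff (fun x => ?_) hN
  rw [hr.dilation x t ht]
  exact mul_le_of_le_one_left (hr.nonneg x) ht1.le

theorem IsHomogeneousNorm.isOpen_ball (hr : D.IsHomogeneousNorm r) (t : ℝ) :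
    IsOpen {x | r x < t} := isOpen_lt hr.continuous continuous_const

theorem IsHomogeneousNorm.one_mem_ball (hr : D.IsHomogeneousNorm r) {t : ℝ} (ht : 0 < t) :
    (1 : G) ∈ {x | r x < t} := by
  simpa [(hr.eq_zero_iff 1).2 rfl] using ht

theorem IsHomogeneousNorm.image_ball (hr : D.IsHomogeneousNorm r) {t : ℝ} (ht : 0 < t) (a : ℝ) :
    D.δ t '' {x | r x < a} = {x | r x < t * a} := by
  ext x
  constructor
  · rintro ⟨y, hy, rfl⟩
    simpa [hr.dilation y t ht, ht] using hy
  · intro hx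
    refine ⟨D.δ t⁻¹ x, ?_, by simpa using D.δ_inv_apply (inv_pos.2 ht) x⟩
    have : r x < t * a := hx
    rw [mem_ofPred_eq, hr.dilation x _ (inv_pos.2 ht), inv_mul_lt_iff₀ ht]
    exact this

theorem IsHomogeneousNorm.hball_eq (hr : D.IsHomogeneousNorm r) (t : ℝ) :
    hball r 1 t = {x | r x < t} := by
  ext x; simp [hball, hr.inv]

variable [MeasurableSpace G] [BorelSpace G] {μ : Measure G} [μ.IsHaarMeasure]

/-- The image of Haar measure under an automorphism is a multiple of Haar measure; the factor is
read off on the unit ball. -/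
theorem IsHomogeneousNorm.measure_ball_mul (hr : D.IsHomogeneousNorm r)
    (hμ : μ {x | r x < 1} = 1) {t : ℝ} (ht : 0 < t) :
    μ {x | r x < t} ≠ ⊤ ∧ ∀ a, μ {x | r x < t * a} = μ {x | r x < t} * μ {x | r x < a} := by
  have : IsTopologicalGroup G := topologicalGroup_of_lieGroup 𝓘(ℝ, E) ∞
  have : LocallyCompactSpace G := Manifold.locallyCompact_of_finiteDimensional 𝓘(ℝ, E)
  have ht' := inv_pos.2 ht
  have hH := MulEquiv.isHaarMeasure_map μ (D.dilationEquiv ht') (D.continuous_δ ht')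
    (D.continuous_δ (inv_pos.2 ht'))
  have hsc : ∀ a, μ {x | r x < t * a} = Measure.haarScalarFactor
      (μ.map (D.dilationEquiv ht')) μ • μ {x | r x < a} := by
    intro a
    rw [← Measure.measure_isHaarMeasure_eq_smul_of_isOpen _ μ (hr.isOpen_ball a),
      Measure.map_apply (show Measurable (D.dilationEquiv ht') from
        (D.continuous_δ ht').measurable) (hr.isOpen_ball a).measurableSet]
    congr 1
    ext x
    change r x < t * a ↔ r (D.δ t⁻¹ x) < a
    rw [hr.dilation x _ ht', inv_mul_lt_iff₀ ht]
  have h1 := hsc 1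
  rw [mul_one, hμ, ENNReal.smul_def, smul_eq_mul, mul_one] at h1
  refine ⟨by rw [h1]; exact ENNReal.coe_ne_top, fun a => ?_⟩
  rw [hsc a, h1]
  rfl

theorem IsHomogeneousNorm.measure_ball_pow_mul (hr : D.IsHomogeneousNorm r)
    (hμ : μ {x | r x < 1} = 1) {t : ℝ} (ht : 0 < t) (a : ℝ) (n : ℕ) :
    μ {x | r x < t ^ n * a} = μ {x | r x < t} ^ n * μ {x | r x < a} := by
  induction n with
  | zero => simp
  | succ n ih => rw [pow_succ', mul_assoc, (hr.measure_ball_mul hμ ht).2, ih, pow_succ', mul_assoc]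

/-- In the chart the dilation is nearly linear with determinant `t ^ Q`, so each application to a
small ball multiplies Lebesgue measure by a factor close to `t ^ Q`. After `n` steps the Haar
measure of the ball has been multiplied by exactly the n-th power of `μ {r < t}`. Comparability of
the two measures and n-th roots identify the factors. -/
theorem IsHomogeneousNorm.measure_ball_of_lt_one (hr : D.IsHomogeneousNorm r)
    (hμ : μ {x | r x < 1} = 1) {t : ℝ} (ht : 0 < t) (ht1 : t < 1) :
    μ {x | r x < t} = ENNReal.ofReal (t ^ D.Q) := by
  have : IsTopologicalGroup G := topologicalGroup_of_lieGroup 𝓘(ℝ, E) ∞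
  borelize E
  obtain ⟨b, d, hbd⟩ := D.diagonalizable
  set M := (NormedSpace.exp (Real.log t • D.A) : E →L[ℝ] E) with hM
  have hdet : |M.det| = t ^ D.Q := by
    rw [hM, det_exp_log_smul (fun i => (hbd i).2) ht]
    exact abs_of_pos (Real.rpow_pos_of_pos ht _)
  have hder := D.hasStrictFDerivAt_chart_δ ht
  set ψ := chartAt E (1 : G) with hψ
  have h1s : (1 : G) ∈ ψ.source := mem_chart_source E 1
  obtain ⟨C, N, hNo, h1N, hNs, hcomp⟩ := exists_haar_comparable_chart (E := E) μ
  set lam : Measure E := Measure.hausdorffMeasure (Module.finrank ℝ E) with hlam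
  set φ := ψ ∘ D.δ t ∘ ψ.symm with hφ
  have hsetup : ∀ δ : ℝ≥0, 0 < δ → ∃ s > 0, {x | r x < s} ⊆ N ∧
      ApproximatesLinearOn φ M (ψ '' {x | r x < s}) δ := by
    intro δ hδ
    obtain ⟨U, hU, hA⟩ := hder.approximates_deriv_on_nhds (c := δ) (Or.inr hδ)
    obtain ⟨s, hs, hsub⟩ := hr.exists_ball_subset (Filter.inter_mem (hNo.mem_nhds h1N)
      ((ψ.continuousAt h1s).preimage_mem_nhds hU))
    refine ⟨s, hs, fun x hx => (hsub hx).1, hA.mono_set ?_⟩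
    rintro _ ⟨x, hx, rfl⟩
    exact (hsub hx).2
  have hmono : ∀ (s : ℝ) (n : ℕ), 0 < s → {x | r x < t ^ n * s} ⊆ {x | r x < s} :=
    fun s n hs x (hx : r x < t ^ n * s) =>
      (hx.trans_le (mul_le_of_le_one_left hs.le (pow_le_one₀ ht.le ht1.le)) : r x < s)
  have himg : ∀ (s : ℝ) (n : ℕ), 0 < s → {x | r x < s} ⊆ N →
      φ '' (ψ '' {x | r x < t ^ n * s}) = ψ '' {x | r x < t ^ (n + 1) * s} := by
    intro s n hs hsub
    rw [pow_succ', mul_assoc, ← hr.image_ball ht, ← image_comp, ← image_comp]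
    refine image_congr fun x hx => ?_
    simp only [hφ, Function.comp_apply]
    rw [ψ.left_inv (hNs (hsub (hmono s n hs hx)))]
  have hpos : ∀ s : ℝ, 0 < s → μ {x | r x < s} ≠ 0 := fun s hs =>
    ((hr.isOpen_ball s).measure_pos μ ⟨1, hr.one_mem_ball hs⟩).ne'
  have hfin : ∀ s : ℝ, 0 < s → μ {x | r x < s} ≠ ⊤ := fun s hs => (hr.measure_ball_mul hμ hs).1
  refine le_antisymm ?_ ?_
  · refine le_of_forall_gt_imp_ge_of_dense fun m hm => ?_
    by_cases hmt : m = ⊤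
    · rw [hmt]; exact le_top
    lift m to ℝ≥0 using hmt
    rw [← hdet] at hm
    obtain ⟨δ, hδ, hδ0⟩ := ((addHaar_image_le_mul_of_det_lt lam M hm).and
      self_mem_nhdsWithin).exists
    obtain ⟨s, hs, hsN, hA⟩ := hsetup δ hδ0
    have hlamfin : lam (ψ '' {x | r x < s}) ≠ ⊤ :=
      ne_top_of_le_ne_top (ENNReal.mul_ne_top ENNReal.coe_ne_top (hfin s hs))
        (hcomp _ hsN (hr.isOpen_ball s)).1
    have hn : ∀ n : ℕ, lam (ψ '' {x | r x < t ^ n * s}) ≤ m ^ n * lam (ψ '' {x | r x < s}) := by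
      intro n
      induction n with
      | zero => simp
      | succ n ih =>
        rw [← himg s n hs hsN, pow_succ', mul_assoc]
        exact (hδ _ _ (hA.mono_set (image_mono (hmono s n hs)))).trans (mul_le_mul_right ih _)
    refine ENNReal.le_of_forall_pow_mul_le (hpos s hs)
      (ENNReal.mul_ne_top (ENNReal.coe_ne_top (r := C)) hlamfin) fun n => ?_
    rw [← hr.measure_ball_pow_mul hμ ht]
    calc _ ≤ C * lam (ψ '' {x | r x < t ^ n * s}) :=
          (hcomp _ ((hmono s n hs).trans hsN) (hr.isOpen_ball _)).2
      _ ≤ C * (m ^ n * lam (ψ '' {x | r x < s})) := mul_le_mul_right (hn n) _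
      _ = _ := by ring
  · refine ENNReal.le_of_forall_nnreal_lt fun m hm => ?_
    rw [← hdet] at hm
    obtain ⟨δ, hδ, hδ0⟩ := ((mul_le_addHaar_image_of_lt_det lam M hm).and
      self_mem_nhdsWithin).exists
    obtain ⟨s, hs, hsN, hA⟩ := hsetup δ hδ0
    have hlampos : lam (ψ '' {x | r x < s}) ≠ 0 :=
      ((ψ.isOpen_image_of_subset_source (hr.isOpen_ball s) (hsN.trans hNs)).measure_pos lam
        ⟨ψ 1, mem_image_of_mem _ (hr.one_mem_ball hs)⟩).ne'
    have hn : ∀ n : ℕ, m ^ n * lam (ψ '' {x | r x < s}) ≤ lam (ψ '' {x | r x < t ^ n * s}) := by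
      intro n
      induction n with
      | zero => simp
      | succ n ih =>
        rw [← himg s n hs hsN, pow_succ', mul_assoc]
        exact (mul_le_mul_right ih _).trans (hδ _ _ (hA.mono_set (image_mono (hmono s n hs))))
    refine ENNReal.le_of_forall_pow_mul_le hlampos
      (ENNReal.mul_ne_top (ENNReal.coe_ne_top (r := C)) (hfin s hs)) fun n => ?_
    calc _ ≤ lam (ψ '' {x | r x < t ^ n * s}) := hn n
      _ ≤ C * μ {x | r x < t ^ n * s} := (hcomp _ ((hmono s n hs).trans hsN) (hr.isOpen_ball _)).1
      _ = _ := by rw [hr.measure_ball_pow_mul hμ ht]; ring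

/-- The Haar measure of a ball of radius `t` is `t ^ Q`. -/
theorem IsHomogeneousNorm.measure_ball (hr : D.IsHomogeneousNorm r)
    (hμ : μ {x | r x < 1} = 1) {t : ℝ} (ht : 0 < t) :
    μ {x | r x < t} = ENNReal.ofReal t ^ D.Q := by
  rw [ENNReal.ofReal_rpow_of_pos ht]
  rcases lt_trichotomy t 1 with h | h | h
  · exact hr.measure_ball_of_lt_one hμ ht h
  · simp [h, hμ]
  · have h1 := (hr.measure_ball_mul hμ ht).2 t⁻¹
    rw [mul_inv_cancel₀ ht.ne', hμ,
      hr.measure_ball_of_lt_one hμ (inv_pos.2 ht) (inv_lt_one_of_one_lt₀ h),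
      Real.inv_rpow ht.le, ENNReal.ofReal_inv_of_pos (Real.rpow_pos_of_pos ht _)] at h1
    rw [← inv_inv (ENNReal.ofReal _)]
    exact ENNReal.eq_inv_of_mul_eq_one_left h1.symm

end HomogeneousGroup

/-! ### Assembly: from homogeneous groups to radial weights. -/

theorem iSup_pos_lt_top_iff {F : ℝ → ℝ → ℝ≥0∞} :
    (⨆ (a₁ : ℝ) (_ : 0 < a₁) (a₂ : ℝ) (_ : 0 < a₂), F a₁ a₂) < ⊤ ↔
      ∃ A : ℝ≥0, ∀ a₁ a₂ : ℝ, 0 < a₁ → 0 < a₂ → F a₁ a₂ ≤ A := by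
  constructor
  · intro h
    refine ⟨(⨆ (a₁ : ℝ) (_ : 0 < a₁) (a₂ : ℝ) (_ : 0 < a₂), F a₁ a₂).toNNReal,
      fun a₁ a₂ h₁ h₂ => ?_⟩
    rw [ENNReal.coe_toNNReal h.ne]
    exact le_iSup₂_of_le a₁ h₁ (le_iSup₂_of_le a₂ h₂ le_rfl)
  · rintro ⟨A, hA⟩
    exact lt_of_le_of_lt (iSup₂_le fun a₁ h₁ => iSup₂_le fun a₂ h₂ => hA a₁ a₂ h₁ h₂)
      ENNReal.coe_lt_top

/-- Finiteness of the density makes the change of measure valid for arbitrary `g`, so it applies to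
powers of `f` and of its Hardy transform without a measurability check. -/
theorem setLIntegral_mul_ofReal {X : Type*} [MeasurableSpace X] {μ : Measure X} {ρ : X → ℝ}
    (hρ : AEMeasurable ρ μ) (g : X → ℝ≥0∞) {s : Set X} (hs : MeasurableSet s) :
    ∫⁻ x in s, g x * ENNReal.ofReal (ρ x) ∂μ =
      ∫⁻ x in s, g x ∂(μ.withDensity fun x => ENNReal.ofReal (ρ x)) := by
  rw [setLIntegral_withDensity_eq_setLIntegral_mul_non_measurable₀ _ _ _ hs
    (ae_of_all _ fun _ => ENNReal.ofReal_lt_top)]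
  · exact lintegral_congr fun x => mul_comm _ _
  · exact hρ.ennreal_ofReal.restrict

theorem lintegral_mul_ofReal {X : Type*} [MeasurableSpace X] {μ : Measure X} {ρ : X → ℝ}
    (hρ : AEMeasurable ρ μ) (g : X → ℝ≥0∞) :
    ∫⁻ x, g x * ENNReal.ofReal (ρ x) ∂μ =
      ∫⁻ x, g x ∂(μ.withDensity fun x => ENNReal.ofReal (ρ x)) := by
  simpa using setLIntegral_mul_ofReal hρ g MeasurableSet.univ

section

variable {E : Type*} [NormedAddCommGroup E] [NormedSpace ℝ E] [FiniteDimensional ℝ E]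
  {G : Type*} [TopologicalSpace G] [T2Space G] [SecondCountableTopology G]
  [ChartedSpace E G] [Group G] [LieGroup 𝓘(ℝ, E) ∞ G]
  [SimplyConnectedSpace G] [Group.IsNilpotent G] {D : HomogeneousGroup E G} {r : G → ℝ}

/-- The trace is a sum of positive eigenvalues. An empty sum would mean dimension zero, and a
discrete connected group is trivial. -/
theorem HomogeneousGroup.Q_pos [Nontrivial G] (D : HomogeneousGroup E G) : 0 < D.Q := by
  have : IsTopologicalGroup G := topologicalGroup_of_lieGroup 𝓘(ℝ, E) ∞
  obtain ⟨b, d, hbd⟩ := D.diagonalizable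
  rw [HomogeneousGroup.Q, trace_eq_sum_of_apply_basis fun i => (hbd i).2]
  rcases Nat.eq_zero_or_pos (Module.finrank ℝ E) with h0 | h0
  · have : Subsingleton E := Module.finrank_zero_iff.1 h0
    have hs : (chartAt E (1 : G)).source = {1} :=
      subset_antisymm (fun x hx => (chartAt E (1 : G)).injOn hx (mem_chart_source E 1)
        (Subsingleton.elim _ _)) (by simp)
    have : DiscreteTopology G := discreteTopology_of_isOpen_singleton_one
      (hs ▸ (chartAt E (1 : G)).open_source)
    have := PreconnectedSpace.trivial_of_discrete (X := G)
    exact absurd this (not_subsingleton G)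
  · exact Finset.sum_pos (fun i _ => (hbd i).1) ⟨⟨0, h0⟩, Finset.mem_univ _⟩

variable [MeasurableSpace G] [BorelSpace G] {μ : Measure G} [μ.IsHaarMeasure]

/-- A homogeneous norm and a weight of infinite mass on a homogeneous group. -/
theorem HomogeneousGroup.IsHomogeneousNorm.isRadialWeight (hr : D.IsHomogeneousNorm r)
    (hμ : μ (hball r 1 1) = 1) {w : G → ℝ} (hw : IsWeight μ w)
    (htop : ∫⁻ x, ENNReal.ofReal (w x) ∂μ = ⊤) :
    IsRadialWeight μ (μ.withDensity fun x => ENNReal.ofReal (w x)) r D.Q := by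
  rw [hr.hball_eq] at hμ
  -- On the trivial group the weight would have finite total mass; infinite mass thus forces `Q >
  -- 0`.
  have hnt : Nontrivial G := by
    by_contra hnt
    rw [not_nontrivial_iff_subsingleton] at hnt
    have hu : {x : G | r x < 1} = univ :=
      eq_univ_of_forall fun x => Subsingleton.elim 1 x ▸ hr.one_mem_ball one_pos
    rw [hu] at hμ
    have : ∫⁻ x, ENNReal.ofReal (w x) ∂μ = ∫⁻ _, ENNReal.ofReal (w 1) ∂μ :=
      lintegral_congr fun x => by rw [Subsingleton.elim x 1]
    rw [this, lintegral_const, hμ, mul_one] at htop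
    exact ENNReal.ofReal_ne_top htop
  exact {
    meas := hr.continuous.measurable
    nonneg := hr.nonneg
    pos := D.Q_pos
    ball := fun t ht => hr.measure_ball hμ ht
    ac := withDensity_absolutelyContinuous _ _
    ac' := withDensity_absolutelyContinuous' hw.1.ennreal_ofReal
      (ae_of_all _ fun x => (ENNReal.ofReal_pos.2 (hw.2 x)).ne')
    top := by rw [withDensity_apply _ MeasurableSet.univ, Measure.restrict_univ, htop] }

end

/-- Characterization of the boundedness of the double Hardy operator on decreasing functions in
terms of measures. -/
theorem hardy_bounded_iff {X₁ X₂ : Type*} [MeasurableSpace X₁] [MeasurableSpace X₂]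
    {μ₁ ρ₁ : Measure X₁} {μ₂ ρ₂ : Measure X₂} [SFinite μ₁] [SFinite μ₂] [SFinite ρ₁] [SFinite ρ₂]
    {r₁ : X₁ → ℝ} {r₂ : X₂ → ℝ} {Q₁ Q₂ p p' q : ℝ} {ν : Measure (X₁ × X₂)} [SFinite ν]
    (h₁ : IsRadialWeight μ₁ ρ₁ r₁ Q₁) (h₂ : IsRadialWeight μ₂ ρ₂ r₂ Q₂)
    (hp : p.HolderConjugate p') (hpq : p ≤ q) (hν : ν ≪ μ₁.prod μ₂) :
    (∃ C : ℝ≥0, ∀ f : X₁ × X₂ → ℝ≥0,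
      (∃ φ : ℝ → ℝ → ℝ≥0, (∀ τ, 0 < τ → AntitoneOn (fun t => φ t τ) (Ioi 0)) ∧
        (∀ t, 0 < t → AntitoneOn (fun τ => φ t τ) (Ioi 0)) ∧
        ∀ x y, 0 < r₁ x → 0 < r₂ y → f (x, y) = φ (r₁ x) (r₂ y)) →
      AEMeasurable f (μ₁.prod μ₂) → ∫⁻ z, (f z : ℝ≥0∞) ^ p ∂(ρ₁.prod ρ₂) ≠ ⊤ →
      (∫⁻ z, (∫⁻ s in {s | r₁ s < r₁ z.1} ×ˢ {s | r₂ s < r₂ z.2}, (f s : ℝ≥0∞)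
        ∂(μ₁.prod μ₂)) ^ q ∂ν) ^ (1 / q) ≤
        C * (∫⁻ z, (f z : ℝ≥0∞) ^ p ∂(ρ₁.prod ρ₂)) ^ (1 / p)) ↔
    (∃ A : ℝ≥0, ∀ s₁ s₂ : ℝ, 0 < s₁ → 0 < s₂ →
      radialMass ρ₁ r₁ s₁ ^ (-(1 / p)) * radialMass ρ₂ r₂ s₂ ^ (-(1 / p)) *
      (∫⁻ z in {x | r₁ x < s₁} ×ˢ {x | r₂ x < s₂},
        (ENNReal.ofReal (r₁ z.1) ^ Q₁ * ENNReal.ofReal (r₂ z.2) ^ Q₂) ^ q ∂ν) ^ (1 / q) ≤ A) ∧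
    (∃ A : ℝ≥0, ∀ s₁ s₂ : ℝ, 0 < s₁ → 0 < s₂ →
      radialDual ρ₁ r₁ Q₁ p' s₁ ^ (1 / p') * radialDual ρ₂ r₂ Q₂ p' s₂ ^ (1 / p') *
      (∫⁻ _ in {x | r₁ x < s₁}ᶜ ×ˢ {x | r₂ x < s₂}ᶜ, (1 * 1) ^ q ∂ν) ^ (1 / q) ≤ A) ∧
    (∃ A : ℝ≥0, ∀ s₁ s₂ : ℝ, 0 < s₁ → 0 < s₂ →
      radialMass ρ₁ r₁ s₁ ^ (-(1 / p)) * radialDual ρ₂ r₂ Q₂ p' s₂ ^ (1 / p') *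
      (∫⁻ z in {x | r₁ x < s₁} ×ˢ {x | r₂ x < s₂}ᶜ,
        (ENNReal.ofReal (r₁ z.1) ^ Q₁ * 1) ^ q ∂ν) ^ (1 / q) ≤ A) ∧
    (∃ A : ℝ≥0, ∀ s₁ s₂ : ℝ, 0 < s₁ → 0 < s₂ →
      radialDual ρ₁ r₁ Q₁ p' s₁ ^ (1 / p') * radialMass ρ₂ r₂ s₂ ^ (-(1 / p)) *
      (∫⁻ z in {x | r₁ x < s₁}ᶜ ×ˢ {x | r₂ x < s₂},
        (1 * ENNReal.ofReal (r₂ z.2) ^ Q₂) ^ q ∂ν) ^ (1 / q) ≤ A) := by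
  have hp0 := hp.pos
  have hq0 : 0 < q := hp0.trans_le hpq
  have hip : 0 < 1 / p := by positivity
  have hiq : 0 < 1 / q := by positivity
  constructor
  · rintro ⟨K, hK⟩
    have hK' : ∀ φ₁ φ₂ : ℝ → ℝ≥0, Antitone φ₁ → Antitone φ₂ →
        ∫⁻ z, ((φ₁ (r₁ z.1) * φ₂ (r₂ z.2) : ℝ≥0) : ℝ≥0∞) ^ p ∂(ρ₁.prod ρ₂) ≠ ⊤ →
        (∫⁻ z, (∫⁻ s in {s | r₁ s < r₁ z.1} ×ˢ {s | r₂ s < r₂ z.2},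
          ((φ₁ (r₁ s.1) * φ₂ (r₂ s.2) : ℝ≥0) : ℝ≥0∞) ∂(μ₁.prod μ₂)) ^ q ∂ν) ^ (1 / q) ≤
        K * (∫⁻ z, ((φ₁ (r₁ z.1) * φ₂ (r₂ z.2) : ℝ≥0) : ℝ≥0∞) ^ p ∂(ρ₁.prod ρ₂)) ^ (1 / p) := by
      intro φ₁ φ₂ hφ₁ hφ₂ hN
      refine hK (fun z => φ₁ (r₁ z.1) * φ₂ (r₂ z.2))
        ⟨fun t τ => φ₁ t * φ₂ τ, fun τ _ t _ t' _ htt' => mul_le_mul_left (hφ₁ htt') _,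
          fun t _ τ _ τ' _ hττ' => mul_le_mul_right (hφ₂ hττ') _, fun _ _ _ _ => rfl⟩ ?_ hN
      exact ((hφ₁.measurable.comp (h₁.meas.comp measurable_fst)).mul
        (hφ₂.measurable.comp (h₂.meas.comp measurable_snd))).aemeasurable
    have t₁ := h₁.hasHardyTests_ball hp0
    have t₂ := h₂.hasHardyTests_ball hp0
    obtain ⟨C₁, c₁⟩ := h₁.exists_hasHardyTests_compl hp
    obtain ⟨C₂, c₂⟩ := h₂.exists_hasHardyTests_compl hp
    have m₁ := h₁.measurableSet_ball
    have m₂ := h₂.measurableSet_ball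
    refine ⟨⟨1 * 1 * K, fun s₁ s₂ hs₁ hs₂ => ?_⟩, ⟨C₁ * C₂ * K, fun s₁ s₂ hs₁ hs₂ => ?_⟩,
      ⟨1 * C₂ * K, fun s₁ s₂ hs₁ hs₂ => ?_⟩, ⟨C₁ * 1 * K, fun s₁ s₂ hs₁ hs₂ => ?_⟩⟩
    · exact_mod_cast t₁.le h₁.meas h₂.meas hp0 hq0 t₂ m₁ m₂ hK' hs₁ hs₂
    · exact_mod_cast c₁.le h₁.meas h₂.meas hp0 hq0 c₂ (fun a => (m₁ a).compl)
        (fun a => (m₂ a).compl) hK' hs₁ hs₂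
    · exact_mod_cast t₁.le h₁.meas h₂.meas hp0 hq0 c₂ m₁ (fun a => (m₂ a).compl) hK' hs₁ hs₂
    · exact_mod_cast c₁.le h₁.meas h₂.meas hp0 hq0 t₂ (fun a => (m₁ a).compl) m₂ hK' hs₁ hs₂
  · rintro ⟨⟨A₁, hA₁⟩, ⟨A₂, hA₂⟩, ⟨A₃, hA₃⟩, ⟨A₄, hA₄⟩⟩
    obtain ⟨C, hC⟩ := exists_lintegral_hardy_rpow_le (A := A₁ + A₂ + A₃ + A₄) h₁ h₂ hp hpq hν
      (fun s₁ s₂ u₁ u₂ => (hA₁ s₁ s₂ u₁ u₂).trans (ENNReal.coe_le_coe.2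
        ((le_self_add.trans le_self_add).trans le_self_add)))
      (fun s₁ s₂ u₁ u₂ => (hA₂ s₁ s₂ u₁ u₂).trans (ENNReal.coe_le_coe.2
        ((le_add_self.trans le_self_add).trans le_self_add)))
      (fun s₁ s₂ u₁ u₂ => (hA₃ s₁ s₂ u₁ u₂).trans (ENNReal.coe_le_coe.2
        (le_add_self.trans le_self_add)))
      (fun s₁ s₂ u₁ u₂ => (hA₄ s₁ s₂ u₁ u₂).trans (ENNReal.coe_le_coe.2 le_add_self))
    refine ⟨C ^ (1 / q), fun f ⟨φ, hφ₁, hφ₂, hfφ⟩ hfm hN => ?_⟩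
    have hdec : ∀ x y x' y', 0 < r₁ x' → 0 < r₂ y' → r₁ x' ≤ r₁ x → r₂ y' ≤ r₂ y →
        f (x, y) ≤ f (x', y') := by
      intro x y x' y' hx' hy' hx hy
      rw [hfφ x y (hx'.trans_le hx) (hy'.trans_le hy), hfφ x' y' hx' hy']
      exact (hφ₁ _ (hy'.trans_le hy) hx' (hx'.trans_le hx) hx).trans
        (hφ₂ _ hx' hy' (hy'.trans_le hy) hy)
    have := ENNReal.rpow_le_rpow (hC f hdec (hfm.mono_ac (h₁.ac.prod h₂.ac)) hN) hiq.le
    rwa [ENNReal.mul_rpow_of_nonneg _ _ hiq.le, ← ENNReal.rpow_mul,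
      show q / p * (1 / q) = 1 / p by field_simp, ← ENNReal.coe_rpow_of_nonneg _ hiq.le] at this

section

variable {X₁ X₂ : Type*} [MeasurableSpace X₁] [MeasurableSpace X₂]
  {μ₁ ρ₁ : Measure X₁} {μ₂ ρ₂ : Measure X₂} [SFinite ρ₁] [SFinite ρ₂]
  {r₁ : X₁ → ℝ} {r₂ : X₂ → ℝ} {Q₁ Q₂ p p' : ℝ}

/-- For a product weight the integrand of condition (ii) factors. The negative power of the product
may be split because both masses are nonzero almost everywhere. -/
theorem setLIntegral_prod_radialDual (h₁ : IsRadialWeight μ₁ ρ₁ r₁ Q₁)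
    (h₂ : IsRadialWeight μ₂ ρ₂ r₂ Q₂) (s₁ s₂ : ℝ) :
    ∫⁻ z in {x | r₁ x < s₁} ×ˢ {x | r₂ x < s₂}, ENNReal.ofReal (r₁ z.1) ^ (Q₁ * p') *
      ENNReal.ofReal (r₂ z.2) ^ (Q₂ * p') *
      (radialMass ρ₁ r₁ (r₁ z.1) * radialMass ρ₂ r₂ (r₂ z.2)) ^ (-p') ∂(ρ₁.prod ρ₂) =
    radialDual ρ₁ r₁ Q₁ p' s₁ * radialDual ρ₂ r₂ Q₂ p' s₂ := by
  have hr₁ := h₁.meas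
  have hr₂ := h₂.meas
  have hW₁ := (IsRadialWeight.measurable_mass ρ₁ r₁).comp hr₁
  have hW₂ := (IsRadialWeight.measurable_mass ρ₂ r₂).comp hr₂
  rw [radialDual, radialDual, ← lintegral_prod_mul, Measure.prod_restrict]
  · refine setLIntegral_congr_fun_ae ((h₁.measurableSet_ball _).prod (h₂.measurableSet_ball _)) ?_
    filter_upwards [ae_prod_pos h₁ h₂] with z hz _
    rw [ENNReal.mul_rpow_of_ne_zero (h₁.mass_ne_zero hz.1) (h₂.mass_ne_zero hz.2)]
    ring
  · exact ((hr₁.ennreal_ofReal.pow_const _).mul (hW₁.pow_const _)).aemeasurable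
  · exact ((hr₂.ennreal_ofReal.pow_const _).mul (hW₂.pow_const _)).aemeasurable

end

theorem mainTheorem4
    {E₁ : Type*} [NormedAddCommGroup E₁] [NormedSpace ℝ E₁] [FiniteDimensional ℝ E₁]
    {G₁ : Type*} [TopologicalSpace G₁] [T2Space G₁] [SecondCountableTopology G₁]
    [ChartedSpace E₁ G₁] [Group G₁] [LieGroup 𝓘(ℝ, E₁) ∞ G₁]
    [SimplyConnectedSpace G₁] [Group.IsNilpotent G₁] [MeasurableSpace G₁] [BorelSpace G₁]
    {E₂ : Type*} [NormedAddCommGroup E₂] [NormedSpace ℝ E₂] [FiniteDimensional ℝ E₂]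
    {G₂ : Type*} [TopologicalSpace G₂] [T2Space G₂] [SecondCountableTopology G₂]
    [ChartedSpace E₂ G₂] [Group G₂] [LieGroup 𝓘(ℝ, E₂) ∞ G₂]
    [SimplyConnectedSpace G₂] [Group.IsNilpotent G₂] [MeasurableSpace G₂] [BorelSpace G₂]
    (D₁ : HomogeneousGroup E₁ G₁) (D₂ : HomogeneousGroup E₂ G₂)
    (r₁ : G₁ → ℝ) (hr₁ : D₁.IsHomogeneousNorm r₁)
    (r₂ : G₂ → ℝ) (hr₂ : D₂.IsHomogeneousNorm r₂)
    (μ₁ : Measure G₁) [μ₁.IsHaarMeasure] (hμ₁ : μ₁ (hball r₁ 1 1) = 1)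
    (μ₂ : Measure G₂) [μ₂.IsHaarMeasure] (hμ₂ : μ₂ (hball r₂ 1 1) = 1)
    (p q : ℝ) (hp : 1 < p) (hpq : p ≤ q)
    (v w : G₁ × G₂ → ℝ) (w₁ : G₁ → ℝ) (w₂ : G₂ → ℝ)
    (hv : IsWeight (μ₁.prod μ₂) v)
    (hw₁ : IsWeight μ₁ w₁) (hw₂ : IsWeight μ₂ w₂) (hw : ∀ x y, w (x, y) = w₁ x * w₂ y)
    (hW₁ : ∫⁻ x, ENNReal.ofReal (w₁ x) ∂μ₁ = ⊤)
    (hW₂ : ∫⁻ y, ENNReal.ofReal (w₂ y) ∂μ₂ = ⊤) :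
    BoundedOnDec μ₁ μ₂ r₁ r₂ p q w v (doubleHardy μ₁ μ₂ r₁ r₂ 1 1) ↔
      -- condition (i)
      (⨆ (a₁ : ℝ) (_ : 0 < a₁) (a₂ : ℝ) (_ : 0 < a₂),
        (∫⁻ z in hball r₁ 1 a₁ ×ˢ hball r₂ 1 a₂,
            ENNReal.ofReal (w z) ∂(μ₁.prod μ₂)) ^ (-(1 / p)) *
        (∫⁻ z in hball r₁ 1 a₁ ×ˢ hball r₂ 1 a₂,
            ENNReal.ofReal (r₁ z.1) ^ (D₁.Q * q) * ENNReal.ofReal (r₂ z.2) ^ (D₂.Q * q) *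
              ENNReal.ofReal (v z) ∂(μ₁.prod μ₂)) ^ (1 / q)) < ⊤ ∧
      -- condition (ii)
      (⨆ (a₁ : ℝ) (_ : 0 < a₁) (a₂ : ℝ) (_ : 0 < a₂),
        (∫⁻ z in hball r₁ 1 a₁ ×ˢ hball r₂ 1 a₂,
            ENNReal.ofReal (r₁ z.1) ^ (D₁.Q * p.conjExponent) *
              ENNReal.ofReal (r₂ z.2) ^ (D₂.Q * p.conjExponent) *
              ballMass₂ μ₁ μ₂ r₁ r₂ w (r₁ z.1) (r₂ z.2) ^ (-p.conjExponent) *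
              ENNReal.ofReal (w z) ∂(μ₁.prod μ₂)) ^ (1 / p.conjExponent) *
        (∫⁻ z in (hball r₁ 1 a₁)ᶜ ×ˢ (hball r₂ 1 a₂)ᶜ,
            ENNReal.ofReal (v z) ∂(μ₁.prod μ₂)) ^ (1 / q)) < ⊤ ∧
      -- condition (iii)
      (⨆ (a₁ : ℝ) (_ : 0 < a₁) (a₂ : ℝ) (_ : 0 < a₂),
        (∫⁻ x in hball r₁ 1 a₁, ENNReal.ofReal (w₁ x) ∂μ₁) ^ (-(1 / p)) *
        (∫⁻ y in hball r₂ 1 a₂,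
            ENNReal.ofReal (r₂ y) ^ (D₂.Q * p.conjExponent) *
              ballMass μ₂ r₂ w₂ (r₂ y) ^ (-p.conjExponent) *
              ENNReal.ofReal (w₂ y) ∂μ₂) ^ (1 / p.conjExponent) *
        (∫⁻ z in hball r₁ 1 a₁ ×ˢ (hball r₂ 1 a₂)ᶜ,
            ENNReal.ofReal (r₁ z.1) ^ (D₁.Q * q) *
              ENNReal.ofReal (v z) ∂(μ₁.prod μ₂)) ^ (1 / q)) < ⊤ ∧
      -- condition (iv)
      (⨆ (a₁ : ℝ) (_ : 0 < a₁) (a₂ : ℝ) (_ : 0 < a₂),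
        (∫⁻ x in hball r₁ 1 a₁,
            ENNReal.ofReal (r₁ x) ^ (D₁.Q * p.conjExponent) *
              ballMass μ₁ r₁ w₁ (r₁ x) ^ (-p.conjExponent) *
              ENNReal.ofReal (w₁ x) ∂μ₁) ^ (1 / p.conjExponent) *
        (∫⁻ y in hball r₂ 1 a₂, ENNReal.ofReal (w₂ y) ∂μ₂) ^ (-(1 / p)) *
        (∫⁻ z in (hball r₁ 1 a₁)ᶜ ×ˢ hball r₂ 1 a₂,
            ENNReal.ofReal (r₂ z.2) ^ (D₂.Q * q) *
              ENNReal.ofReal (v z) ∂(μ₁.prod μ₂)) ^ (1 / q)) < ⊤ := by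
  have hp0 : 0 < p := by linarith
  have hq0 : 0 < q := by linarith
  have hip : 0 < 1 / p := by positivity
  have hc : p.HolderConjugate p.conjExponent := Real.HolderConjugate.conjExponent hp
  have hic : 0 < 1 / p.conjExponent := one_div_pos.2 hc.symm.pos
  have : IsTopologicalGroup G₁ := topologicalGroup_of_lieGroup 𝓘(ℝ, E₁) ∞
  have : IsTopologicalGroup G₂ := topologicalGroup_of_lieGroup 𝓘(ℝ, E₂) ∞
  have : LocallyCompactSpace G₁ := Manifold.locallyCompact_of_finiteDimensional 𝓘(ℝ, E₁)
  have : LocallyCompactSpace G₂ := Manifold.locallyCompact_of_finiteDimensional 𝓘(ℝ, E₂)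
  set ρ₁ : Measure G₁ := μ₁.withDensity fun x => ENNReal.ofReal (w₁ x) with hρ₁
  set ρ₂ : Measure G₂ := μ₂.withDensity fun x => ENNReal.ofReal (w₂ x) with hρ₂
  set ν : Measure (G₁ × G₂) := (μ₁.prod μ₂).withDensity fun z => ENNReal.ofReal (v z) with hν
  have h₁ : IsRadialWeight μ₁ ρ₁ r₁ D₁.Q := hr₁.isRadialWeight hμ₁ hw₁ hW₁
  have h₂ : IsRadialWeight μ₂ ρ₂ r₂ D₂.Q := hr₂.isRadialWeight hμ₂ hw₂ hW₂
  have hwm : AEMeasurable w (μ₁.prod μ₂) := by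
    have : w = fun z => w₁ z.1 * w₂ z.2 := funext fun z => hw z.1 z.2
    rw [this]
    exact hw₁.1.comp_fst.mul hw₂.1.comp_snd
  have hprod : (μ₁.prod μ₂).withDensity (fun z => ENNReal.ofReal (w z)) = ρ₁.prod ρ₂ := by
    rw [hρ₁, hρ₂, prod_withDensity₀ hw₁.1.ennreal_ofReal hw₂.1.ennreal_ofReal]
    congr 1
    funext z
    rw [hw z.1 z.2, ENNReal.ofReal_mul (hw₁.2 _).le]
  have hb₁ := h₁.measurableSet_ball
  have hb₂ := h₂.measurableSet_ball
  have hmass₁ : ∀ a, ∫⁻ x in {x | r₁ x < a}, ENNReal.ofReal (w₁ x) ∂μ₁ = radialMass ρ₁ r₁ a :=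
    fun a => (withDensity_apply _ (hb₁ a)).symm
  have hmass₂ : ∀ a, ∫⁻ x in {x | r₂ x < a}, ENNReal.ofReal (w₂ x) ∂μ₂ = radialMass ρ₂ r₂ a :=
    fun a => (withDensity_apply _ (hb₂ a)).symm
  have hmass : ∀ a b, ∫⁻ z in {x | r₁ x < a} ×ˢ {x | r₂ x < b}, ENNReal.ofReal (w z)
      ∂(μ₁.prod μ₂) = radialMass ρ₁ r₁ a * radialMass ρ₂ r₂ b := fun a b => by
    rw [← withDensity_apply _ ((hb₁ a).prod (hb₂ b)), hprod, Measure.prod_prod]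
    rfl
  have hdual₁ : ∀ a, ∫⁻ x in {x | r₁ x < a}, ENNReal.ofReal (r₁ x) ^ (D₁.Q * p.conjExponent) *
      radialMass ρ₁ r₁ (r₁ x) ^ (-p.conjExponent) * ENNReal.ofReal (w₁ x) ∂μ₁ =
      radialDual ρ₁ r₁ D₁.Q p.conjExponent a := fun a => setLIntegral_mul_ofReal hw₁.1 _ (hb₁ a)
  have hdual₂ : ∀ a, ∫⁻ x in {x | r₂ x < a}, ENNReal.ofReal (r₂ x) ^ (D₂.Q * p.conjExponent) *
      radialMass ρ₂ r₂ (r₂ x) ^ (-p.conjExponent) * ENNReal.ofReal (w₂ x) ∂μ₂ =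
      radialDual ρ₂ r₂ D₂.Q p.conjExponent a := fun a => setLIntegral_mul_ofReal hw₂.1 _ (hb₂ a)
  have hdual : ∀ a b, ∫⁻ z in {x | r₁ x < a} ×ˢ {x | r₂ x < b},
      ENNReal.ofReal (r₁ z.1) ^ (D₁.Q * p.conjExponent) *
      ENNReal.ofReal (r₂ z.2) ^ (D₂.Q * p.conjExponent) *
      (radialMass ρ₁ r₁ (r₁ z.1) * radialMass ρ₂ r₂ (r₂ z.2)) ^ (-p.conjExponent) *
      ENNReal.ofReal (w z) ∂(μ₁.prod μ₂) =
      radialDual ρ₁ r₁ D₁.Q p.conjExponent a * radialDual ρ₂ r₂ D₂.Q p.conjExponent b :=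
    fun a b => by
      rw [setLIntegral_mul_ofReal hwm _ ((hb₁ a).prod (hb₂ b)), hprod,
        setLIntegral_prod_radialDual h₁ h₂]
  have hv₁ : ∀ a b, ∫⁻ z in {x | r₁ x < a} ×ˢ {x | r₂ x < b},
      ENNReal.ofReal (r₁ z.1) ^ (D₁.Q * q) * ENNReal.ofReal (r₂ z.2) ^ (D₂.Q * q) *
      ENNReal.ofReal (v z) ∂(μ₁.prod μ₂) = ∫⁻ z in {x | r₁ x < a} ×ˢ {x | r₂ x < b},
      (ENNReal.ofReal (r₁ z.1) ^ D₁.Q * ENNReal.ofReal (r₂ z.2) ^ D₂.Q) ^ q ∂ν := fun a b => by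
    rw [setLIntegral_mul_ofReal hv.1 _ ((hb₁ a).prod (hb₂ b))]
    simp only [ENNReal.mul_rpow_of_nonneg _ _ hq0.le, ENNReal.rpow_mul, hν]
  have hv₂ : ∀ a b, ∫⁻ z in {x | r₁ x < a}ᶜ ×ˢ {x | r₂ x < b}ᶜ,
      ENNReal.ofReal (v z) ∂(μ₁.prod μ₂) = ∫⁻ _ in {x | r₁ x < a}ᶜ ×ˢ {x | r₂ x < b}ᶜ,
      (1 * 1) ^ q ∂ν := fun a b => by
    rw [← setLIntegral_mul_ofReal hv.1 _ ((hb₁ a).compl.prod (hb₂ b).compl)]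
    simp
  have hv₃ : ∀ a b, ∫⁻ z in {x | r₁ x < a} ×ˢ {x | r₂ x < b}ᶜ,
      ENNReal.ofReal (r₁ z.1) ^ (D₁.Q * q) * ENNReal.ofReal (v z) ∂(μ₁.prod μ₂) =
      ∫⁻ z in {x | r₁ x < a} ×ˢ {x | r₂ x < b}ᶜ,
      (ENNReal.ofReal (r₁ z.1) ^ D₁.Q * 1) ^ q ∂ν := fun a b => by
    rw [setLIntegral_mul_ofReal hv.1 _ ((hb₁ a).prod (hb₂ b).compl)]
    simp only [mul_one, ENNReal.rpow_mul, hν]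
  have hv₄ : ∀ a b, ∫⁻ z in {x | r₁ x < a}ᶜ ×ˢ {x | r₂ x < b},
      ENNReal.ofReal (r₂ z.2) ^ (D₂.Q * q) * ENNReal.ofReal (v z) ∂(μ₁.prod μ₂) =
      ∫⁻ z in {x | r₁ x < a}ᶜ ×ˢ {x | r₂ x < b},
      (1 * ENNReal.ofReal (r₂ z.2) ^ D₂.Q) ^ q ∂ν := fun a b => by
    rw [setLIntegral_mul_ofReal hv.1 _ ((hb₁ a).compl.prod (hb₂ b))]
    simp only [one_mul, ENNReal.rpow_mul, hν]
  -- With a negative exponent the product rule fails at `0 * ⊤`; positive radii have nonzero mass,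
  -- which rules this out.
  have hneg : ∀ a b, 0 < a → 0 < b → (radialMass ρ₁ r₁ a * radialMass ρ₂ r₂ b) ^ (-(1 / p)) =
      radialMass ρ₁ r₁ a ^ (-(1 / p)) * radialMass ρ₂ r₂ b ^ (-(1 / p)) := fun a b ha hb =>
    ENNReal.mul_rpow_of_ne_zero (h₁.mass_ne_zero ha) (h₂.mass_ne_zero hb) _
  simp only [iSup_pos_lt_top_iff, ballMass, ballMass₂, hr₁.hball_eq, hr₂.hball_eq, hmass₁, hmass₂,
    hmass, hdual₁, hdual₂, hdual, hv₁, hv₂, hv₃, hv₄, ENNReal.mul_rpow_of_nonneg _ _ hic.le]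
  have key := hardy_bounded_iff h₁ h₂ hc hpq (withDensity_absolutelyContinuous _ _ : ν ≪ μ₁.prod μ₂)
  have hi : (∃ A : ℝ≥0, ∀ a₁ a₂ : ℝ, 0 < a₁ → 0 < a₂ →
      (radialMass ρ₁ r₁ a₁ * radialMass ρ₂ r₂ a₂) ^ (-(1 / p)) *
      (∫⁻ z in {x | r₁ x < a₁} ×ˢ {x | r₂ x < a₂},
        (ENNReal.ofReal (r₁ z.1) ^ D₁.Q * ENNReal.ofReal (r₂ z.2) ^ D₂.Q) ^ q ∂ν) ^ (1 / q) ≤ A) ↔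
      (∃ A : ℝ≥0, ∀ a₁ a₂ : ℝ, 0 < a₁ → 0 < a₂ →
      radialMass ρ₁ r₁ a₁ ^ (-(1 / p)) * radialMass ρ₂ r₂ a₂ ^ (-(1 / p)) *
      (∫⁻ z in {x | r₁ x < a₁} ×ˢ {x | r₂ x < a₂},
        (ENNReal.ofReal (r₁ z.1) ^ D₁.Q * ENNReal.ofReal (r₂ z.2) ^ D₂.Q) ^ q ∂ν) ^ (1 / q) ≤ A) :=
    exists_congr fun A => forall₄_congr fun a b ha hb => by rw [hneg a b ha hb]
  rw [hi]
  refine Iff.trans (exists_congr fun C => forall_congr' fun f => ?_) key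
  have hnorm : wNorm (μ₁.prod μ₂) p w (fun z => (f z : ℝ≥0∞)) =
      (∫⁻ z, (f z : ℝ≥0∞) ^ p ∂(ρ₁.prod ρ₂)) ^ (1 / p) := by
    rw [wNorm, lintegral_mul_ofReal hwm, hprod]
  have hnormv : wNorm (μ₁.prod μ₂) q v (doubleHardy μ₁ μ₂ r₁ r₂ 1 1 f) =
      (∫⁻ z, (∫⁻ s in {s | r₁ s < r₁ z.1} ×ˢ {s | r₂ s < r₂ z.2}, (f s : ℝ≥0∞)
        ∂(μ₁.prod μ₂)) ^ q ∂ν) ^ (1 / q) := by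
    rw [wNorm, lintegral_mul_ofReal hv.1]
    simp only [doubleHardy, one_mul, hr₁.hball_eq, hr₂.hball_eq]
    rfl
  have hrad : RadiallyDecreasing r₁ r₂ f ↔ ∃ φ : ℝ → ℝ → ℝ≥0,
      (∀ τ, 0 < τ → AntitoneOn (fun t => φ t τ) (Ioi 0)) ∧
      (∀ t, 0 < t → AntitoneOn (fun τ => φ t τ) (Ioi 0)) ∧
      ∀ x y, 0 < r₁ x → 0 < r₂ y → f (x, y) = φ (r₁ x) (r₂ y) := by
    have e₁ : ∀ x, 0 < r₁ x ↔ x ≠ 1 := fun x => by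
      rw [(hr₁.nonneg x).lt_iff_ne', Ne, hr₁.eq_zero_iff]
    have e₂ : ∀ x, 0 < r₂ x ↔ x ≠ 1 := fun x => by
      rw [(hr₂.nonneg x).lt_iff_ne', Ne, hr₂.eq_zero_iff]
    simp only [e₁, e₂]
    rfl
  rw [MemLpDec, hnorm, hnormv, hrad, ENNReal.rpow_lt_top_iff_of_pos hip, lt_top_iff_ne_top]
  exact ⟨fun h a b c => h ⟨b, a, c⟩, fun h ⟨a, b, c⟩ => h b a c⟩
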